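/- Let $d\in\mathbb N$, $\alpha\in(0,1]$, and let $P,Q$ be Borel probability measures on $\mathbb R^d$ such that: (i) $P$ is supported on a compact convex set $\mathcal X\subset\mathbb R^d$ with nonempty interior and has a Lebesgue density $\rho$ that is Lipschitz continuous and strictly positive on $\mathcal X$; (ii) $Q$ has finite support $\mathcal Y=\{y_1,\dots,y_N\}\subset\mathbb R^d$ and $\min_{1\le i\le N}Q(\{y_i\})\ge c_0$ for some constant $c_0\in(0,1)$. Let $\Pi(P,Q)$ be the set of couplings of $P$ and $Q$. Let $T^0$ be the Brenier map from $P$ to $Q$, i.e. the ($P$-a.e. unique) map for which $P\circ(\mathrm{id},T^0)^{-1}$ maximizes $\int\langle x,y\rangle\,d\pi(x,y)$ over $\pi\in\Pi(P,Q)$ (equivalently, minimizes $\int\|x-y\|^2\,d\pi(x,y)$). For $\varepsilon>0$ let $\pi^\varepsilon$ be the maximizer over $\pi\in\Pi(P,Q)$ of $\int\langle x,y\rangle\,d\pi(x,y)-\varepsilon D_{\mathsf{KL}}(\pi\,\|\,P\otimes Q)$, and let $T^\varepsilon(x)=\mathbb E_{(X,Y)\sim\pi^\varepsilon}[Y\mid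 X=x]$ be the entropic map. Let $\mathcal C^\alpha=\mathcal C^\alpha(\mathcal X;\mathbb R^d)$ be the space of vector fields $\varphi:\mathcal X\to\mathbb R^d$ with finite norm $$\|\varphi\|_{\mathcal C^\alpha}=\sup_{x\in\mathcal X}\|\varphi(x)\|+\sup_{x,y\in\mathcal X,\;x\ne y}\frac{\|\varphi(x)-\varphi(y)\|}{\|x-y\|^\alpha},$$ and let $\|\ell\|_{(\mathcal C^\alpha)^*}=\sup_{\|\varphi\|_{\mathcal C^\alpha}\le1}\ell(\varphi)$ be the norm of its topological dual, in which a map $T$ is identified with the continuous linear functional $\varphi\mapsto\langle\varphi,T\rangle_{L^2(P)}=\int_{\mathcal X}\langle\varphi(x),T(x)\rangle\,dP(x)$. Then there is a constant $C$ depending only on $\alpha,\mathcal X,\rho,\mathcal Y$ and $c_0$ (in particular, not on $\varepsilon$, nor on $Q$ otherwise) such that $$\|T^\varepsilon-T^0\|_{(\mathcal C^\alpha)^*}\le C\,\max\bigl\{\varepsilon^{1+\alpha},\ \varepsilon^2\log^3(1/\varepsilon)\bigr\}\qquad\text{for all }\varepsilon\in(0,1).$$ -/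

import Mathlib

open MeasureTheory ProbabilityTheory Set Filter
open scoped ENNReal

/-- `ℝᵈ` with the Euclidean norm and inner product. -/
abbrev Euc (d : ℕ) : Type := EuclideanSpace ℝ (Fin d)

/-! ### Hölder spaces of vector fields -/

section Holder

variable {d : ℕ} {X : Set (Euc d)}

/-- The `α`-Hölder norm `‖φ‖_∞ + sup_{x ≠ y} ‖φ x - φ y‖ / ‖x - y‖ ^ α` of a vector field
`φ : X → ℝᵈ`, with values in `[0, ∞]`. -/
noncomputable def eHolderNormField (α : ℝ) (φ : X → Euc d) : ℝ≥0∞ :=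
  (⨆ x : X, ‖φ x‖ₑ) +
    ⨆ (x : X) (y : X) (_ : x ≠ y), ‖φ x - φ y‖ₑ / ‖(x : Euc d) - (y : Euc d)‖ₑ ^ α

theorem eHolderNormField_zero (α : ℝ) : eHolderNormField α (0 : X → Euc d) = 0 := by
  simp [eHolderNormField]

theorem eHolderNormField_add_le (α : ℝ) (φ ψ : X → Euc d) :
    eHolderNormField α (φ + ψ) ≤ eHolderNormField α φ + eHolderNormField α ψ := by
  have h1 : (⨆ x : X, ‖(φ + ψ) x‖ₑ) ≤ (⨆ x : X, ‖φ x‖ₑ) + ⨆ x : X, ‖ψ x‖ₑ :=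
    iSup_le fun x => (enorm_add_le _ _).trans
      (add_le_add (le_iSup (fun x : X => ‖φ x‖ₑ) x) (le_iSup (fun x : X => ‖ψ x‖ₑ) x))
  have key : ∀ (χ : X → Euc d) (x y : X), x ≠ y →
      ‖χ x - χ y‖ₑ / ‖(x : Euc d) - (y : Euc d)‖ₑ ^ α ≤
      ⨆ (x : X) (y : X) (_ : x ≠ y), ‖χ x - χ y‖ₑ / ‖(x : Euc d) - (y : Euc d)‖ₑ ^ α :=
    fun χ x y h => le_iSup_of_le x (le_iSup_of_le y (le_iSup_of_le h le_rfl))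
  have h2 : (⨆ (x : X) (y : X) (_ : x ≠ y),
        ‖(φ + ψ) x - (φ + ψ) y‖ₑ / ‖(x : Euc d) - (y : Euc d)‖ₑ ^ α) ≤
      (⨆ (x : X) (y : X) (_ : x ≠ y), ‖φ x - φ y‖ₑ / ‖(x : Euc d) - (y : Euc d)‖ₑ ^ α) +
      ⨆ (x : X) (y : X) (_ : x ≠ y), ‖ψ x - ψ y‖ₑ / ‖(x : Euc d) - (y : Euc d)‖ₑ ^ α := by
    refine iSup_le fun x => iSup_le fun y => iSup_le fun h => ?_
    refine le_trans ?_ (add_le_add (key φ x y h) (key ψ x y h))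
    rw [← ENNReal.add_div]
    refine ENNReal.div_le_div_right ?_ _
    have : (φ + ψ) x - (φ + ψ) y = (φ x - φ y) + (ψ x - ψ y) := by
      simp only [Pi.add_apply]; abel
    rw [this]
    exact enorm_add_le _ _
  calc eHolderNormField α (φ + ψ) ≤ _ := add_le_add h1 h2
    _ = _ := by unfold eHolderNormField; exact add_add_add_comm _ _ _ _

theorem eHolderNormField_smul (α : ℝ) (c : ℝ) (φ : X → Euc d) :
    eHolderNormField α (c • φ) = ‖c‖ₑ * eHolderNormField α φ := by
  simp only [eHolderNormField, mul_add, ENNReal.mul_iSup, Pi.smul_apply, ← smul_sub, enorm_smul,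
    mul_div_assoc]

theorem eHolderNormField_eq_zero {α : ℝ} {φ : X → Euc d} (h : eHolderNormField α φ = 0) :
    φ = 0 := by
  have h1 : (⨆ x : X, ‖φ x‖ₑ) = 0 := (add_eq_zero.1 h).1
  funext x
  have h2 : ‖φ x‖ₑ ≤ 0 := h1 ▸ le_iSup (fun x : X => ‖φ x‖ₑ) x
  simpa using h2

end Holder

/-- The vector fields `X → ℝᵈ` of finite `α`-Hölder norm, as a linear subspace of all fields. -/
def holderSubmodule {d : ℕ} (α : ℝ) (X : Set (Euc d)) : Submodule ℝ (X → Euc d) where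
  carrier := {φ | eHolderNormField α φ ≠ ∞}
  zero_mem' := by simp [eHolderNormField_zero]
  add_mem' {φ ψ} hφ hψ :=
    ne_top_of_le_ne_top (ENNReal.add_ne_top.2 ⟨hφ, hψ⟩) (eHolderNormField_add_le α φ ψ)
  smul_mem' c φ hφ := by
    simp only [Set.mem_ofPred_eq, eHolderNormField_smul] at hφ ⊢
    exact ENNReal.mul_ne_top (by simp) hφ

/-- The space `C^α(X; ℝᵈ)` of `α`-Hölder vector fields on `X`. -/
def HolderSpace {d : ℕ} (α : ℝ) (X : Set (Euc d)) : Type := holderSubmodule α X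

namespace HolderSpace

variable {d : ℕ} {α : ℝ} {X : Set (Euc d)}

instance : AddCommGroup (HolderSpace α X) := inferInstanceAs (AddCommGroup (holderSubmodule α X))

instance : Module ℝ (HolderSpace α X) := inferInstanceAs (Module ℝ (holderSubmodule α X))

/-- The vector field underlying an element of `C^α(X; ℝᵈ)`. -/
def toField (φ : HolderSpace α X) : X → Euc d := φ.1

noncomputable instance : Norm (HolderSpace α X) := ⟨fun φ => (eHolderNormField α φ.toField).toReal⟩

theorem core : NormedSpace.Core ℝ (HolderSpace α X) where
  norm_nonneg _ := ENNReal.toReal_nonneg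
  norm_smul c φ := by
    change (eHolderNormField α (c • φ.1)).toReal = _ * (eHolderNormField α φ.1).toReal
    rw [eHolderNormField_smul, ENNReal.toReal_mul, toReal_enorm]
  norm_triangle φ ψ := by
    change (eHolderNormField α (φ.1 + ψ.1)).toReal ≤
      (eHolderNormField α φ.1).toReal + (eHolderNormField α ψ.1).toReal
    rw [← ENNReal.toReal_add φ.2 ψ.2]
    exact ENNReal.toReal_mono (ENNReal.add_ne_top.2 ⟨φ.2, ψ.2⟩) (eHolderNormField_add_le α _ _)
  norm_eq_zero_iff φ := by
    change (eHolderNormField α φ.1).toReal = 0 ↔ φ = 0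
    rw [ENNReal.toReal_eq_zero_iff]
    constructor
    · rintro (h | h)
      · exact Subtype.ext (eHolderNormField_eq_zero h)
      · exact absurd h φ.2
    · rintro rfl
      exact Or.inl (eHolderNormField_zero α)

noncomputable instance : NormedAddCommGroup (HolderSpace α X) := NormedAddCommGroup.ofCore core

noncomputable instance : NormedSpace ℝ (HolderSpace α X) := NormedSpace.ofCore core

end HolderSpace

/-- The continuous linear functional `ℓ` on `C^α(X; ℝᵈ)` is the one with which the map `T` is
identified, `ℓ φ = ⟨φ, T⟩_{L²(P)} = ∫_X ⟨φ x, T x⟩ dP(x)`; here `P` is a measure supported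
on `X`, and the integrals are required to exist. -/
def IsDualElement {d : ℕ} {α : ℝ} {X : Set (Euc d)} (P : Measure (Euc d)) (T : Euc d → Euc d)
    (ℓ : StrongDual ℝ (HolderSpace α X)) : Prop :=
  ∀ φ : HolderSpace α X,
    Integrable (fun x : X => inner ℝ (φ.toField x) (T x)) (P.comap (fun x : X => (x : Euc d))) ∧
    ℓ φ = ∫ x : X, inner ℝ (φ.toField x) (T x) ∂(P.comap (fun x : X => (x : Euc d)))

/-! ### Optimal transport and entropic optimal transport -/

section Transport

variable {d : ℕ}

/-- The set `Π(P, Q)` of couplings of `P` and `Q`. -/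
def couplings (P Q : Measure (Euc d)) : Set (Measure (Euc d × Euc d)) :=
  {π | π.fst = P ∧ π.snd = Q}

/-- `π` is an optimal coupling for quadratic optimal transport, in the equivalent form of the
maximization of `∫ ⟨x, y⟩ dπ(x, y)` over the couplings of `P` and `Q`. -/
def IsOTOptimal (P Q : Measure (Euc d)) (π : Measure (Euc d × Euc d)) : Prop :=
  π ∈ couplings P Q ∧ IsMaxOn (fun π' => ∫ p, inner ℝ p.1 p.2 ∂π') (couplings P Q) π

/-- `T` is a Brenier map from `P` to `Q`: the coupling `P ∘ (id, T)⁻¹` is optimal. -/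
def IsBrenierMap (P Q : Measure (Euc d)) (T : Euc d → Euc d) : Prop :=
  AEMeasurable T P ∧ IsOTOptimal P Q (P.map fun x => (x, T x))

/-- The objective `∫ ⟨x, y⟩ dπ(x, y) - ε KL(π ‖ P ⊗ Q)` of entropic optimal transport. -/
noncomputable def entropicObjective (P Q : Measure (Euc d)) (ε : ℝ)
    (π : Measure (Euc d × Euc d)) : EReal :=
  ((∫ p, inner ℝ p.1 p.2 ∂π : ℝ) : EReal) -
    ((ENNReal.ofReal ε * InformationTheory.klDiv π (P.prod Q) : ℝ≥0∞) : EReal)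

/-- `π` is an optimal coupling for entropic optimal transport with parameter `ε`. -/
def IsEOTOptimal (P Q : Measure (Euc d)) (ε : ℝ) (π : Measure (Euc d × Euc d)) : Prop :=
  π ∈ couplings P Q ∧ IsMaxOn (entropicObjective P Q ε) (couplings P Q) π

/-- `T` is an entropic map from `P` to `Q` with parameter `ε`: it is a version of
`x ↦ E[Y | X = x]`, where `(X, Y)` has as its law an optimal entropic coupling `π`; that is,
`T(X)` is the conditional expectation of `Y` given `σ(X)` under `π`. -/
def IsEntropicMap (P Q : Measure (Euc d)) (ε : ℝ) (T : Euc d → Euc d) : Prop :=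
  AEMeasurable T P ∧ ∃ π : Measure (Euc d × Euc d), IsEOTOptimal P Q ε π ∧
    (fun p : Euc d × Euc d => T p.1) =ᵐ[π]
      π[(fun p : Euc d × Euc d => p.2) |
        MeasurableSpace.comap (fun p : Euc d × Euc d => p.1) inferInstance]

/-! ### Conditions on the marginals -/

/-- `P` is a probability measure on the compact convex set `X`, which has nonempty interior, with a
Lebesgue density `ρ` that is Lipschitz and strictly positive on `X`. -/
structure SourceCondition (X : Set (Euc d)) (ρ : Euc d → ℝ) (P : Measure (Euc d)) : Prop where
  isCompact : IsCompact X
  convex : Convex ℝ X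
  nonempty_interior : (interior X).Nonempty
  lipschitz : ∃ K, LipschitzOnWith K ρ X
  pos : ∀ x ∈ X, 0 < ρ x
  isProbabilityMeasure : IsProbabilityMeasure P
  density : P = (volume.restrict X).withDensity fun x => ENNReal.ofReal (ρ x)

/-- `Q` is a finitely discrete probability measure with support `Y` all of whose atoms have mass at
least `c₀`. -/
structure TargetCondition (Y : Finset (Euc d)) (c₀ : ℝ) (Q : Measure (Euc d)) : Prop where
  isProbabilityMeasure : IsProbabilityMeasure Q
  support_eq : Q.support = (Y : Set (Euc d))
  mass_ge : ∀ y ∈ Y, c₀ ≤ Q.real {y}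

end Transport

/-!
Write `fᵢ x = ⟪x, yᵢ⟫ - zᵢ` for the score of the target `yᵢ`. The Brenier map is `yᵢ` on the
Laguerre cell where `fᵢ` is maximal, for weights `z⁰` whose cells have the masses `Q {yᵢ}`, by
complementary slackness (`IsBrenierMap.ae_exists_mem_lagCell`). The entropic map is the mean of
the targets with respect to the Gibbs weights `gibbs y z ε i ∝ exp (fᵢ / ε)`, for weights `z^ε`
whose Gibbs weights have the integrals `Q {yᵢ}`, by Gibbs' variational principle
(`IsEntropicMap.ae_eq_sum_gibbs`). Both `z⁰` and `z^ε` minimize a convex function of their own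
(`exists_integral_eq_of_potential`).

For a common `z`, Gibbs weights and cells differ substantially only at distance `O(ε)` from the
facets, and there the reflection across the hyperplane `fᵢ = fⱼ` exchanges what one cell loses
with what the other gains. Hence a Hölder weight feels the difference only through its variation
over the distance `ε`, which makes `ε ^ (1 + α)` out of the volume `O(ε)`. The reflection is
defective near the points where three scores are nearly equal, of volume `O(ε ^ 2)`, and near the
boundary of `X`, where convexity limits the defect within distance `t` of the hyperplane to volume
`O(t ^ 2)` (`exists_volume_hyperRefl_notMem_le`); `t` of order `ε log (1 / ε)` gives the
logarithms. The result is `exists_abs_integral_gibbs_sub_indicator_le`, uniformly in all `z` whose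
cells have volume bounded below.

With `z = z^ε` and constant weights, it says that the cells for `z^ε` have nearly the masses
`Q {yᵢ}`. The masses determine the weights in a Lipschitz way, by an isoperimetric inequality for
convex sets (`exists_abs_sub_le_sum_measureReal_lagCell`), and the cells depend on the weights in
a Lipschitz way (`exists_volume_lagCell_diff_le`). So the cells for `z^ε` and for `z⁰` differ in
volume by no more than the rate. Together the two comparisons bound the pairing of the difference
of the maps with a Hölder field (`SourceCondition.exists_abs_integral_gibbs_sub_optimal_le`). The
logarithms first enter as `ε ^ 2 log ^ 2 (1 / ε)`, which the maximum in the theorem dominates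
(`rpow_add_sq_mul_log_sq_le`).
-/

/-! ### Integrals over strips -/

section Strips

variable {d : ℕ}

/-- Averaging over the translates by `s • w`, `0 ≤ s ≤ 1`, bounds the integral of a function of
`⟪x, u⟫` by its integral over the line. The factor `k`, invariant under these translations, allows
the bound to be iterated. -/
lemma lintegral_ball_slab_le {u w : Euc d} (huw : inner ℝ w u = 1) {g : ℝ → ℝ≥0∞}
    (hg : Measurable g) {k : Euc d → ℝ≥0∞} (hk : Measurable k)
    (hkw : ∀ x (s : ℝ), k (x - s • w) = k x) (R a : ℝ) :
    ∫⁻ x in Metric.ball 0 R, g (inner ℝ x u - a) * k x ≤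
      (∫⁻ t, g t) * ∫⁻ x in Metric.ball 0 (R + ‖w‖), k x := by
  have key : ∀ s ∈ Icc (0 : ℝ) 1, ∫⁻ x in Metric.ball 0 R, g (inner ℝ x u - a) * k x ≤
      ∫⁻ x in Metric.ball 0 (R + ‖w‖), g (inner ℝ x u - a - s) * k x := by
    intro s hs
    rw [← lintegral_indicator measurableSet_ball, ← lintegral_indicator measurableSet_ball,
      ← lintegral_sub_right_eq_self _ (s • w)]
    refine lintegral_mono fun x => ?_
    by_cases hx : x - s • w ∈ Metric.ball (0 : Euc d) R
    · have hx' : x ∈ Metric.ball (0 : Euc d) (R + ‖w‖) := by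
        rw [mem_ball_zero_iff] at hx ⊢
        have h1 : ‖x‖ ≤ ‖x - s • w‖ + ‖s • w‖ := by
          simpa using norm_add_le (x - s • w) (s • w)
        have h2 : ‖s • w‖ ≤ ‖w‖ := by
          rw [norm_smul, Real.norm_of_nonneg hs.1]
          exact mul_le_of_le_one_left (norm_nonneg _) hs.2
        linarith
      rw [indicator_of_mem hx, indicator_of_mem hx', hkw, inner_sub_left, real_inner_smul_left, huw,
        mul_one, sub_right_comm]
    · rw [indicator_of_notMem hx]; exact zero_le
  have hm : Measurable fun p : ℝ × Euc d => g (inner ℝ p.2 u - a - p.1) * k p.2 := by fun_prop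
  calc ∫⁻ x in Metric.ball 0 R, g (inner ℝ x u - a) * k x
      = ∫⁻ _s in Icc (0 : ℝ) 1, ∫⁻ x in Metric.ball 0 R, g (inner ℝ x u - a) * k x := by simp
    _ ≤ ∫⁻ s in Icc (0 : ℝ) 1,
          ∫⁻ x in Metric.ball 0 (R + ‖w‖), g (inner ℝ x u - a - s) * k x :=
        setLIntegral_mono' measurableSet_Icc key
    _ = ∫⁻ x in Metric.ball 0 (R + ‖w‖),
          ∫⁻ s in Icc (0 : ℝ) 1, g (inner ℝ x u - a - s) * k x :=
        lintegral_lintegral_swap hm.aemeasurable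
    _ ≤ ∫⁻ x in Metric.ball 0 (R + ‖w‖), (∫⁻ t, g t) * k x := by
        refine lintegral_mono fun x => ?_
        rw [lintegral_mul_const _ (by fun_prop)]
        refine mul_le_mul_left ?_ _
        calc ∫⁻ s in Icc (0 : ℝ) 1, g (inner ℝ x u - a - s)
            ≤ ∫⁻ s, g (inner ℝ x u - a - s) := setLIntegral_le_lintegral _ _
          _ = ∫⁻ t, g t := lintegral_sub_left_eq_self g _
    _ = _ := lintegral_const_mul _ hk

lemma exists_lintegral_slab_le {X : Set (Euc d)} (hX : Bornology.IsBounded X) {u : Euc d}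
    (hu : u ≠ 0) : ∃ C : ℝ, 0 < C ∧ ∀ (a : ℝ) (g : ℝ → ℝ≥0∞), Measurable g →
      ∫⁻ x in X, g (inner ℝ x u - a) ≤ ENNReal.ofReal C * ∫⁻ t, g t := by
  obtain ⟨R, hR⟩ := hX.subset_ball (0 : Euc d)
  set w : Euc d := (‖u‖ ^ 2)⁻¹ • u
  have hw : inner ℝ w u = 1 := by
    have : ‖u‖ ≠ 0 := norm_ne_zero_iff.2 hu
    rw [real_inner_smul_left, real_inner_self_eq_norm_sq]; field_simp
  refine ⟨volume.real (Metric.ball (0 : Euc d) (R + ‖w‖)) + 1, by positivity, fun a g hg => ?_⟩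
  calc ∫⁻ x in X, g (inner ℝ x u - a) ≤ ∫⁻ x in Metric.ball 0 R, g (inner ℝ x u - a) * 1 := by
        simpa using lintegral_mono_set hR
    _ ≤ (∫⁻ t, g t) * ∫⁻ x in Metric.ball 0 (R + ‖w‖), 1 :=
        lintegral_ball_slab_le hw hg measurable_const (fun _ _ => rfl) R a
    _ ≤ _ := by
        rw [mul_comm, setLIntegral_one]
        gcongr
        rw [← ENNReal.ofReal_toReal (measure_ball_lt_top (μ := volume) (x := (0 : Euc d))).ne]
        exact ENNReal.ofReal_le_ofReal (by simp [Measure.real])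

/-- The two-dimensional version of `exists_lintegral_slab_le`. -/
lemma exists_lintegral_slab_mul_le {X : Set (Euc d)} (hX : Bornology.IsBounded X) {u v : Euc d}
    (hv : v ≠ 0) (huv : ∀ c : ℝ, u ≠ c • v) : ∃ C : ℝ, 0 < C ∧ ∀ (a b : ℝ) (g k : ℝ → ℝ≥0∞),
      Measurable g → Measurable k →
      ∫⁻ x in X, g (inner ℝ x u - a) * k (inner ℝ x v - b) ≤
        ENNReal.ofReal C * ((∫⁻ t, g t) * ∫⁻ t, k t) := by
  obtain ⟨R, hR⟩ := hX.subset_ball (0 : Euc d)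
  -- The component of `u` orthogonal to `v` is a direction along which only `⟪x, u⟫` varies.
  set w₀ : Euc d := u - (inner ℝ u v / ‖v‖ ^ 2) • v with hw₀
  have hv' : ‖v‖ ≠ 0 := norm_ne_zero_iff.2 hv
  have hw₀v : inner ℝ w₀ v = 0 := by
    rw [hw₀, inner_sub_left, real_inner_smul_left, real_inner_self_eq_norm_sq]; field_simp; simp
  have hw₀0 : w₀ ≠ 0 := fun h => huv _ (sub_eq_zero.1 h)
  have hw₀u : inner ℝ w₀ u = ‖w₀‖ ^ 2 := by
    have : u = w₀ + (inner ℝ u v / ‖v‖ ^ 2) • v := by rw [hw₀]; abel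
    nth_rewrite 1 [this]
    rw [inner_add_right, real_inner_smul_right, hw₀v, real_inner_self_eq_norm_sq, mul_zero,
      add_zero]
  set w : Euc d := (‖w₀‖ ^ 2)⁻¹ • w₀
  have hwu : inner ℝ w u = 1 := by
    have : ‖w₀‖ ≠ 0 := norm_ne_zero_iff.2 hw₀0
    rw [real_inner_smul_left, hw₀u]; field_simp
  have hwv : inner ℝ w v = 0 := by rw [real_inner_smul_left, hw₀v, mul_zero]
  obtain ⟨C, hC, H⟩ := exists_lintegral_slab_le
    (Metric.isBounded_ball (x := (0 : Euc d)) (r := R + ‖w‖)) hv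
  refine ⟨C, hC, fun a b g k hg hk => ?_⟩
  calc ∫⁻ x in X, g (inner ℝ x u - a) * k (inner ℝ x v - b)
      ≤ ∫⁻ x in Metric.ball 0 R, g (inner ℝ x u - a) * k (inner ℝ x v - b) := lintegral_mono_set hR
    _ ≤ (∫⁻ t, g t) * ∫⁻ x in Metric.ball 0 (R + ‖w‖), k (inner ℝ x v - b) :=
        lintegral_ball_slab_le (k := fun x => k (inner ℝ x v - b)) hwu hg (by fun_prop)
          (fun x s => by rw [inner_sub_left, real_inner_smul_left, hwv, mul_zero, sub_zero]) R a
    _ ≤ (∫⁻ t, g t) * (ENNReal.ofReal C * ∫⁻ t, k t) := by gcongr; exact H b k hk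
    _ = _ := by ring

lemma lintegral_exp_neg_abs_div {ε : ℝ} (hε : 0 < ε) :
    ∫⁻ t : ℝ, ENNReal.ofReal (Real.exp (-|t| / ε)) = ENNReal.ofReal (2 * ε) := by
  have h2 : ∫ t in Ioi (0 : ℝ), Real.exp (-t / ε) = ε := by
    have := integral_exp_mul_Ioi (a := -ε⁻¹) (by simpa) 0
    simpa [neg_div, div_eq_inv_mul] using this
  have h3 : ∫ t : ℝ, Real.exp (-|t| / ε) = 2 * ε := by
    rw [integral_comp_abs (f := fun t => Real.exp (-t / ε)), h2]
  rw [← ofReal_integral_eq_lintegral_ofReal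
    (Integrable.of_integral_ne_zero (by rw [h3]; positivity))
    (ae_of_all _ fun t => (Real.exp_pos _).le), h3]

/-- Strips of width `t` meet a bounded set in volume `O(t)`. -/
lemma exists_volume_slab_le {X : Set (Euc d)} (hX : Bornology.IsBounded X) {u : Euc d}
    (hu : u ≠ 0) : ∃ C : ℝ, 0 < C ∧ ∀ a t : ℝ, 0 ≤ t →
      volume.real {x ∈ X | |inner ℝ x u - a| ≤ t} ≤ C * t := by
  obtain ⟨C, hC, H⟩ := exists_lintegral_slab_le hX hu
  refine ⟨2 * C, by positivity, fun a t ht => ?_⟩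
  have h1 := H a ((Icc (-t) t).indicator 1) (measurable_one.indicator measurableSet_Icc)
  rw [lintegral_indicator_one measurableSet_Icc, Real.volume_Icc, sub_neg_eq_add,
    ← ENNReal.ofReal_mul hC.le] at h1
  have h2 : volume {x ∈ X | |inner ℝ x u - a| ≤ t} ≤ ENNReal.ofReal (C * (t + t)) := by
    refine le_trans ?_ h1
    have hm : MeasurableSet {x : Euc d | |inner ℝ x u - a| ≤ t} :=
      measurableSet_le (by fun_prop) measurable_const
    calc volume {x ∈ X | |inner ℝ x u - a| ≤ t}
        = volume.restrict X {x : Euc d | |inner ℝ x u - a| ≤ t} := by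
          rw [Measure.restrict_apply hm, inter_comm]; rfl
      _ = ∫⁻ x in X, {x : Euc d | |inner ℝ x u - a| ≤ t}.indicator 1 x :=
          (lintegral_indicator_one hm).symm
      _ ≤ _ := by
          refine lintegral_mono fun x => ?_
          by_cases hx : |inner ℝ x u - a| ≤ t
          · simp [hx, abs_le.1 hx]
          · simp [hx]
  calc volume.real _ ≤ (ENNReal.ofReal (C * (t + t))).toReal :=
        ENNReal.toReal_mono ENNReal.ofReal_ne_top h2
    _ = 2 * C * t := by rw [ENNReal.toReal_ofReal (by positivity)]; ring

lemma exists_integral_exp_slab_le {X : Set (Euc d)} (hX : Bornology.IsBounded X) {u : Euc d}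
    (hu : u ≠ 0) : ∃ C : ℝ, 0 < C ∧ ∀ a ε : ℝ, 0 < ε →
      ∫ x in X, Real.exp (-|inner ℝ x u - a| / ε) ≤ C * ε := by
  obtain ⟨C, hC, H⟩ := exists_lintegral_slab_le hX hu
  refine ⟨2 * C, by positivity, fun a ε hε => ?_⟩
  rw [integral_eq_lintegral_of_nonneg_ae (ae_of_all _ fun x => (Real.exp_pos _).le)
    (by fun_prop)]
  refine ENNReal.toReal_le_of_le_ofReal (by positivity) ?_
  refine (H a (fun t => ENNReal.ofReal (Real.exp (-|t| / ε))) (by fun_prop)).trans_eq ?_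
  rw [lintegral_exp_neg_abs_div hε, ← ENNReal.ofReal_mul hC.le]
  ring_nf

lemma exists_integral_exp_slab_mul_le {X : Set (Euc d)} (hX : Bornology.IsBounded X) {u v : Euc d}
    (hv : v ≠ 0) (huv : ∀ c : ℝ, u ≠ c • v) : ∃ C : ℝ, 0 < C ∧ ∀ a b ε : ℝ, 0 < ε →
      ∫ x in X, Real.exp (-|inner ℝ x u - a| / ε) * Real.exp (-|inner ℝ x v - b| / ε) ≤
        C * ε ^ 2 := by
  obtain ⟨C, hC, H⟩ := exists_lintegral_slab_mul_le hX hv huv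
  refine ⟨4 * C, by positivity, fun a b ε hε => ?_⟩
  rw [integral_eq_lintegral_of_nonneg_ae (ae_of_all _ fun x => by positivity)
    (by fun_prop)]
  refine ENNReal.toReal_le_of_le_ofReal (by positivity) ?_
  have := H a b (fun t => ENNReal.ofReal (Real.exp (-|t| / ε)))
    (fun t => ENNReal.ofReal (Real.exp (-|t| / ε))) (by fun_prop) (by fun_prop)
  simp_rw [← ENNReal.ofReal_mul (Real.exp_pos _).le] at this
  refine this.trans_eq ?_
  rw [lintegral_exp_neg_abs_div hε, ← ENNReal.ofReal_mul (by positivity),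
    ← ENNReal.ofReal_mul hC.le]
  ring_nf

end Strips

/-! ### An isoperimetric inequality for convex sets -/

section Isoperimetric

variable {d : ℕ}

lemma volume_preimage_add_smul (c : Euc d) {t : ℝ} (ht : 1 / 2 ≤ t) (T : Set (Euc d)) :
    volume ((fun w => c + t • w) ⁻¹' T) ≤ 2 ^ d * volume T := by
  have h1 : (fun w : Euc d => c + t • w) ⁻¹' T = (t • ·) ⁻¹' ((c + ·) ⁻¹' T) := rfl
  have ht0 : 0 < t := by linarith
  rw [h1, Measure.addHaar_preimage_smul _ ht0.ne', measure_preimage_add]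
  gcongr
  have h2 : |(t ^ Module.finrank ℝ (Euc d))⁻¹| ≤ 2 ^ d := by
    rw [finrank_euclideanSpace, Fintype.card_fin, abs_of_pos (by positivity), ← inv_pow]
    gcongr
    exact inv_le_of_inv_le₀ (by norm_num) (by linarith)
  calc ENNReal.ofReal _ ≤ ENNReal.ofReal (2 ^ d) := ENNReal.ofReal_le_ofReal h2
    _ = 2 ^ d := by rw [ENNReal.ofReal_pow (by norm_num)]; simp

/-- For each `t`, either `1 - t` or `t` is at least `1 / 2`, so one of the variables can be changed
at the cost of a factor `2 ^ d`. -/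
lemma lintegral_lintegral_lineMap_le (X : Set (Euc d)) {T : Set (Euc d)} (hT : MeasurableSet T)
    (t : ℝ) : ∫⁻ x in X, ∫⁻ w in X, T.indicator 1 (AffineMap.lineMap x w t) ≤
      2 ^ d * volume T * volume X := by
  have hind : ∀ (c : Euc d) (s : ℝ), 1 / 2 ≤ s →
      ∫⁻ w in X, T.indicator (1 : Euc d → ℝ≥0∞) (c + s • w) ≤ 2 ^ d * volume T := by
    intro c s hs
    calc ∫⁻ w in X, T.indicator (1 : Euc d → ℝ≥0∞) (c + s • w)
        ≤ ∫⁻ w, T.indicator (1 : Euc d → ℝ≥0∞) (c + s • w) := setLIntegral_le_lintegral _ _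
      _ = ∫⁻ w, ((fun w => c + s • w) ⁻¹' T).indicator (1 : Euc d → ℝ≥0∞) w := rfl
      _ = volume ((fun w => c + s • w) ⁻¹' T) := lintegral_indicator_one (hT.preimage (by fun_prop))
      _ ≤ _ := volume_preimage_add_smul c hs T
  have hm : Measurable fun p : Euc d × Euc d =>
      T.indicator (1 : Euc d → ℝ≥0∞) (AffineMap.lineMap p.1 p.2 t) := by
    simp_rw [AffineMap.lineMap_apply_module]
    exact (measurable_one.indicator hT).comp (by fun_prop)
  rcases le_total (1 / 2) t with ht | ht
  · calc _ ≤ ∫⁻ _x in X, 2 ^ d * volume T := by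
          refine lintegral_mono fun x => ?_
          simp_rw [AffineMap.lineMap_apply_module]
          exact hind _ _ ht
      _ = _ := by rw [setLIntegral_const]
  · rw [lintegral_lintegral_swap hm.aemeasurable]
    calc _ ≤ ∫⁻ _x in X, 2 ^ d * volume T := by
          refine lintegral_mono fun x => ?_
          simp_rw [AffineMap.lineMap_apply_module, add_comm ((1 - t) • _)]
          exact hind _ _ (by linarith)
      _ = _ := by rw [setLIntegral_const]

/-- A segment along which a Lipschitz function crosses the values between `0` and `g` spends a
time of order `g` there. -/
lemma ofReal_le_volume_lineMap {K : NNReal} {h : Euc d → ℝ} (hh : LipschitzWith K h) {g : ℝ}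
    {x w : Euc d} (hx : h x ≤ 0) (hw : g ≤ h w) :
    ENNReal.ofReal g ≤ K * ‖x - w‖₊ *
      volume {t ∈ Icc (0 : ℝ) 1 | 0 < h (AffineMap.lineMap x w t) ∧
        h (AffineMap.lineMap x w t) < g} := by
  set φ : ℝ → ℝ := fun t => h (AffineMap.lineMap x w t) with hφ
  have hL : LipschitzWith (K * ‖x - w‖₊) φ := by
    refine hh.comp ?_
    refine LipschitzWith.of_dist_le_mul fun s t => ?_
    rw [dist_lineMap_lineMap, dist_eq_norm x w, coe_nnnorm, mul_comm]
  set A := {t ∈ Icc (0 : ℝ) 1 | 0 < φ t ∧ φ t < g}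
  have hsub : Ioo 0 g ⊆ φ '' A := by
    intro s hs
    obtain ⟨t, ht, rfl⟩ := intermediate_value_Icc (zero_le_one (α := ℝ)) hL.continuous.continuousOn
      (show s ∈ Icc (φ 0) (φ 1) by simp only [hφ, AffineMap.lineMap_apply_zero,
        AffineMap.lineMap_apply_one]; exact ⟨hx.trans hs.1.le, hs.2.le.trans hw⟩)
    exact ⟨t, ⟨ht, hs⟩, rfl⟩
  have h1 := hL.hausdorffMeasure_image_le zero_le_one A
  rw [hausdorffMeasure_real] at h1
  calc ENNReal.ofReal g = volume (Ioo 0 g) := by rw [Real.volume_Ioo, sub_zero]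
    _ ≤ volume (φ '' A) := measure_mono hsub
    _ ≤ _ := by simpa using h1

lemma lintegral_rotate {α β γ : Type*} [MeasurableSpace α] [MeasurableSpace β] [MeasurableSpace γ]
    {F : α × β × γ → ℝ≥0∞} (hF : Measurable F) (μ : Measure α) (ν : Measure β) (τ : Measure γ)
    [SFinite μ] [SFinite ν] [SFinite τ] :
    ∫⁻ x, ∫⁻ w, ∫⁻ t, F (x, w, t) ∂τ ∂ν ∂μ = ∫⁻ t, ∫⁻ x, ∫⁻ w, F (x, w, t) ∂ν ∂μ ∂τ := by
  have h1 : ∀ x, ∫⁻ w, ∫⁻ t, F (x, w, t) ∂τ ∂ν = ∫⁻ t, ∫⁻ w, F (x, w, t) ∂ν ∂τ := fun x =>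
    lintegral_lintegral_swap
      (hF.comp (by fun_prop : Measurable fun q : β × γ => (x, q.1, q.2))).aemeasurable
  simp_rw [h1]
  refine lintegral_lintegral_swap (Measurable.aemeasurable ?_)
  have h2 : Measurable fun q : (α × γ) × β => F (q.1.1, q.2, q.1.2) :=
    hF.comp (by fun_prop : Measurable fun q : (α × γ) × β => (q.1.1, q.2, q.1.2))
  exact h2.lintegral_prod_right'

/-- If a Lipschitz function is `≤ 0` and `≥ g` on substantial parts of a bounded convex set, then
the set where it lies strictly between has volume of order at least `g`: integrate the time which
the segments between the two parts spend there. -/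
lemma exists_volume_between_ge {X : Set (Euc d)} (hXc : Convex ℝ X) (hXb : Bornology.IsBounded X)
    (hXm : MeasurableSet X) (K : NNReal) {a : ℝ} (ha : 0 < a) :
    ∃ c : ℝ, 0 < c ∧ ∀ h : Euc d → ℝ, LipschitzWith K h → ∀ g : ℝ,
      a ≤ volume.real {x ∈ X | h x ≤ 0} → a ≤ volume.real {x ∈ X | g ≤ h x} →
      c * g ≤ volume.real {x ∈ X | 0 < h x ∧ h x < g} := by
  obtain ⟨R, hR0, hR⟩ := hXb.subset_ball_lt 0 (0 : Euc d)
  have hXfin : volume X ≠ ∞ := hXb.measure_lt_top.ne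
  set L : ℝ := (K + 1) * (2 * R)
  have hL : 0 < L := by positivity
  set V : ℝ := volume.real X + 1
  have hV : 0 < V := by positivity
  refine ⟨a * a / (L * (2 ^ d * V)), by positivity, fun h hh g h1 h2 => ?_⟩
  set S := {x ∈ X | h x ≤ 0}
  set S' := {x ∈ X | g ≤ h x}
  set T := {x ∈ X | 0 < h x ∧ h x < g}
  have hhm : Measurable h := hh.continuous.measurable
  have hS : MeasurableSet S := hXm.inter (measurableSet_le hhm measurable_const)
  have hS' : MeasurableSet S' := hXm.inter (measurableSet_le measurable_const hhm)
  have hT : MeasurableSet T := hXm.inter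
    ((measurableSet_lt measurable_const hhm).inter (measurableSet_lt hhm measurable_const))
  have hSX : S ⊆ X := fun x hx => hx.1
  have hS'X : S' ⊆ X := fun x hx => hx.1
  have hTX : T ⊆ X := fun x hx => hx.1
  have hpt : ∀ x ∈ S, ∀ w ∈ S', ENNReal.ofReal g ≤ ENNReal.ofReal L *
      ∫⁻ t in Icc (0 : ℝ) 1, T.indicator 1 (AffineMap.lineMap x w t) := by
    intro x hx w hw
    refine (ofReal_le_volume_lineMap hh hx.2 hw.2).trans ?_
    have e1 : (K : ℝ≥0∞) * ‖x - w‖₊ ≤ ENNReal.ofReal L := by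
      rw [← ENNReal.ofReal_coe_nnreal, ← ENNReal.ofReal_coe_nnreal,
        ← ENNReal.ofReal_mul K.coe_nonneg]
      refine ENNReal.ofReal_le_ofReal ?_
      have hx' := mem_ball_zero_iff.1 (hR hx.1)
      have hw' := mem_ball_zero_iff.1 (hR hw.1)
      have := norm_sub_le x w
      rw [coe_nnnorm]
      exact mul_le_mul (by linarith) (by linarith) (norm_nonneg _) (by positivity)
    refine mul_le_mul' e1 ?_
    have hm : MeasurableSet ((fun t : ℝ => AffineMap.lineMap x w t) ⁻¹' T) :=
      hT.preimage AffineMap.lineMap_continuous.measurable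
    calc _ ≤ volume.restrict (Icc (0 : ℝ) 1) ((fun t : ℝ => AffineMap.lineMap x w t) ⁻¹' T) := by
          rw [Measure.restrict_apply hm]
          refine measure_mono fun t ht => ⟨⟨?_, ht.2⟩, ht.1⟩
          exact hXc.lineMap_mem hx.1 hw.1 ht.1
      _ = _ := (lintegral_indicator_one hm).symm
  have hFm : Measurable fun p : Euc d × Euc d × ℝ =>
      T.indicator (1 : Euc d → ℝ≥0∞) (AffineMap.lineMap p.1 p.2.1 p.2.2) := by
    simp_rw [AffineMap.lineMap_apply_module]
    exact (measurable_one.indicator hT).comp (by fun_prop)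
  have hswap : ∫⁻ x in X, ∫⁻ w in X, ∫⁻ t in Icc (0 : ℝ) 1,
        T.indicator (1 : Euc d → ℝ≥0∞) (AffineMap.lineMap x w t) =
      ∫⁻ t in Icc (0 : ℝ) 1, ∫⁻ x in X, ∫⁻ w in X,
        T.indicator (1 : Euc d → ℝ≥0∞) (AffineMap.lineMap x w t) := by
    exact lintegral_rotate hFm _ _ _
  have hmain : ENNReal.ofReal g * volume S' * volume S ≤
      ENNReal.ofReal L * (2 ^ d * volume T * volume X) := by
    calc ENNReal.ofReal g * volume S' * volume S
        = ∫⁻ _x in S, ∫⁻ _w in S', ENNReal.ofReal g := by simp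
      _ ≤ ∫⁻ x in S, ∫⁻ w in S', ENNReal.ofReal L *
          ∫⁻ t in Icc (0 : ℝ) 1, T.indicator 1 (AffineMap.lineMap x w t) :=
        setLIntegral_mono' hS fun x hx => setLIntegral_mono' hS' fun w hw => hpt x hx w hw
      _ ≤ ∫⁻ x in X, ∫⁻ w in X, ENNReal.ofReal L *
          ∫⁻ t in Icc (0 : ℝ) 1, T.indicator 1 (AffineMap.lineMap x w t) :=
        (lintegral_mono fun x => lintegral_mono_set hS'X).trans (lintegral_mono_set hSX)
      _ = ENNReal.ofReal L * ∫⁻ t in Icc (0 : ℝ) 1, ∫⁻ x in X, ∫⁻ w in X,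
          T.indicator (1 : Euc d → ℝ≥0∞) (AffineMap.lineMap x w t) := by
        simp_rw [lintegral_const_mul' _ _ ENNReal.ofReal_ne_top]
        rw [hswap]
      _ ≤ ENNReal.ofReal L * ∫⁻ _t in Icc (0 : ℝ) 1, 2 ^ d * volume T * volume X := by
        gcongr with t
        exact lintegral_lintegral_lineMap_le X hT t
      _ = _ := by simp
  have hTfin : volume T ≠ ∞ := ne_top_of_le_ne_top hXfin (measure_mono hTX)
  rcases le_total g 0 with hg | hg
  · exact (mul_nonpos_of_nonneg_of_nonpos (by positivity) hg).trans measureReal_nonneg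
  have hreal : g * volume.real S' * volume.real S ≤
      L * (2 ^ d * volume.real T * volume.real X) := by
    have := ENNReal.toReal_mono (by finiteness) hmain
    simpa [ENNReal.toReal_mul, ENNReal.toReal_ofReal hg, ENNReal.toReal_ofReal hL.le,
      Measure.real] using this
  have hge : g * a * a ≤ g * volume.real S' * volume.real S := by gcongr
  have hle : L * (2 ^ d * volume.real T * volume.real X) ≤ L * (2 ^ d * volume.real T * V) := by
    gcongr; simp [V]
  rw [div_mul_eq_mul_div, div_le_iff₀ (by positivity)]
  calc a * a * g = g * a * a := by ring
    _ ≤ _ := hge.trans (hreal.trans hle)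
    _ = _ := by ring

end Isoperimetric

/-! ### Reflections across hyperplanes -/

section Reflection

variable {d : ℕ}

/-- The reflection of `ℝᵈ` across the hyperplane `⟪x, u⟫ = a`. -/
noncomputable def hyperRefl (u : Euc d) (a : ℝ) (x : Euc d) : Euc d :=
  x - (2 * (inner ℝ x u - a) / ‖u‖ ^ 2) • u

lemma inner_hyperRefl {u : Euc d} (hu : u ≠ 0) (a : ℝ) (x : Euc d) :
    inner ℝ (hyperRefl u a x) u - a = -(inner ℝ x u - a) := by
  have : ‖u‖ ≠ 0 := norm_ne_zero_iff.2 hu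
  rw [hyperRefl, inner_sub_left, real_inner_smul_left, real_inner_self_eq_norm_sq]
  field_simp
  ring

lemma hyperRefl_hyperRefl {u : Euc d} (hu : u ≠ 0) (a : ℝ) (x : Euc d) :
    hyperRefl u a (hyperRefl u a x) = x := by
  conv_lhs => rw [hyperRefl, inner_hyperRefl hu]
  rw [hyperRefl, mul_neg, neg_div, neg_smul, sub_neg_eq_add, sub_add_cancel]

lemma norm_sub_hyperRefl {u : Euc d} (hu : u ≠ 0) (a : ℝ) (x : Euc d) :
    ‖x - hyperRefl u a x‖ = 2 * |inner ℝ x u - a| / ‖u‖ := by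
  have : ‖u‖ ≠ 0 := norm_ne_zero_iff.2 hu
  rw [hyperRefl, sub_sub_cancel, norm_smul, Real.norm_eq_abs, abs_div, abs_mul, abs_two,
    abs_of_pos (by positivity : 0 < ‖u‖ ^ 2)]
  field_simp

lemma measurePreserving_hyperRefl (u : Euc d) (a : ℝ) :
    MeasurePreserving (hyperRefl u a) := by
  have h1 : hyperRefl u a = (fun x => x + (2 * a / ‖u‖ ^ 2) • u) ∘
      (Submodule.reflection (Submodule.span ℝ {u})ᗮ) := by
    funext x
    simp only [Function.comp, Submodule.reflection_orthogonal_apply,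
      Submodule.reflection_singleton_apply, hyperRefl, real_inner_comm x u]
    rw [RCLike.ofReal_real_eq_id, id]
    module
  rw [h1]
  exact (measurePreserving_add_right volume _).comp
    (LinearIsometryEquiv.measurePreserving _)

/-- Let a convex set contain a ball about a point `o` of the hyperplane. The homothety about `o`
with ratio `1 - O(t)` maps the part of the set within the strip of width `t` about the hyperplane
to points whose reflections remain in the set, so that the reflection leaves the set only on a set
of volume `O(t ^ 2)`. -/
lemma exists_volume_hyperRefl_notMem_le {X : Set (Euc d)} (hXc : Convex ℝ X)
    (hXb : Bornology.IsBounded X) (hXm : MeasurableSet X) {u : Euc d} (hu : u ≠ 0) {r : ℝ}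
    (hr : 0 < r) : ∃ C : ℝ, 0 < C ∧ ∀ (a : ℝ) (o : Euc d), Metric.closedBall o r ⊆ X →
      inner ℝ o u = a → ∀ t : ℝ, 0 ≤ t →
      volume.real {x ∈ X | |inner ℝ x u - a| ≤ t ∧ hyperRefl u a x ∉ X} ≤ C * t ^ 2 := by
  obtain ⟨C, hC, H⟩ := exists_volume_slab_le hXb hu
  have hu' : 0 < ‖u‖ := norm_pos_iff.2 hu
  refine ⟨C * (d + 1) * (2 / (‖u‖ * r)), by positivity, fun a o ho hoa t ht => ?_⟩
  have hXfin : volume X ≠ ∞ := hXb.measure_lt_top.ne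
  set K := {x ∈ X | |inner ℝ x u - a| ≤ t} with hK
  have hKX : K ⊆ X := fun x hx => hx.1
  have hKm : MeasurableSet K :=
    hXm.inter (measurableSet_le (f := fun x : Euc d => |inner ℝ x u - a|) (by fun_prop)
      measurable_const)
  have hKfin : volume K ≠ ∞ := ne_top_of_le_ne_top hXfin (measure_mono hKX)
  have hbadK : {x ∈ X | |inner ℝ x u - a| ≤ t ∧ hyperRefl u a x ∉ X} ⊆ K :=
    fun x hx => ⟨hx.1, hx.2.1⟩
  set l : ℝ := 2 * t / (‖u‖ * r) with hl
  have hl0 : 0 ≤ l := by positivity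
  have hend : C * (d + 1) * (2 / (‖u‖ * r)) * t ^ 2 = (d + 1) * l * (C * t) := by
    rw [hl]; field_simp
  rw [hend]
  rcases le_or_gt 1 l with h1 | h1
  · calc _ ≤ volume.real K := measureReal_mono hbadK hKfin
      _ ≤ C * t := H a t ht
      _ ≤ (d + 1) * l * (C * t) := by
        refine le_mul_of_one_le_left (by positivity) ?_
        have : (0 : ℝ) ≤ d := Nat.cast_nonneg d
        nlinarith
  · set K' := AffineMap.homothety o (1 - l) '' K
    have hhom : ∀ x : Euc d, AffineMap.homothety o (1 - l) x = (1 - l) • x + l • o := by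
      intro x
      rw [AffineMap.homothety_apply, vsub_eq_sub, vadd_eq_add, smul_sub, sub_smul, sub_smul,
        one_smul, one_smul]
      abel
    have hK'h : ∀ x, inner ℝ (AffineMap.homothety o (1 - l) x) u - a =
        (1 - l) * (inner ℝ x u - a) := by
      intro x
      rw [hhom, inner_add_left, real_inner_smul_left, real_inner_smul_left, hoa]; ring
    have hoX : o ∈ X := ho (Metric.mem_closedBall_self hr.le)
    have hK'K : K' ⊆ K := by
      rintro _ ⟨x, hx, rfl⟩
      refine ⟨?_, ?_⟩
      · rw [hhom]; exact hXc hx.1 hoX (by linarith) hl0 (by ring)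
      · rw [hK'h, abs_mul, abs_of_pos (by linarith : 0 < 1 - l)]
        exact (mul_le_of_le_one_left (abs_nonneg _) (by linarith)).trans hx.2
    have hsub : {x ∈ X | |inner ℝ x u - a| ≤ t ∧ hyperRefl u a x ∉ X} ⊆ K \ K' := by
      intro x' hx'
      refine ⟨hbadK hx', ?_⟩
      rintro ⟨x, hx, rfl⟩
      refine hx'.2.2 ?_
      set x' := AffineMap.homothety o (1 - l) x with hx'def
      rcases hl0.eq_or_lt with hl1 | hl1
      · have ht0 : t = 0 := by
          have := hl1.symm
          rw [hl, div_eq_zero_iff] at this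
          rcases this with h | h
          · linarith
          · exact absurd h (by positivity)
        have h0 : inner ℝ x' u - a = 0 := by
          have := hx'.2.1
          rw [ht0] at this
          exact abs_nonpos_iff.1 this
        rw [hyperRefl, h0]
        simpa using hx'.1
      -- The displacement is absorbed by moving `o` inside its ball.
      set e : Euc d := l⁻¹ • (hyperRefl u a x' - x') with he
      have he' : ‖e‖ ≤ r := by
        rw [he, norm_smul, norm_sub_rev, norm_sub_hyperRefl hu, Real.norm_of_nonneg (by positivity),
          inv_mul_le_iff₀ hl1, hl]
        have : 2 * t / (‖u‖ * r) * r = 2 * t / ‖u‖ := by field_simp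
        rw [this]
        gcongr
        exact hx'.2.1
      have heq : hyperRefl u a x' = (1 - l) • x + l • (o + e) := by
        rw [smul_add, ← add_assoc, ← hhom, he, smul_smul, mul_inv_cancel₀ hl1.ne', one_smul,
          ← hx'def]
        abel
      rw [heq]
      exact hXc hx.1 (ho (by simpa using he')) (by linarith) hl0 (by ring)
    have hK'm : volume.real K' = (1 - l) ^ d * volume.real K := by
      rw [Measure.real, Measure.addHaar_image_homothety, ENNReal.toReal_mul,
        ENNReal.toReal_ofReal (abs_nonneg _), finrank_euclideanSpace, Fintype.card_fin,
        abs_of_nonneg (pow_nonneg (by linarith) _)]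
      rfl
    have hK'meas : MeasurableSet K' := by
      have hinj : Function.Injective (AffineMap.homothety o (1 - l)) := by
        intro p q hpq
        rw [hhom, hhom, add_left_inj] at hpq
        exact smul_right_injective _ (by linarith : (1 - l) ≠ 0) hpq
      have hcont : Continuous (AffineMap.homothety o (1 - l)) := by
        have : (AffineMap.homothety o (1 - l) : Euc d → Euc d) = fun x => (1 - l) • x + l • o :=
          funext hhom
        rw [this]; fun_prop
      exact hKm.image_of_continuousOn_injOn hcont.continuousOn hinj.injOn
    have hbern : 1 - d * l ≤ (1 - l) ^ d := by
      have := one_add_mul_le_pow (a := -l) (by linarith) d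
      simpa [sub_eq_add_neg] using this
    calc _ ≤ volume.real (K \ K') :=
          measureReal_mono hsub (ne_top_of_le_ne_top hKfin (measure_mono sdiff_subset))
      _ = volume.real K - volume.real K' := measureReal_sdiff hK'K hK'meas
      _ = (1 - (1 - l) ^ d) * volume.real K := by rw [hK'm]; ring
      _ ≤ (d * l) * volume.real K := by
          have : 0 ≤ volume.real K := measureReal_nonneg
          gcongr; linarith
      _ ≤ ((d + 1) * l) * (C * t) := by
          have := H a t ht
          gcongr
          linarith

end Reflection

/-! ### Laguerre cells -/

section Cells

variable {d : ℕ} {ι : Type*}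

/-- The affine function `x ↦ ⟪x, yᵢ⟫ - zᵢ`; the dual potential with weights `z` is the maximum of
these functions, and its regularization is their soft maximum. -/
noncomputable def score (y : ι → Euc d) (z : ι → ℝ) (i : ι) (x : Euc d) : ℝ :=
  inner ℝ x (y i) - z i

/-- The Laguerre cell of `yᵢ` in `X`: the points at which the score of `i` is maximal. The cells are
taken closed, so that they overlap, but only on parts of hyperplanes. -/
def lagCell (X : Set (Euc d)) (y : ι → Euc d) (z : ι → ℝ) (i : ι) : Set (Euc d) :=
  {x ∈ X | ∀ k, score y z k x ≤ score y z i x}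

lemma score_sub_score (y : ι → Euc d) (z : ι → ℝ) (i j : ι) (x : Euc d) :
    score y z i x - score y z j x = inner ℝ x (y i - y j) - (z i - z j) := by
  simp only [score, inner_sub_right]; ring

@[fun_prop]
lemma measurable_score (y : ι → Euc d) (z : ι → ℝ) (i : ι) : Measurable (score y z i) := by
  unfold score; fun_prop

lemma continuous_score (y : ι → Euc d) (z : ι → ℝ) (i : ι) : Continuous (score y z i) := by
  unfold score; fun_prop

lemma lagCell_subset (X : Set (Euc d)) (y : ι → Euc d) (z : ι → ℝ) (i : ι) :
    lagCell X y z i ⊆ X := fun _ hx => hx.1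

lemma measurableSet_lagCell [Countable ι] {X : Set (Euc d)} (hX : MeasurableSet X) (y : ι → Euc d)
    (z : ι → ℝ) (i : ι) : MeasurableSet (lagCell X y z i) := by
  have : lagCell X y z i = X ∩ ⋂ k, {x | score y z k x ≤ score y z i x} := by
    ext x; simp [lagCell]
  rw [this]
  exact hX.inter (MeasurableSet.iInter fun k => measurableSet_le (by fun_prop) (by fun_prop))

lemma exists_mem_lagCell [Finite ι] [Nonempty ι] {X : Set (Euc d)} (y : ι → Euc d) (z : ι → ℝ)
    {x : Euc d} (hx : x ∈ X) : ∃ i, x ∈ lagCell X y z i := by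
  obtain ⟨i, hi⟩ := Finite.exists_max fun i => score y z i x
  exact ⟨i, hx, hi⟩

lemma exists_forall_of_finite {κ : Type*} [Finite κ] {p : κ → ℝ → Prop}
    (hmono : ∀ i a b, a ≤ b → p i a → p i b) (h : ∀ i, ∃ a, p i a) : ∃ a, 0 < a ∧ ∀ i, p i a := by
  have := Fintype.ofFinite κ
  choose a ha using h
  refine ⟨1 + ∑ i, |a i|, by positivity, fun i => hmono i _ _ ?_ (ha i)⟩
  have := Finset.single_le_sum (fun i _ => abs_nonneg (a i)) (Finset.mem_univ i)
  linarith [le_abs_self (a i)]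

variable [Fintype ι] {X : Set (Euc d)} {y : ι → Euc d}

lemma exists_volume_score_le (hX : Bornology.IsBounded X) (hy : Function.Injective y) :
    ∃ C : ℝ, 0 < C ∧ ∀ (z : ι → ℝ) (i j : ι), i ≠ j → ∀ t : ℝ, 0 ≤ t →
      volume.real {x ∈ X | |score y z i x - score y z j x| ≤ t} ≤ C * t := by
  obtain ⟨C, hC, H⟩ := exists_forall_of_finite
    (p := fun (q : ι × ι) C => q.1 ≠ q.2 → ∀ (z : ι → ℝ) (t : ℝ), 0 ≤ t →
      volume.real {x ∈ X | |score y z q.1 x - score y z q.2 x| ≤ t} ≤ C * t)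
    (fun q a b hab h hq z t ht => (h hq z t ht).trans (by gcongr))
    (fun q => by
      by_cases hq : q.1 = q.2
      · exact ⟨0, fun h => absurd hq h⟩
      · obtain ⟨C, -, H⟩ := exists_volume_slab_le hX (sub_ne_zero.2 (hy.ne hq))
        exact ⟨C, fun _ z t ht => by simpa only [score_sub_score] using H (z q.1 - z q.2) t ht⟩)
  exact ⟨C, hC, fun z i j hij t ht => H (i, j) hij z t ht⟩

lemma exists_integral_exp_score_le (hX : Bornology.IsBounded X) (hy : Function.Injective y) :
    ∃ C : ℝ, 0 < C ∧ ∀ (z : ι → ℝ) (i j : ι), i ≠ j → ∀ ε : ℝ, 0 < ε →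
      ∫ x in X, Real.exp (-|score y z i x - score y z j x| / ε) ≤ C * ε := by
  obtain ⟨C, hC, H⟩ := exists_forall_of_finite
    (p := fun (q : ι × ι) C => q.1 ≠ q.2 → ∀ (z : ι → ℝ) (ε : ℝ), 0 < ε →
      ∫ x in X, Real.exp (-|score y z q.1 x - score y z q.2 x| / ε) ≤ C * ε)
    (fun q a b hab h hq z t ht => (h hq z t ht).trans (by gcongr))
    (fun q => by
      by_cases hq : q.1 = q.2
      · exact ⟨0, fun h => absurd hq h⟩
      · obtain ⟨C, -, H⟩ := exists_integral_exp_slab_le hX (sub_ne_zero.2 (hy.ne hq))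
        exact ⟨C, fun _ z t ht => by simpa only [score_sub_score] using H (z q.1 - z q.2) t ht⟩)
  exact ⟨C, hC, fun z i j hij t ht => H (i, j) hij z t ht⟩

lemma volume_score_eq_zero (hX : Bornology.IsBounded X) (hy : Function.Injective y) (z : ι → ℝ)
    {i j : ι} (hij : i ≠ j) : volume {x ∈ X | score y z i x = score y z j x} = 0 := by
  obtain ⟨C, hC, H⟩ := exists_volume_score_le hX hy
  have h1 := H z i j hij 0 le_rfl
  have h2 : {x ∈ X | |score y z i x - score y z j x| ≤ 0} =
      {x ∈ X | score y z i x = score y z j x} := by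
    ext x; simp only [abs_nonpos_iff, sub_eq_zero]
  rw [h2, mul_zero] at h1
  refine (measureReal_eq_zero_iff ?_).1 (le_antisymm h1 measureReal_nonneg)
  exact ne_top_of_le_ne_top hX.measure_lt_top.ne (measure_mono fun x hx => hx.1)

/-- Almost every point of `X` lies in exactly one cell. -/
lemma ae_mem_lagCell_unique (hX : Bornology.IsBounded X) (hXm : MeasurableSet X)
    (hy : Function.Injective y) (z : ι → ℝ) :
    ∀ᵐ x ∂volume.restrict X, ∀ i j, x ∈ lagCell X y z i → x ∈ lagCell X y z j → i = j := by
  rw [ae_restrict_iff' hXm]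
  have h1 : ∀ i j, i ≠ j → ∀ᵐ x : Euc d, ¬ (x ∈ X ∧ score y z i x = score y z j x) := fun i j hij =>
    measure_eq_zero_iff_ae_notMem.1 (volume_score_eq_zero hX hy z hij)
  have h2 : ∀ᵐ x : Euc d, ∀ i j, i ≠ j → ¬ (x ∈ X ∧ score y z i x = score y z j x) :=
    ae_all_iff.2 fun i => ae_all_iff.2 fun j => by
      by_cases hij : i = j
      · exact ae_of_all _ fun x h => absurd hij h
      · exact (h1 i j hij).mono fun x hx _ => hx
  filter_upwards [h2] with x hx hxX i j hi hj
  by_contra hij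
  exact hx i j hij ⟨hxX, le_antisymm (hj.2 i) (hi.2 j)⟩

/-- If `yₘ` lies strictly between `yₗ` and `yₙ` then the cell of `yₘ` is a slab, and the three
scores can only be close together if that slab is thin. -/
lemma exists_lt_abs_score_sub_of_between (hX : Bornology.IsBounded X) {a : ℝ} (ha : 0 < a)
    (hy : Function.Injective y) {l m n : ι} (hlm : l ≠ m) {s : ℝ} (hs0 : 0 < s) (hs1 : s < 1)
    (hs : y m = (1 - s) • y l + s • y n) :
    ∃ κ : ℝ, 0 < κ ∧ ∀ z : ι → ℝ, a ≤ volume.real (lagCell X y z m) → ∀ x,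
      κ < |score y z m x - score y z l x| ∨ κ < |score y z m x - score y z n x| := by
  obtain ⟨C, hC, H⟩ := exists_volume_score_le hX hy
  have hs' : 0 < 1 - s := by linarith
  refine ⟨a * (1 - s) / (2 * C), by positivity, fun z hz x₀ => ?_⟩
  set κ := a * (1 - s) / (2 * C) with hκ
  by_contra! hcon
  -- This combination of the scores does not depend on the point.
  have hK : ∀ x, (1 - s) * (score y z m x - score y z l x) +
      s * (score y z m x - score y z n x) = (1 - s) * z l + s * z n - z m := by
    intro x
    simp only [score, hs, inner_add_right, real_inner_smul_right]
    ring
  have h0 := hK x₀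
  have hKκ : (1 - s) * z l + s * z n - z m ≤ κ := by
    rw [← h0]
    have h1 := mul_le_mul_of_nonneg_left ((le_abs_self _).trans hcon.1) hs'.le
    have h2 := mul_le_mul_of_nonneg_left ((le_abs_self _).trans hcon.2) hs0.le
    linarith
  have hsub : lagCell X y z m ⊆
      {x ∈ X | |score y z m x - score y z l x| ≤ κ / (1 - s)} := by
    intro x hx
    refine ⟨hx.1, ?_⟩
    have h1 := hx.2 l
    have h2 := mul_nonneg hs0.le (sub_nonneg.2 (hx.2 n))
    rw [abs_of_nonneg (by linarith), le_div_iff₀ hs']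
    have := hK x
    nlinarith
  have h3 : a ≤ C * (κ / (1 - s)) := hz.trans <| (measureReal_mono hsub
    (ne_top_of_le_ne_top hX.measure_lt_top.ne (measure_mono fun x hx => hx.1))).trans
    (H z m l hlm.symm _ (by positivity))
  have h4 : C * (κ / (1 - s)) = a / 2 := by rw [hκ]; field_simp
  linarith

/-- For three collinear targets, whichever of them lies between the other two, the scores cannot
all be close together. -/
lemma exists_lt_abs_score_sub_of_collinear (hX : Bornology.IsBounded X) {a : ℝ} (ha : 0 < a)
    (hy : Function.Injective y) {i j k : ι} (hij : i ≠ j) (hik : i ≠ k) (hjk : j ≠ k) {c : ℝ}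
    (hc : y i - y j = c • (y i - y k)) :
    ∃ κ : ℝ, 0 < κ ∧ ∀ z : ι → ℝ, (∀ i, a ≤ volume.real (lagCell X y z i)) → ∀ x,
      κ < |score y z i x - score y z j x| ∨ κ < |score y z i x - score y z k x| := by
  have hc0 : c ≠ 0 := fun h => hy.ne hij (sub_eq_zero.1 (by rw [hc, h, zero_smul]))
  have hc1 : c ≠ 1 := fun h => hy.ne hjk (by rw [h, one_smul] at hc; exact sub_right_injective hc)
  have hyj : y j = (1 - c) • y i + c • y k := by
    rw [sub_eq_iff_eq_add, ← sub_eq_iff_eq_add'] at hc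
    rw [← hc]; module
  rcases lt_or_gt_of_ne hc0 with h | h
  · have h1c : 0 < 1 - c := by linarith
    have hyi : y i = (1 - -c / (1 - c)) • y j + (-c / (1 - c)) • y k := by
      rw [hyj]
      match_scalars <;> field_simp <;> ring
    obtain ⟨κ, hκ, H⟩ := exists_lt_abs_score_sub_of_between hX ha hy hij.symm
      (div_pos (by linarith) h1c) ((div_lt_one h1c).2 (by linarith)) hyi
    exact ⟨κ, hκ, fun z hz x => H z (hz i) x⟩
  · rcases lt_or_gt_of_ne hc1 with h' | h'
    · obtain ⟨κ, hκ, H⟩ := exists_lt_abs_score_sub_of_between hX ha hy hij h h' hyj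
      refine ⟨κ / 2, by positivity, fun z hz x => ?_⟩
      by_contra! hcon
      have h3 := abs_sub_le (score y z j x) (score y z i x) (score y z k x)
      rw [abs_sub_comm] at hcon
      rcases H z (hz j) x with h4 | h4 <;> linarith
    · have hyk : y k = (1 - 1 / c) • y i + (1 / c) • y j := by
        rw [hyj]
        match_scalars <;> field_simp
        ring
      obtain ⟨κ, hκ, H⟩ := exists_lt_abs_score_sub_of_between hX ha hy hik (by positivity)
        ((div_lt_one h).2 h') hyk
      refine ⟨κ / 2, by positivity, fun z hz x => ?_⟩
      by_contra! hcon
      have h3 := abs_sub_le (score y z k x) (score y z i x) (score y z j x)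
      rw [abs_sub_comm (score y z i x) (score y z k x)] at hcon
      rcases H z (hz k) x with h4 | h4 <;> linarith

lemma exp_neg_div_le {κ ε : ℝ} (hκ : 0 < κ) (hε : 0 < ε) :
    Real.exp (-κ / ε) ≤ 2 / κ ^ 2 * ε ^ 2 := by
  have h1 := Real.quadratic_le_exp_of_nonneg (div_pos hκ hε).le
  have h2 : (κ / ε) ^ 2 / 2 ≤ Real.exp (κ / ε) := by
    have := div_pos hκ hε
    linarith
  rw [neg_div, Real.exp_neg]
  calc (Real.exp (κ / ε))⁻¹ ≤ ((κ / ε) ^ 2 / 2)⁻¹ := inv_anti₀ (by positivity) h2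
    _ = _ := by field_simp

/-- Points at which three scores are within `O(ε)` of each other have volume `O(ε ^ 2)`, provided
that all cells have substantial volume: this holds for any weights if the three targets are not
collinear, and there are no such points for small `ε` if they are. -/
lemma exists_integral_exp_score_mul_le (hX : Bornology.IsBounded X) {a : ℝ} (ha : 0 < a)
    (hy : Function.Injective y) :
    ∃ C : ℝ, 0 < C ∧ ∀ z : ι → ℝ, (∀ i, a ≤ volume.real (lagCell X y z i)) →
      ∀ i j k : ι, i ≠ j → i ≠ k → j ≠ k → ∀ ε : ℝ, 0 < ε →
      ∫ x in X, Real.exp (-|score y z i x - score y z j x| / ε) *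
        Real.exp (-|score y z i x - score y z k x| / ε) ≤ C * ε ^ 2 := by
  obtain ⟨C, hC, H⟩ := exists_forall_of_finite
    (p := fun (q : ι × ι × ι) C => q.1 ≠ q.2.1 → q.1 ≠ q.2.2 → q.2.1 ≠ q.2.2 →
      ∀ z : ι → ℝ, (∀ i, a ≤ volume.real (lagCell X y z i)) → ∀ ε : ℝ, 0 < ε →
      ∫ x in X, Real.exp (-|score y z q.1 x - score y z q.2.1 x| / ε) *
        Real.exp (-|score y z q.1 x - score y z q.2.2 x| / ε) ≤ C * ε ^ 2)
    (fun q a b hab h h1 h2 h3 z hz t ht => (h h1 h2 h3 z hz t ht).trans (by gcongr))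
    (fun ⟨i, j, k⟩ => by
      by_cases hij : i = j
      · exact ⟨0, fun h => absurd hij h⟩
      by_cases hik : i = k
      · exact ⟨0, fun _ h => absurd hik h⟩
      by_cases hjk : j = k
      · exact ⟨0, fun _ _ h => absurd hjk h⟩
      by_cases hc : ∃ c : ℝ, y i - y j = c • (y i - y k)
      · obtain ⟨c, hc⟩ := hc
        obtain ⟨κ, hκ, H⟩ := exists_lt_abs_score_sub_of_collinear hX ha hy hij hik hjk hc
        refine ⟨volume.real X * (2 / κ ^ 2), fun _ _ _ z hz ε hε => ?_⟩
        have hb : ∀ x ∈ X, ‖Real.exp (-|score y z i x - score y z j x| / ε) *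
            Real.exp (-|score y z i x - score y z k x| / ε)‖ ≤ 2 / κ ^ 2 * ε ^ 2 := by
          intro x _
          rw [Real.norm_of_nonneg (by positivity), ← Real.exp_add, ← add_div]
          refine le_trans ?_ (exp_neg_div_le hκ hε)
          refine Real.exp_le_exp.2 (div_le_div_of_nonneg_right ?_ hε.le)
          have h1 := abs_nonneg (score y z i x - score y z j x)
          have h2 := abs_nonneg (score y z i x - score y z k x)
          rcases H z hz x with h | h <;> linarith
        refine (le_abs_self _).trans ((norm_setIntegral_le_of_norm_le_const
          hX.measure_lt_top hb).trans_eq ?_)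
        ring
      · push Not at hc
        obtain ⟨C, -, H⟩ := exists_integral_exp_slab_mul_le hX (sub_ne_zero.2 (hy.ne hik)) hc
        exact ⟨C, fun _ _ _ z _ ε hε => by
          simpa only [score_sub_score] using H (z i - z j) (z i - z k) ε hε⟩)
  exact ⟨C, hC, fun z hz i j k hij hik hjk t ht => H (i, j, k) hij hik hjk z hz t ht⟩

/-- If all cells have substantial volume then each hyperplane on which two scores agree passes deep
through the interior of `X`. -/
lemma exists_closedBall_subset_of_lagCell (hXc : Convex ℝ X) (hX : Bornology.IsBounded X)
    (hXi : (interior X).Nonempty) {a : ℝ} (ha : 0 < a) (hy : Function.Injective y) :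
    ∃ r : ℝ, 0 < r ∧ ∀ z : ι → ℝ, (∀ i, a ≤ volume.real (lagCell X y z i)) →
      ∀ i j, i ≠ j → ∃ o, Metric.closedBall o r ⊆ X ∧ score y z i o = score y z j o := by
  obtain ⟨C, hC, H⟩ := exists_volume_score_le hX hy
  obtain ⟨x₀, hx₀⟩ := hXi
  obtain ⟨r₀, hr₀, hr₀X⟩ := Metric.nhds_basis_closedBall.mem_iff.1 (mem_interior_iff_mem_nhds.1 hx₀)
  obtain ⟨R, hR0, hR⟩ := hX.subset_ball_lt 0 (0 : Euc d)
  set η : ℝ := a / (2 * C) with hη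
  have hη0 : 0 < η := by positivity
  set M : ℝ := 2 * R * (2 * ∑ k, ‖y k‖) + η
  have hM : 0 < M := by positivity
  refine ⟨η / M * r₀, by positivity, fun z hz => ?_⟩
  have hx₀X : x₀ ∈ X := interior_subset hx₀
  have key : ∀ i j, i ≠ j → score y z i x₀ ≤ score y z j x₀ →
      ∃ o, Metric.closedBall o (η / M * r₀) ⊆ X ∧ score y z i o = score y z j o := by
    intro i j hij h0
    obtain ⟨x₁, hx₁, hx₁η⟩ : ∃ x ∈ lagCell X y z i, η < score y z i x - score y z j x := by
      by_contra! hcon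
      have hsub : lagCell X y z i ⊆ {x ∈ X | |score y z i x - score y z j x| ≤ η} := fun x hx =>
        ⟨hx.1, by rw [abs_of_nonneg (sub_nonneg.2 (hx.2 j))]; exact hcon x hx⟩
      have h3 : a ≤ C * η := (hz i).trans <| (measureReal_mono hsub
        (ne_top_of_le_ne_top hX.measure_lt_top.ne (measure_mono fun x hx => hx.1))).trans
        (H z i j hij _ hη0.le)
      have h4 : C * η = a / 2 := by rw [hη]; field_simp
      linarith
    set h₀ := score y z i x₀ - score y z j x₀ with hh₀
    set h₁ := score y z i x₁ - score y z j x₁ with hh₁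
    have hgap : 0 < h₁ - h₀ := by linarith
    have hgapM : h₁ - h₀ ≤ M := by
      have e1 : h₁ - h₀ = inner ℝ (x₁ - x₀) (y i - y j) := by
        rw [hh₁, hh₀, score_sub_score, score_sub_score, inner_sub_left]; ring
      have hx₁' := mem_ball_zero_iff.1 (hR hx₁.1)
      have hx₀' := mem_ball_zero_iff.1 (hR hx₀X)
      have e2 : ‖x₁ - x₀‖ ≤ 2 * R := by linarith [norm_sub_le x₁ x₀]
      have e3 : ‖y i - y j‖ ≤ 2 * ∑ k, ‖y k‖ := by
        have f1 := Finset.single_le_sum (fun k _ => norm_nonneg (y k)) (Finset.mem_univ i)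
        have f2 := Finset.single_le_sum (fun k _ => norm_nonneg (y k)) (Finset.mem_univ j)
        linarith [norm_sub_le (y i) (y j)]
      rw [e1]
      have e4 := real_inner_le_norm (x₁ - x₀) (y i - y j)
      have e5 := mul_le_mul e2 e3 (norm_nonneg _) (by positivity)
      linarith
    set s : ℝ := -h₀ / (h₁ - h₀) with hs
    have hs0 : 0 ≤ s := div_nonneg (by linarith) hgap.le
    have hs1 : 1 - s = h₁ / (h₁ - h₀) := by rw [hs]; field_simp; ring
    have hs1' : η / M ≤ 1 - s := by
      rw [hs1]; exact div_le_div₀ (by linarith) hx₁η.le hgap hgapM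
    have hs1pos : 0 < 1 - s := lt_of_lt_of_le (by positivity) hs1'
    refine ⟨(1 - s) • x₀ + s • x₁, ?_, ?_⟩
    · intro p hp
      have hp' : ‖p - ((1 - s) • x₀ + s • x₁)‖ ≤ (1 - s) * r₀ := by
        rw [Metric.mem_closedBall, dist_eq_norm] at hp
        exact hp.trans (by gcongr)
      have e1 : p = (1 - s) • (x₀ + (1 - s)⁻¹ • (p - ((1 - s) • x₀ + s • x₁))) + s • x₁ := by
        rw [smul_add, smul_smul, mul_inv_cancel₀ hs1pos.ne', one_smul]
        abel
      rw [e1]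
      refine hXc (hr₀X ?_) hx₁.1 hs1pos.le hs0 (by ring)
      rw [Metric.mem_closedBall, dist_eq_norm, add_sub_cancel_left, norm_smul,
        Real.norm_of_nonneg (by positivity), inv_mul_le_iff₀ hs1pos]
      exact hp'
    · have e1 : score y z i ((1 - s) • x₀ + s • x₁) - score y z j ((1 - s) • x₀ + s • x₁) =
          (1 - s) * h₀ + s * h₁ := by
        rw [hh₀, hh₁]
        simp only [score, inner_add_left, real_inner_smul_left]
        ring
      rw [← sub_eq_zero, e1, hs1, hs]
      field_simp
      ring
  intro i j hij
  rcases le_total (score y z i x₀) (score y z j x₀) with h | h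
  · exact key i j hij h
  · obtain ⟨o, h1, h2⟩ := key j i hij.symm h
    exact ⟨o, h1, h2.symm⟩

end Cells

/-! ### Comparison of the soft maximum with the maximum -/

section Gibbs

variable {d : ℕ} {ι : Type*}

/-- The soft assignment of `x` to the farther of two targets when there are no others. It is
invariant under the reflection which exchanges the two scores. -/
noncomputable def pairWeight (y : ι → Euc d) (z : ι → ℝ) (ε : ℝ) (i j : ι) (x : Euc d) : ℝ :=
  (1 + Real.exp (|score y z i x - score y z j x| / ε))⁻¹

variable {y : ι → Euc d} {z : ι → ℝ} {ε : ℝ}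

@[fun_prop]
lemma measurable_pairWeight (y : ι → Euc d) (z : ι → ℝ) (ε : ℝ) (i j : ι) :
    Measurable (pairWeight y z ε i j) := by
  unfold pairWeight; fun_prop

lemma pairWeight_comm (i j : ι) : pairWeight y z ε i j = pairWeight y z ε j i := by
  funext x; rw [pairWeight, pairWeight, abs_sub_comm]

lemma pairWeight_nonneg (i j : ι) (x : Euc d) : 0 ≤ pairWeight y z ε i j x := by
  unfold pairWeight; positivity

lemma pairWeight_le_exp (i j : ι) (x : Euc d) :
    pairWeight y z ε i j x ≤ Real.exp (-|score y z i x - score y z j x| / ε) := by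
  rw [pairWeight, neg_div, Real.exp_neg]
  exact inv_anti₀ (Real.exp_pos _) (by linarith)

lemma pairWeight_le_one (hε : 0 < ε) (i j : ι) (x : Euc d) : pairWeight y z ε i j x ≤ 1 :=
  (pairWeight_le_exp i j x).trans (Real.exp_le_one_iff.2
    (div_nonpos_of_nonpos_of_nonneg (by simp) hε.le))

lemma score_hyperRefl (i j k : ι) (x : Euc d) :
    score y z k (hyperRefl (y i - y j) (z i - z j) x) = score y z k x -
      2 * (score y z i x - score y z j x) / ‖y i - y j‖ ^ 2 * inner ℝ (y i - y j) (y k) := by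
  rw [score_sub_score]
  simp only [score, hyperRefl, inner_sub_left, real_inner_smul_left]
  ring

lemma score_sub_score_hyperRefl (hy : Function.Injective y) {i j : ι} (hij : i ≠ j) (x : Euc d) :
    score y z i (hyperRefl (y i - y j) (z i - z j) x) -
      score y z j (hyperRefl (y i - y j) (z i - z j) x) =
      -(score y z i x - score y z j x) := by
  rw [score_sub_score, score_sub_score, inner_hyperRefl (sub_ne_zero.2 (hy.ne hij))]

lemma pairWeight_hyperRefl (hy : Function.Injective y) {i j : ι} (hij : i ≠ j) (x : Euc d) :
    pairWeight y z ε i j (hyperRefl (y i - y j) (z i - z j) x) = pairWeight y z ε i j x := by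
  rw [pairWeight, pairWeight, score_sub_score_hyperRefl hy hij, abs_neg]

variable [Fintype ι]

/-- The soft assignment of `x` to the index `i`: the Gibbs weights `exp (fᵢ x / ε)` of the scores
`f`, normalized to have sum one. -/
noncomputable def gibbs (y : ι → Euc d) (z : ι → ℝ) (ε : ℝ) (i : ι) (x : Euc d) : ℝ :=
  Real.exp (score y z i x / ε) / ∑ k, Real.exp (score y z k x / ε)

@[fun_prop]
lemma measurable_gibbs (y : ι → Euc d) (z : ι → ℝ) (ε : ℝ) (i : ι) :
    Measurable (gibbs y z ε i) := by
  unfold gibbs; fun_prop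

lemma gibbs_nonneg (i : ι) (x : Euc d) : 0 ≤ gibbs y z ε i x := by
  unfold gibbs; positivity

lemma sum_gibbs [Nonempty ι] (x : Euc d) : ∑ i, gibbs y z ε i x = 1 := by
  unfold gibbs
  rw [← Finset.sum_div]
  exact div_self (Finset.sum_pos (fun k _ => Real.exp_pos _) Finset.univ_nonempty).ne'

lemma gibbs_le_one (i : ι) (x : Euc d) : gibbs y z ε i x ≤ 1 := by
  have : Nonempty ι := ⟨i⟩
  rw [← sum_gibbs (y := y) (z := z) (ε := ε) x]
  exact Finset.single_le_sum (fun k _ => gibbs_nonneg k x) (Finset.mem_univ i)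

lemma gibbs_le_exp (i j : ι) (x : Euc d) :
    gibbs y z ε j x ≤ Real.exp ((score y z j x - score y z i x) / ε) := by
  rw [gibbs, sub_div, Real.exp_sub]
  exact div_le_div_of_nonneg_left (Real.exp_pos _).le (Real.exp_pos _)
    (Finset.single_le_sum (f := fun k => Real.exp (score y z k x / ε))
      (fun k _ => (Real.exp_pos _).le) (Finset.mem_univ i))

/-- In the cell of `i`, the indices other than `i` and `j` change the weight of `j` only where three
scores are nearly equal. -/
lemma abs_gibbs_sub_pairWeight_le [DecidableEq ι] {X : Set (Euc d)} {i j : ι}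
    (hij : i ≠ j) {x : Euc d} (hx : x ∈ lagCell X y z i) :
    |gibbs y z ε j x - pairWeight y z ε i j x| ≤ ∑ k ∈ (Finset.univ.erase i).erase j,
      Real.exp (-|score y z i x - score y z j x| / ε) *
        Real.exp (-|score y z i x - score y z k x| / ε) := by
  set e : ι → ℝ := fun k => Real.exp ((score y z k x - score y z i x) / ε) with he
  have habs : ∀ k, Real.exp (-|score y z i x - score y z k x| / ε) = e k := by
    intro k
    rw [abs_of_nonneg (sub_nonneg.2 (hx.2 k)), neg_sub]
  have hepos : ∀ k, 0 < e k := fun k => Real.exp_pos _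
  set r : ℝ := ∑ k ∈ (Finset.univ.erase i).erase j, e k with hr
  have hr0 : 0 ≤ r := Finset.sum_nonneg fun k _ => (hepos k).le
  have hei : e i = 1 := by simp [he]
  have hsum : ∑ k, e k = 1 + e j + r := by
    rw [← Finset.add_sum_erase _ _ (Finset.mem_univ i), ← Finset.add_sum_erase _ _
      (Finset.mem_erase.2 ⟨hij.symm, Finset.mem_univ j⟩), hei, hr, add_assoc]
  have hg : gibbs y z ε j x = e j / (1 + e j + r) := by
    rw [← hsum, he]
    simp only [gibbs, sub_div, Real.exp_sub]
    rw [← Finset.sum_div, div_div_div_cancel_right₀ (Real.exp_pos _).ne']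
  have hp : pairWeight y z ε i j x = e j / (1 + e j) := by
    have h1 : Real.exp (|score y z i x - score y z j x| / ε) = (e j)⁻¹ := by
      rw [← habs j, ← Real.exp_neg, neg_div, neg_neg]
    rw [pairWeight, h1]
    have := (hepos j).ne'
    field_simp
    ring
  simp_rw [habs]
  rw [← Finset.mul_sum, ← hr, hg, hp]
  have h1 : e j / (1 + e j + r) - e j / (1 + e j) =
      -(e j * r / ((1 + e j + r) * (1 + e j))) := by
    have := hepos j
    field_simp
    ring
  rw [h1, abs_neg, abs_of_nonneg (by have := hepos j; positivity)]
  refine div_le_self (mul_nonneg (hepos j).le hr0) ?_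
  have := hepos j
  nlinarith

lemma hyperRefl_neg (u : Euc d) (a : ℝ) : hyperRefl (-u) (-a) = hyperRefl u a := by
  funext x
  rw [hyperRefl, hyperRefl, inner_neg_right, norm_neg]
  module

/-- If the reflection exchanging the scores of `i` and `j` takes a point of the cell of `i` to a
point of `X` outside the cell of `j`, then a third score is nearly maximal at the point. -/
lemma exists_score_sub_le_of_hyperRefl_notMem {X : Set (Euc d)} (hy : Function.Injective y)
    {i j : ι} (hij : i ≠ j) {x : Euc d} (hx : x ∈ lagCell X y z i)
    (hR : hyperRefl (y i - y j) (z i - z j) x ∈ X)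
    (hR' : hyperRefl (y i - y j) (z i - z j) x ∉ lagCell X y z j) :
    ∃ k, k ≠ i ∧ k ≠ j ∧ |score y z i x - score y z k x| ≤
      (1 + 4 * (∑ l, ‖y l‖) / ‖y i - y j‖) * |score y z i x - score y z j x| := by
  have hcon : ∃ k, score y z j (hyperRefl (y i - y j) (z i - z j) x) <
      score y z k (hyperRefl (y i - y j) (z i - z j) x) := by
    by_contra! h
    exact hR' ⟨hR, h⟩
  obtain ⟨k, hk⟩ := hcon
  have hneg := score_sub_score_hyperRefl (z := z) hy hij x
  have h0 := sub_nonneg.2 (hx.2 j)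
  refine ⟨k, ?_, ?_, ?_⟩
  · rintro rfl; linarith
  · rintro rfl; exact lt_irrefl _ hk
  rw [abs_of_nonneg (sub_nonneg.2 (hx.2 k)), abs_of_nonneg h0]
  set h := score y z i x - score y z j x with hh
  have hu : 0 < ‖y i - y j‖ := norm_pos_iff.2 (sub_ne_zero.2 (hy.ne hij))
  rw [score_hyperRefl, score_hyperRefl, ← hh] at hk
  have hτ : 0 ≤ 2 * h / ‖y i - y j‖ ^ 2 := by positivity
  have b : ∀ l, |inner ℝ (y i - y j) (y l)| ≤ ‖y i - y j‖ * ∑ l, ‖y l‖ := fun l =>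
    (abs_real_inner_le_norm _ _).trans (mul_le_mul_of_nonneg_left
      (Finset.single_le_sum (fun l _ => norm_nonneg (y l)) (Finset.mem_univ l)) (norm_nonneg _))
  have bj := mul_le_mul_of_nonneg_left ((le_abs_self _).trans (b j)) hτ
  have bk := mul_le_mul_of_nonneg_left ((neg_le_abs _).trans (b k)) hτ
  have heq : 2 * h / ‖y i - y j‖ ^ 2 * (‖y i - y j‖ * ∑ l, ‖y l‖) =
      2 * (∑ l, ‖y l‖) / ‖y i - y j‖ * h := by field_simp
  rw [heq] at bj bk
  have h4 : (1 + 4 * (∑ l, ‖y l‖) / ‖y i - y j‖) * h =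
      h + 2 * (2 * (∑ l, ‖y l‖) / ‖y i - y j‖ * h) := by ring
  rw [h4]
  linarith

end Gibbs

/-! ### The exchange of mass across a facet -/

section PairEstimate

variable {d : ℕ} {ι : Type*} [Fintype ι] {X : Set (Euc d)} {y : ι → Euc d}

/-- The part of the cell of `i` whose reflection is not in the cell of `j` carries little of the
weight `exp (-|fᵢ - fⱼ| / ε)`: either a third score interferes, or the reflection leaves `X`. In the
second case points at distance `≥ 2 ε log (1 / ε)` from the hyperplane have weight `≤ ε ^ 2`, and
the others have volume of the order of the square of that distance, whence the logarithms. -/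
lemma exists_integral_exp_hyperRefl_notMem_le (hXc : Convex ℝ X) (hX : Bornology.IsBounded X)
    (hXm : MeasurableSet X) (hXi : (interior X).Nonempty) {a : ℝ} (ha : 0 < a)
    (hy : Function.Injective y) {i j : ι} (hij : i ≠ j) :
    ∃ C : ℝ, 0 < C ∧ ∀ z : ι → ℝ, (∀ i, a ≤ volume.real (lagCell X y z i)) →
      ∀ ε : ℝ, 0 < ε → ε < 1 →
      ∫ x in lagCell X y z i \ hyperRefl (y i - y j) (z i - z j) ⁻¹' lagCell X y z j,
        Real.exp (-|score y z i x - score y z j x| / ε) ≤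
        C * (ε ^ 2 + ε ^ 2 * Real.log (1 / ε) ^ 2) := by
  classical
  have hu : y i - y j ≠ 0 := sub_ne_zero.2 (hy.ne hij)
  obtain ⟨r, hr, Hr⟩ := exists_closedBall_subset_of_lagCell hXc hX hXi ha hy
  obtain ⟨C₁, hC₁, H₁⟩ := exists_volume_hyperRefl_notMem_le hXc hX hXm hu hr
  obtain ⟨C₂, hC₂, H₂⟩ := exists_integral_exp_score_mul_le hX ha hy
  set c : ℝ := 1 + 4 * (∑ l, ‖y l‖) / ‖y i - y j‖ with hc
  have hc1 : 1 ≤ c := by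
    have : 0 ≤ 4 * (∑ l, ‖y l‖) / ‖y i - y j‖ := by positivity
    linarith
  have hXfin : volume X ≠ ∞ := hX.measure_lt_top.ne
  refine ⟨4 * C₁ + volume.real X + Fintype.card ι * (C₂ * (2 * c) ^ 2), by positivity,
    fun z hz ε hε hε1 => ?_⟩
  set u := y i - y j
  set b := z i - z j
  set h : Euc d → ℝ := fun x => score y z i x - score y z j x with hh
  set s := (Finset.univ.erase i).erase j
  have hlog : 0 ≤ Real.log (1 / ε) := Real.log_nonneg (by rw [le_div_iff₀ hε]; linarith)
  -- At this distance from the hyperplane, the exponential weight is `ε ^ 2`.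
  set δ : ℝ := 2 * ε * Real.log (1 / ε) with hδ
  have hδ0 : 0 ≤ δ := by positivity
  have hexpδ : Real.exp (-δ / ε) = ε ^ 2 := by
    have h1 : -δ / ε = 2 * Real.log ε := by
      rw [hδ, one_div, Real.log_inv]; field_simp
    rw [h1, two_mul, Real.exp_add, Real.exp_log hε, sq]
  set bad : Set (Euc d) := {x ∈ X | |inner ℝ x u - b| ≤ δ ∧ hyperRefl u b x ∉ X} with hbad
  have hRm : Measurable (hyperRefl u b) := (measurePreserving_hyperRefl u b).measurable
  have hbadm : MeasurableSet bad :=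
    hXm.inter ((measurableSet_le (f := fun x : Euc d => |inner ℝ x u - b|) (by fun_prop)
      measurable_const).inter (hXm.preimage hRm).compl)
  -- If the `k`-th score is within `c * |h x|` of the `i`-th, then `exp (-|h x| / ε)` splits into
  -- two exponentials of the kind that three nearly equal scores control, with `2 * c * ε` for `ε`.
  set E : ι → Euc d → ℝ := fun k x => Real.exp (-|h x| / (2 * c * ε)) *
    Real.exp (-|score y z i x - score y z k x| / (2 * c * ε)) with hE
  have hE0 : ∀ k x, 0 ≤ E k x := fun k x => by positivity
  have hhm : Measurable h := by fun_prop
  have hEint : ∀ k, IntegrableOn (E k) X := fun k => by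
    refine Measure.integrableOn_of_bounded (M := 1) hXfin (by fun_prop) (ae_of_all _ fun x => ?_)
    rw [Real.norm_of_nonneg (hE0 k x)]
    refine mul_le_one₀ ?_ (Real.exp_pos _).le ?_ <;>
      exact Real.exp_le_one_iff.2 (div_nonpos_of_nonpos_of_nonneg (by simp) (by positivity))
  have hgle1 : ∀ x, Real.exp (-|h x| / ε) ≤ 1 := fun x =>
    Real.exp_le_one_iff.2 (div_nonpos_of_nonpos_of_nonneg (by simp) hε.le)
  have hbadint : IntegrableOn (bad.indicator (1 : Euc d → ℝ)) X :=
    (integrable_indicator_iff hbadm).2 (integrableOn_const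
      (ne_top_of_le_ne_top hXfin (Measure.restrict_apply_le _ _ |>.trans
        (measure_mono fun x hx => hx.1))))
  have hconst : IntegrableOn (fun _ : Euc d => ε ^ 2) X := integrableOn_const hXfin
  have hsumint : IntegrableOn (fun x => ∑ k ∈ s, E k x) X :=
    integrable_finsetSum _ fun k _ => hEint k
  set D := lagCell X y z i \ hyperRefl u b ⁻¹' lagCell X y z j with hD
  have hDm : MeasurableSet D :=
    (measurableSet_lagCell hXm y z i).diff ((measurableSet_lagCell hXm y z j).preimage hRm)
  have hDX : D ⊆ X := fun x hx => hx.1.1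
  set G : Euc d → ℝ := fun x => bad.indicator (1 : Euc d → ℝ) x + ε ^ 2 + ∑ k ∈ s, E k x
  have hGint : IntegrableOn G X := (hbadint.add hconst).add hsumint
  have hpt : ∀ x ∈ D, Real.exp (-|h x| / ε) ≤ G x := by
    intro x hx
    have hs0 : 0 ≤ ∑ k ∈ s, E k x := Finset.sum_nonneg fun k _ => hE0 k x
    have hi0 : 0 ≤ bad.indicator (1 : Euc d → ℝ) x := indicator_nonneg (by simp) x
    by_cases hxX : hyperRefl u b x ∈ X
    · obtain ⟨k, hki, hkj, hk⟩ := exists_score_sub_le_of_hyperRefl_notMem hy hij hx.1 hxX hx.2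
      have hks : k ∈ s := Finset.mem_erase.2 ⟨hkj, Finset.mem_erase.2 ⟨hki, Finset.mem_univ k⟩⟩
      have h1 : Real.exp (-|h x| / ε) ≤ E k x := by
        rw [hE]
        simp only
        rw [← Real.exp_add, ← add_div]
        refine Real.exp_le_exp.2 ?_
        rw [div_le_div_iff₀ hε (by positivity)]
        have h2 : |h x| ≤ c * |h x| := le_mul_of_one_le_left (abs_nonneg _) hc1
        have h3 : |h x| + |score y z i x - score y z k x| ≤ 2 * c * |h x| := by
          have : |score y z i x - score y z k x| ≤ c * |h x| := hk
          linarith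
        nlinarith
      have h2 := Finset.single_le_sum (f := fun k => E k x) (fun k _ => hE0 k x) hks
      have : 0 ≤ ε ^ 2 := by positivity
      simp only [G]
      linarith
    · by_cases hxδ : |inner ℝ x u - b| ≤ δ
      · have h1 : x ∈ bad := ⟨hx.1.1, hxδ, hxX⟩
        have h2 : bad.indicator (1 : Euc d → ℝ) x = 1 := by simp [h1]
        have := hgle1 x
        have : 0 ≤ ε ^ 2 := by positivity
        simp only [G]
        linarith
      · have h1 : Real.exp (-|h x| / ε) ≤ ε ^ 2 := by
          rw [← hexpδ]
          refine Real.exp_le_exp.2 (div_le_div_of_nonneg_right ?_ hε.le)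
          rw [hh]
          simp only
          rw [score_sub_score]
          exact neg_le_neg (not_le.1 hxδ).le
        simp only [G]
        linarith
  have hvol : volume.real bad ≤ C₁ * δ ^ 2 := by
    obtain ⟨o, ho, ho'⟩ := Hr z hz i j hij
    refine H₁ b o ho ?_ δ hδ0
    have := score_sub_score y z i j o
    rw [ho', sub_self] at this
    linarith
  have hGX : ∫ x in X, G x ≤ C₁ * δ ^ 2 + ε ^ 2 * volume.real X +
      Fintype.card ι * (C₂ * (2 * c * ε) ^ 2) := by
    have h1 : ∫ x in X, G x = (∫ x in X, bad.indicator (1 : Euc d → ℝ) x) + (∫ _x in X, ε ^ 2) +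
        ∑ k ∈ s, ∫ x in X, E k x := by
      rw [← integral_finsetSum _ fun k _ => hEint k, ← integral_add hbadint hconst,
        ← integral_add (f := fun x => bad.indicator (1 : Euc d → ℝ) x + ε ^ 2)
          (Integrable.add (f := bad.indicator 1) hbadint hconst) hsumint]
    rw [h1]
    have h2 : ∫ x in X, bad.indicator (1 : Euc d → ℝ) x = volume.real bad := by
      rw [integral_indicator_one hbadm, measureReal_restrict_apply hbadm,
        inter_eq_self_of_subset_left fun x hx => hx.1]
    have h3 : ∫ _x in X, ε ^ 2 = ε ^ 2 * volume.real X := by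
      rw [setIntegral_const, smul_eq_mul, mul_comm]
    have h4 : ∑ k ∈ s, ∫ x in X, E k x ≤ Fintype.card ι * (C₂ * (2 * c * ε) ^ 2) := by
      calc ∑ k ∈ s, ∫ x in X, E k x ≤ ∑ k ∈ s, C₂ * (2 * c * ε) ^ 2 := by
            refine Finset.sum_le_sum fun k hk => ?_
            have hkj := (Finset.mem_erase.1 hk).1
            have hki := (Finset.mem_erase.1 (Finset.mem_erase.1 hk).2).1
            exact H₂ z hz i j k hij hki.symm hkj.symm _ (by positivity)
        _ ≤ _ := by
            rw [Finset.sum_const, nsmul_eq_mul]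
            gcongr
            exact Finset.card_le_univ s
    rw [h2, h3]
    linarith
  calc ∫ x in D, Real.exp (-|h x| / ε) ≤ ∫ x in D, G x := by
        refine setIntegral_mono_on ?_ (hGint.mono_set hDX) hDm hpt
        exact Measure.integrableOn_of_bounded (M := 1)
          (ne_top_of_le_ne_top hXfin (measure_mono hDX)) (by fun_prop)
          (ae_of_all _ fun x => by rw [Real.norm_of_nonneg (Real.exp_pos _).le]; exact hgle1 x)
    _ ≤ ∫ x in X, G x := by
        refine setIntegral_mono_set hGint (ae_of_all _ fun x => ?_) hDX.eventuallyLE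
        exact add_nonneg (add_nonneg (indicator_nonneg (by simp) x) (by positivity))
          (Finset.sum_nonneg fun k _ => hE0 k x)
    _ ≤ _ := hGX
    _ ≤ _ := by
        rw [hδ]
        set L := Real.log (1 / ε)
        have e1 : 0 ≤ C₁ * ε ^ 2 := by positivity
        have e2 : 0 ≤ volume.real X * (ε ^ 2 * L ^ 2) := by positivity
        have e3 : 0 ≤ Fintype.card ι * (C₂ * (2 * c) ^ 2) * (ε ^ 2 * L ^ 2) := by positivity
        nlinarith

/-- Near the hyperplane between two cells, the soft assignment spreads mass symmetrically, so that
an `α`-Hölder weight feels it only through its variation over a distance of order `ε`. -/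
lemma exists_abs_integral_pairWeight_sub_le (hXc : Convex ℝ X) (hX : Bornology.IsBounded X)
    (hXm : MeasurableSet X) (hXi : (interior X).Nonempty) {a : ℝ} (ha : 0 < a)
    (hy : Function.Injective y) {α : ℝ} (hα : 0 < α) (hα1 : α ≤ 1) {i j : ι} (hij : i ≠ j) :
    ∃ C : ℝ, 0 < C ∧ ∀ z : ι → ℝ, (∀ i, a ≤ volume.real (lagCell X y z i)) →
      ∀ ε : ℝ, 0 < ε → ε < 1 → ∀ (B : ℝ) (χ : Euc d → ℝ), Measurable χ → (∀ x ∈ X, |χ x| ≤ B) →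
      (∀ x ∈ X, ∀ x' ∈ X, |χ x - χ x'| ≤ B * ‖x - x'‖ ^ α) →
      |(∫ x in lagCell X y z i, pairWeight y z ε i j x * χ x) -
        ∫ x in lagCell X y z j, pairWeight y z ε i j x * χ x| ≤
        C * B * (ε ^ (1 + α) + ε ^ 2 * Real.log (1 / ε) ^ 2) := by
  have hu : y i - y j ≠ 0 := sub_ne_zero.2 (hy.ne hij)
  have hu' : 0 < ‖y i - y j‖ := norm_pos_iff.2 hu
  obtain ⟨C₁, hC₁, H₁⟩ := exists_integral_exp_hyperRefl_notMem_le hXc hX hXm hXi ha hy hij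
  obtain ⟨C₁', hC₁', H₁'⟩ := exists_integral_exp_hyperRefl_notMem_le hXc hX hXm hXi ha hy hij.symm
  obtain ⟨C₂, hC₂, H₂⟩ := exists_integral_exp_score_le hX hy
  have hXfin : volume X ≠ ∞ := hX.measure_lt_top.ne
  refine ⟨(2 / ‖y i - y j‖) ^ α * (4 * C₂) + C₁ + C₁', by positivity,
    fun z hz ε hε hε1 B χ hχ hB hH => ?_⟩
  obtain ⟨x₀, hx₀⟩ : X.Nonempty := hXi.mono interior_subset
  have hB0 : 0 ≤ B := (abs_nonneg _).trans (hB x₀ hx₀)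
  set u := y i - y j
  set b := z i - z j
  set R := hyperRefl u b with hR
  set A := lagCell X y z i
  set A' := lagCell X y z j
  set W : Euc d → ℝ := fun x => pairWeight y z ε i j x * χ x with hW
  set h : Euc d → ℝ := fun x => score y z i x - score y z j x with hh
  have hRmp : MeasurePreserving R := measurePreserving_hyperRefl u b
  have hRm : Measurable R := hRmp.measurable
  have hRR : ∀ x, R (R x) = x := hyperRefl_hyperRefl hu b
  have hRemb : MeasurableEmbedding R := by
    have : R = (MeasurableEquiv.mk ⟨R, R, hRR, hRR⟩ hRm hRm : Euc d ≃ᵐ Euc d) := rfl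
    rw [this]
    exact MeasurableEquiv.measurableEmbedding _
  have hAm : MeasurableSet A := measurableSet_lagCell hXm y z i
  have hA'm : MeasurableSet A' := measurableSet_lagCell hXm y z j
  have hAX : A ⊆ X := lagCell_subset X y z i
  have hA'X : A' ⊆ X := lagCell_subset X y z j
  have hWm : Measurable W := by fun_prop
  have hhm : Measurable h := by fun_prop
  have hWle : ∀ x ∈ X, |W x| ≤ B * Real.exp (-|h x| / ε) := by
    intro x hx
    rw [hW]
    simp only
    rw [abs_mul, abs_of_nonneg (pairWeight_nonneg i j x), mul_comm]
    exact mul_le_mul (hB x hx) (pairWeight_le_exp i j x) (pairWeight_nonneg i j x) hB0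
  have hexp1 : ∀ x, ∀ ε' > 0, Real.exp (-|h x| / ε') ≤ 1 := fun x ε' hε' =>
    Real.exp_le_one_iff.2 (div_nonpos_of_nonpos_of_nonneg (by simp) hε'.le)
  have hWB : ∀ x ∈ X, |W x| ≤ B := fun x hx =>
    (hWle x hx).trans (mul_le_of_le_one_right hB0 (hexp1 x ε hε))
  have hWint : ∀ S ⊆ X, MeasurableSet S → IntegrableOn W S := fun S hS hSm =>
    Measure.integrableOn_of_bounded (M := B) (ne_top_of_le_ne_top hXfin (measure_mono hS))
      hWm.aestronglyMeasurable
      ((ae_restrict_iff' hSm).2 (ae_of_all _ fun x hx => hWB x (hS hx)))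
  have hexpint : ∀ S ⊆ X, ∀ ε' > 0, IntegrableOn (fun x => Real.exp (-|h x| / ε')) S :=
    fun S hS ε' hε' =>
    Measure.integrableOn_of_bounded (M := 1) (ne_top_of_le_ne_top hXfin (measure_mono hS))
      (by fun_prop) (ae_of_all _ fun x => by
        rw [Real.norm_of_nonneg (Real.exp_pos _).le]; exact hexp1 x ε' hε')
  have hWRint : ∀ S ⊆ X, MeasurableSet S → IntegrableOn (W ∘ R) (R ⁻¹' S) := fun S hS hSm =>
    (hRmp.integrableOn_comp_preimage hRemb).2 (hWint S hS hSm)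
  have hpre : ∀ S, ∫ x in R ⁻¹' S, W (R x) = ∫ x in S, W x := fun S =>
    hRmp.setIntegral_preimage_emb hRemb W S
  have hIm : MeasurableSet (A ∩ R ⁻¹' A') := hAm.inter (hA'm.preimage hRm)
  have hpp : R ⁻¹' (A' \ R ⁻¹' A) = R ⁻¹' A' \ A := by
    ext x; simp [hRR]
  -- The reflection carries the bulk of one cell onto the bulk of the other.
  have hsplit : (∫ x in A, W x) - ∫ x in A', W x = (∫ x in A ∩ R ⁻¹' A', (W x - W (R x))) +
      (∫ x in A \ R ⁻¹' A', W x) - ∫ x in A' \ R ⁻¹' A, W x := by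
    have h1 := integral_inter_add_sdiff (hA'm.preimage hRm) (hWint A hAX hAm)
    have h2 := integral_inter_add_sdiff hAm (hWRint A' hA'X hA'm)
    simp only [Function.comp] at h2
    rw [hpre A', ← hpp, hpre, inter_comm] at h2
    rw [integral_sub (g := fun x => W (R x)) ((hWint A hAX hAm).mono_set inter_subset_left)
      ((hWRint A' hA'X hA'm).mono_set inter_subset_right), ← h1, ← h2]
    ring
  have hbd : ∀ S ⊆ X, MeasurableSet S → ∀ c, ∫ x in S, Real.exp (-|h x| / ε) ≤ c →
      |∫ x in S, W x| ≤ B * c := by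
    intro S hS hSm c hc
    calc |∫ x in S, W x| ≤ ∫ x in S, |W x| := abs_integral_le_integral_abs
      _ ≤ ∫ x in S, B * Real.exp (-|h x| / ε) :=
          setIntegral_mono_on (hWint S hS hSm).abs ((hexpint S hS ε hε).const_mul B) hSm
            fun x hx => hWle x (hS hx)
      _ = B * ∫ x in S, Real.exp (-|h x| / ε) := integral_const_mul _ _
      _ ≤ B * c := by gcongr
  have hR1 : hyperRefl (y j - y i) (z j - z i) = R := by
    rw [hR, ← hyperRefl_neg, neg_sub, neg_sub]
  have e1 := hbd (A \ R ⁻¹' A') (sdiff_subset.trans hAX) (hAm.diff (hA'm.preimage hRm)) _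
    (H₁ z hz ε hε hε1)
  have e2 := hbd (A' \ R ⁻¹' A) (sdiff_subset.trans hA'X) (hA'm.diff (hAm.preimage hRm)) _
    (by simpa only [hR1, abs_sub_comm (score y z j _)] using H₁' z hz ε hε hε1)
  -- Here `(t / ε) ^ α ≤ 2 * exp (t / (2 * ε))` turns the Hölder factor into a factor `ε ^ α`.
  have hpt : ∀ x ∈ A ∩ R ⁻¹' A', ‖W x - W (R x)‖ ≤
      B * ((2 / ‖u‖) ^ α * (2 * ε ^ α)) * Real.exp (-|h x| / (2 * ε)) := by
    intro x hx
    have hxX := hAX hx.1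
    have hRX := hA'X hx.2
    have f1 : W x - W (R x) = pairWeight y z ε i j x * (χ x - χ (R x)) := by
      rw [hW]
      simp only
      rw [hR, pairWeight_hyperRefl hy hij]
      ring
    have f2 : ‖x - R x‖ ^ α = (2 / ‖u‖) ^ α * ε ^ α * (|h x| / ε) ^ α := by
      rw [hR, norm_sub_hyperRefl hu, ← Real.mul_rpow (by positivity) hε.le,
        ← Real.mul_rpow (by positivity) (by positivity), ← score_sub_score]
      congr 1
      field_simp
      rfl
    have f3 : (|h x| / ε) ^ α ≤ 2 * Real.exp (|h x| / (2 * ε)) := by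
      set τ := |h x| / ε with hτ
      have hτ0 : 0 ≤ τ := by positivity
      have g1 : τ ^ α ≤ 1 + τ := by
        rcases le_total τ 1 with ht | ht
        · have := Real.rpow_le_one hτ0 ht hα.le
          linarith
        · have := Real.rpow_le_rpow_of_exponent_le ht hα1
          rw [Real.rpow_one] at this
          linarith
      have g2 : |h x| / (2 * ε) = τ / 2 := by rw [hτ]; field_simp
      have g3 := Real.add_one_le_exp (τ / 2)
      rw [g2]
      linarith
    have f4 : Real.exp (-|h x| / ε) * Real.exp (|h x| / (2 * ε)) =
        Real.exp (-|h x| / (2 * ε)) := by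
      rw [← Real.exp_add]
      congr 1
      field_simp
      ring
    rw [f1, norm_mul, Real.norm_of_nonneg (pairWeight_nonneg i j x), Real.norm_eq_abs]
    calc pairWeight y z ε i j x * |χ x - χ (R x)|
        ≤ Real.exp (-|h x| / ε) * (B * ((2 / ‖u‖) ^ α * ε ^ α *
            (2 * Real.exp (|h x| / (2 * ε))))) := by
          refine mul_le_mul (pairWeight_le_exp i j x) ((hH x hxX _ hRX).trans ?_) (abs_nonneg _)
            (Real.exp_pos _).le
          rw [f2]
          gcongr
      _ = B * ((2 / ‖u‖) ^ α * (2 * ε ^ α)) *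
            (Real.exp (-|h x| / ε) * Real.exp (|h x| / (2 * ε))) := by ring
      _ = _ := by rw [f4]
  have e3 : |∫ x in A ∩ R ⁻¹' A', (W x - W (R x))| ≤
      B * ((2 / ‖u‖) ^ α * (2 * ε ^ α)) * (C₂ * (2 * ε)) := by
    have hsub : A ∩ R ⁻¹' A' ⊆ X := inter_subset_left.trans hAX
    calc |∫ x in A ∩ R ⁻¹' A', (W x - W (R x))|
        ≤ ∫ x in A ∩ R ⁻¹' A',
            B * ((2 / ‖u‖) ^ α * (2 * ε ^ α)) * Real.exp (-|h x| / (2 * ε)) :=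
          norm_integral_le_of_norm_le ((hexpint _ hsub (2 * ε) (by positivity)).const_mul _)
            ((ae_restrict_iff' hIm).2 (ae_of_all _ hpt))
      _ ≤ ∫ x in X, B * ((2 / ‖u‖) ^ α * (2 * ε ^ α)) * Real.exp (-|h x| / (2 * ε)) :=
          setIntegral_mono_set ((hexpint X subset_rfl (2 * ε) (by positivity)).const_mul _)
            (ae_of_all _ fun x => by positivity) hsub.eventuallyLE
      _ = B * ((2 / ‖u‖) ^ α * (2 * ε ^ α)) * ∫ x in X, Real.exp (-|h x| / (2 * ε)) :=
          integral_const_mul _ _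
      _ ≤ _ := by
          gcongr
          exact H₂ z i j hij (2 * ε) (by positivity)
  have hpow : ε ^ (1 + α) = ε * ε ^ α := by rw [Real.rpow_add hε, Real.rpow_one]
  have hpow2 : ε ^ 2 ≤ ε ^ (1 + α) := by
    rw [← Real.rpow_natCast]
    exact Real.rpow_le_rpow_of_exponent_ge hε hε1.le (by push_cast; linarith)
  rw [hsplit]
  set L := Real.log (1 / ε)
  set c := (2 / ‖u‖) ^ α
  have hc : 0 ≤ c := by positivity
  have e1' : |∫ x in A \ R ⁻¹' A', W x| ≤ B * (C₁ * (ε ^ (1 + α) + ε ^ 2 * L ^ 2)) :=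
    e1.trans (by gcongr)
  have e2' : |∫ x in A' \ R ⁻¹' A, W x| ≤ B * (C₁' * (ε ^ (1 + α) + ε ^ 2 * L ^ 2)) :=
    e2.trans (by gcongr)
  have e3' : |∫ x in A ∩ R ⁻¹' A', (W x - W (R x))| ≤
      B * (c * (4 * C₂) * (ε ^ (1 + α) + ε ^ 2 * L ^ 2)) := by
    refine e3.trans ?_
    have : B * (c * (2 * ε ^ α)) * (C₂ * (2 * ε)) = B * (c * (4 * C₂) * ε ^ (1 + α)) := by
      rw [hpow]; ring
    rw [this]
    gcongr
    have : 0 ≤ ε ^ 2 * L ^ 2 := by positivity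
    linarith
  calc _ ≤ |∫ x in A ∩ R ⁻¹' A', (W x - W (R x))| + |∫ x in A \ R ⁻¹' A', W x| +
        |∫ x in A' \ R ⁻¹' A, W x| := (abs_sub _ _).trans (by gcongr; exact abs_add_le _ _)
    _ ≤ _ := by linarith

end PairEstimate

/-! ### The soft assignment and the cells with the same weights -/

section CellEstimate

variable {d : ℕ} {ι : Type*} [Fintype ι] {X : Set (Euc d)} {y : ι → Euc d}

lemma aedisjoint_lagCell (hX : Bornology.IsBounded X) (hy : Function.Injective y) (z : ι → ℝ)
    {i j : ι} (hij : i ≠ j) : AEDisjoint volume (lagCell X y z i) (lagCell X y z j) :=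
  measure_mono_null (t := {x ∈ X | score y z i x = score y z j x})
    (fun _ hx => ⟨hx.1.1, le_antisymm (hx.2.2 i) (hx.1.2 j)⟩) (volume_score_eq_zero hX hy z hij)

lemma iUnion_lagCell [Nonempty ι] (z : ι → ℝ) : ⋃ i, lagCell X y z i = X := by
  ext x
  rw [mem_iUnion]
  exact ⟨fun ⟨i, hi⟩ => hi.1, fun hx => exists_mem_lagCell y z hx⟩

lemma setIntegral_eq_sum_lagCell [Nonempty ι] (hX : Bornology.IsBounded X)
    (hXm : MeasurableSet X) (hy : Function.Injective y) (z : ι → ℝ) {F : Euc d → ℝ}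
    (hF : IntegrableOn F X) : ∫ x in X, F x = ∑ i, ∫ x in lagCell X y z i, F x := by
  have h := integral_iUnion_ae (μ := volume) (f := F) (s := lagCell X y z)
    (fun i => (measurableSet_lagCell hXm y z i).nullMeasurableSet)
    (fun i j hij => aedisjoint_lagCell hX hy z hij) (by rwa [iUnion_lagCell])
  rwa [iUnion_lagCell, tsum_fintype] at h

lemma integrableOn_of_abs_le {S : Set (Euc d)} (hX : Bornology.IsBounded X) (hS : S ⊆ X)
    (hSm : MeasurableSet S) {f : Euc d → ℝ} (hf : Measurable f) {B : ℝ}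
    (hB : ∀ x ∈ S, |f x| ≤ B) : IntegrableOn f S :=
  Measure.integrableOn_of_bounded (M := B)
    (ne_top_of_le_ne_top hX.measure_lt_top.ne (measure_mono hS)) hf.aestronglyMeasurable
    ((ae_restrict_iff' hSm).2 (ae_of_all _ hB))

/-- Integrated against Hölder weights, the soft assignment and the assignment to the Laguerre cells
with the same weights `z` differ by `O(ε ^ (1 + α) + ε ^ 2 log ^ 2 (1 / ε))`: in the sum over
all pairs of cells, the main terms of `(i, j)` and `(j, i)` nearly cancel. -/
lemma exists_abs_integral_gibbs_sub_indicator_le [Nonempty ι] (hXc : Convex ℝ X)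
    (hX : Bornology.IsBounded X) (hXm : MeasurableSet X) (hXi : (interior X).Nonempty) {a : ℝ}
    (ha : 0 < a) (hy : Function.Injective y) {α : ℝ} (hα : 0 < α) (hα1 : α ≤ 1) :
    ∃ C : ℝ, 0 < C ∧ ∀ z : ι → ℝ, (∀ i, a ≤ volume.real (lagCell X y z i)) →
      ∀ ε : ℝ, 0 < ε → ε < 1 → ∀ (B : ℝ) (ψ : ι → Euc d → ℝ), (∀ i, Measurable (ψ i)) →
      (∀ i, ∀ x ∈ X, |ψ i x| ≤ B) →
      (∀ i, ∀ x ∈ X, ∀ x' ∈ X, |ψ i x - ψ i x'| ≤ B * ‖x - x'‖ ^ α) →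
      |∫ x in X, ∑ i, ψ i x * (gibbs y z ε i x - (lagCell X y z i).indicator 1 x)| ≤
        C * B * (ε ^ (1 + α) + ε ^ 2 * Real.log (1 / ε) ^ 2) := by
  classical
  obtain ⟨C₁, hC₁, H₁⟩ := exists_integral_exp_score_mul_le hX ha hy
  obtain ⟨C₂, hC₂, H₂⟩ := exists_forall_of_finite
    (p := fun (q : ι × ι) C => q.1 ≠ q.2 → ∀ z : ι → ℝ,
      (∀ i, a ≤ volume.real (lagCell X y z i)) →
      ∀ ε : ℝ, 0 < ε → ε < 1 → ∀ (B : ℝ) (χ : Euc d → ℝ), Measurable χ → (∀ x ∈ X, |χ x| ≤ B) →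
      (∀ x ∈ X, ∀ x' ∈ X, |χ x - χ x'| ≤ B * ‖x - x'‖ ^ α) →
      |(∫ x in lagCell X y z q.1, pairWeight y z ε q.1 q.2 x * χ x) -
        ∫ x in lagCell X y z q.2, pairWeight y z ε q.1 q.2 x * χ x| ≤
        C * B * (ε ^ (1 + α) + ε ^ 2 * Real.log (1 / ε) ^ 2))
    (fun q b c hbc h hq z hz ε hε hε1 B χ hχ hB hH => by
      obtain ⟨x₀, hx₀⟩ : X.Nonempty := hXi.mono interior_subset
      have hB0 : 0 ≤ B := (abs_nonneg _).trans (hB x₀ hx₀)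
      exact (h hq z hz ε hε hε1 B χ hχ hB hH).trans (by gcongr))
    (fun q => by
      by_cases hq : q.1 = q.2
      · exact ⟨0, fun h => absurd hq h⟩
      · obtain ⟨C, -, H⟩ := exists_abs_integral_pairWeight_sub_le hXc hX hXm hXi ha hy hα hα1 hq
        exact ⟨C, fun _ => H⟩)
  set N : ℝ := (Fintype.card ι : ℝ) with hN
  have hN0 : 0 < N := by rw [hN]; exact_mod_cast Fintype.card_pos
  refine ⟨N ^ 2 * (2 * (N * C₁)) + N ^ 2 * C₂, by positivity,
    fun z hz ε hε hε1 B ψ hψ hB hH => ?_⟩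
  obtain ⟨x₀, hx₀⟩ : X.Nonempty := hXi.mono interior_subset
  have hB0 : 0 ≤ B := (abs_nonneg _).trans (hB (Classical.arbitrary ι) x₀ hx₀)
  set c : ι → Set (Euc d) := lagCell X y z with hc
  have hcX : ∀ i, c i ⊆ X := lagCell_subset X y z
  have hcm : ∀ i, MeasurableSet (c i) := measurableSet_lagCell hXm y z
  set rate : ℝ := ε ^ (1 + α) + ε ^ 2 * Real.log (1 / ε) ^ 2 with hrate
  have hdiff : ∀ i j, ∀ x ∈ X, |ψ j x - ψ i x| ≤ 2 * B := fun i j x hx => by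
    linarith [abs_sub (ψ j x) (ψ i x), hB i x hx, hB j x hx]
  set F : Euc d → ℝ := fun x => ∑ i, ψ i x * (gibbs y z ε i x - (c i).indicator 1 x) with hF
  have hFm : Measurable F := by
    refine Finset.measurable_sum _ fun i _ => (hψ i).mul ?_
    exact (measurable_gibbs y z ε i).sub (measurable_one.indicator (hcm i))
  have hind : ∀ i x, (c i).indicator (1 : Euc d → ℝ) x ∈ Icc (0 : ℝ) 1 := fun i x => by
    by_cases hx : x ∈ c i <;> simp [hx]
  have hFint : IntegrableOn F X := by
    refine integrableOn_of_abs_le hX subset_rfl hXm hFm (B := ∑ _i : ι, B * 1) fun x hx => ?_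
    refine (Finset.abs_sum_le_sum_abs _ _).trans (Finset.sum_le_sum fun i _ => ?_)
    rw [abs_mul]
    refine mul_le_mul (hB i x hx) ?_ (abs_nonneg _) hB0
    have h1 := hind i x
    have h2 := gibbs_nonneg (y := y) (z := z) (ε := ε) i x
    have h3 := gibbs_le_one (y := y) (z := z) (ε := ε) i x
    exact abs_le.2 ⟨by linarith [h1.2], by linarith [h1.1]⟩
  -- `A i j` is the effect of the mass which the soft assignment moves from the cell of `i` to `j`,
  -- and `Bp i j` the same quantity in the absence of other indices.
  set A : ι → ι → ℝ := fun i j => ∫ x in c i, gibbs y z ε j x * (ψ j x - ψ i x) with hA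
  set Bp : ι → ι → ℝ := fun i j => ∫ x in c i, pairWeight y z ε i j x * (ψ j x - ψ i x) with hBp
  have hAint : ∀ i j, IntegrableOn (fun x => gibbs y z ε j x * (ψ j x - ψ i x)) (c i) := by
    intro i j
    refine integrableOn_of_abs_le hX (hcX i) (hcm i) (by fun_prop) (B := 1 * (2 * B)) fun x hx => ?_
    rw [abs_mul, abs_of_nonneg (gibbs_nonneg j x)]
    exact mul_le_mul (gibbs_le_one j x) (hdiff i j x (hcX i hx)) (abs_nonneg _) zero_le_one
  have hBint : ∀ i j, IntegrableOn (fun x => pairWeight y z ε i j x * (ψ j x - ψ i x)) (c i) := by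
    intro i j
    refine integrableOn_of_abs_le hX (hcX i) (hcm i) (by fun_prop) (B := 1 * (2 * B)) fun x hx => ?_
    rw [abs_mul, abs_of_nonneg (pairWeight_nonneg i j x)]
    exact mul_le_mul (pairWeight_le_one hε i j x) (hdiff i j x (hcX i hx)) (abs_nonneg _)
      zero_le_one
  have hcell : ∀ i, ∫ x in c i, F x = ∑ j, A i j := by
    intro i
    rw [hA, ← integral_finsetSum _ fun j _ => hAint i j]
    refine integral_congr_ae ?_
    filter_upwards [ae_restrict_of_ae_restrict_of_subset (hcX i)
      (ae_mem_lagCell_unique hX hXm hy z), ae_restrict_mem (hcm i)] with x hx hxi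
    have h1 : ∀ k, (c k).indicator (1 : Euc d → ℝ) x = if k = i then 1 else 0 := by
      intro k
      by_cases hk : k = i
      · rw [hk]; simp [hxi]
      · have : x ∉ c k := fun h => hk (hx k i h hxi)
        simp [hk, this]
    have h2 : ∑ j, ψ i x * gibbs y z ε j x = ψ i x := by
      rw [← Finset.mul_sum, sum_gibbs, mul_one]
    simp only [hF, h1, mul_sub, Finset.sum_sub_distrib, h2, mul_ite, mul_one, mul_zero,
      Finset.sum_ite_eq', Finset.mem_univ, if_true, mul_comm]
  have hAB : ∀ i j, |A i j - Bp i j| ≤ 2 * B * (N * (C₁ * ε ^ 2)) := by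
    intro i j
    by_cases hij : i = j
    · subst hij
      simp only [hA, hBp, sub_self, mul_zero, integral_zero, abs_zero]
      positivity
    set E : ι → Euc d → ℝ := fun k x => Real.exp (-|score y z i x - score y z j x| / ε) *
        Real.exp (-|score y z i x - score y z k x| / ε) with hE
    have hE0 : ∀ k x, 0 ≤ E k x := fun k x => by positivity
    have hEint : ∀ k, IntegrableOn (E k) X := fun k => by
      refine integrableOn_of_abs_le hX subset_rfl hXm (by fun_prop) (B := 1) fun x _ => ?_
      rw [abs_of_nonneg (hE0 k x)]
      refine mul_le_one₀ ?_ (Real.exp_pos _).le ?_ <;>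
        exact Real.exp_le_one_iff.2 (div_nonpos_of_nonpos_of_nonneg (by simp) hε.le)
    set s := (Finset.univ.erase i).erase j
    have hsint : IntegrableOn (fun x => 2 * B * ∑ k ∈ s, E k x) X :=
      Integrable.const_mul (integrable_finsetSum _ fun k _ => hEint k) _
    rw [hA, hBp]
    simp only
    rw [← integral_sub (hAint i j) (hBint i j)]
    calc |∫ x in c i, (gibbs y z ε j x * (ψ j x - ψ i x) -
          pairWeight y z ε i j x * (ψ j x - ψ i x))|
        ≤ ∫ x in c i, 2 * B * ∑ k ∈ s, E k x := by
          refine (Real.norm_eq_abs _).symm.le.trans (norm_integral_le_of_norm_le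
            (hsint.mono_set (hcX i)) ((ae_restrict_iff' (hcm i)).2 (ae_of_all _ fun x hx => ?_)))
          rw [← sub_mul, norm_mul, mul_comm, Real.norm_eq_abs, Real.norm_eq_abs]
          exact mul_le_mul (hdiff i j x (hcX i hx)) (abs_gibbs_sub_pairWeight_le hij hx)
            (abs_nonneg _) (by positivity)
      _ ≤ ∫ x in X, 2 * B * ∑ k ∈ s, E k x :=
          setIntegral_mono_set hsint (ae_of_all _ fun x =>
            mul_nonneg (by positivity) (Finset.sum_nonneg fun k _ => hE0 k x)) (hcX i).eventuallyLE
      _ = 2 * B * ∑ k ∈ s, ∫ x in X, E k x := by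
          rw [integral_const_mul, integral_finsetSum _ fun k _ => hEint k]
      _ ≤ 2 * B * ∑ k ∈ s, C₁ * ε ^ 2 := by
          gcongr with k hk
          have hkj := (Finset.mem_erase.1 hk).1
          have hki := (Finset.mem_erase.1 (Finset.mem_erase.1 hk).2).1
          exact H₁ z hz i j k hij hki.symm hkj.symm ε hε
      _ ≤ _ := by
          rw [Finset.sum_const, nsmul_eq_mul]
          gcongr
          rw [hN]
          exact_mod_cast Finset.card_le_univ s
  have hpair : ∀ i j, |Bp i j + Bp j i| ≤ C₂ * (2 * B) * rate := by
    intro i j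
    by_cases hij : i = j
    · subst hij
      simp only [hBp, sub_self, mul_zero, integral_zero, abs_zero, add_zero]
      positivity
    have h1 : Bp j i = -∫ x in c j, pairWeight y z ε i j x * (ψ j x - ψ i x) := by
      rw [← integral_neg]
      simp only [hBp, pairWeight_comm j i]
      congr 1; funext x; ring
    rw [h1, ← sub_eq_add_neg]
    refine H₂ (i, j) hij z hz ε hε hε1 (2 * B) (fun x => ψ j x - ψ i x) (by fun_prop)
      (hdiff i j) fun x hx x' hx' => ?_
    have h2 := hH i x hx x' hx'
    have h3 := hH j x hx x' hx'
    have h4 : ψ j x - ψ i x - (ψ j x' - ψ i x') = (ψ j x - ψ j x') - (ψ i x - ψ i x') := by ring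
    rw [h4]
    linarith [abs_sub (ψ j x - ψ j x') (ψ i x - ψ i x')]
  have hsumB : 2 * ∑ i, ∑ j, Bp i j = ∑ i, ∑ j, (Bp i j + Bp j i) := by
    simp_rw [Finset.sum_add_distrib]
    rw [Finset.sum_comm (f := fun i j => Bp j i), two_mul]
  have hsumB' : |∑ i, ∑ j, Bp i j| ≤ N ^ 2 * C₂ * B * rate := by
    have h1 : |∑ i, ∑ j, (Bp i j + Bp j i)| ≤ ∑ _i : ι, ∑ _j : ι, C₂ * (2 * B) * rate :=
      (Finset.abs_sum_le_sum_abs _ _).trans (Finset.sum_le_sum fun i _ =>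
        (Finset.abs_sum_le_sum_abs _ _).trans (Finset.sum_le_sum fun j _ => hpair i j))
    rw [← hsumB, abs_mul, abs_two] at h1
    simp only [Finset.sum_const, Finset.card_univ, nsmul_eq_mul, ← hN] at h1
    nlinarith
  have hsumAB : |∑ i, ∑ j, (A i j - Bp i j)| ≤ N ^ 2 * (2 * B * (N * (C₁ * ε ^ 2))) := by
    have h1 : |∑ i, ∑ j, (A i j - Bp i j)| ≤ ∑ _i : ι, ∑ _j : ι, 2 * B * (N * (C₁ * ε ^ 2)) :=
      (Finset.abs_sum_le_sum_abs _ _).trans (Finset.sum_le_sum fun i _ =>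
        (Finset.abs_sum_le_sum_abs _ _).trans (Finset.sum_le_sum fun j _ => hAB i j))
    simp only [Finset.sum_const, Finset.card_univ, nsmul_eq_mul, ← hN] at h1
    linarith
  have hpow2 : ε ^ 2 ≤ rate := by
    have h1 : ε ^ 2 ≤ ε ^ (1 + α) := by
      rw [← Real.rpow_natCast]
      exact Real.rpow_le_rpow_of_exponent_ge hε hε1.le (by push_cast; linarith)
    have h2 : 0 ≤ ε ^ 2 * Real.log (1 / ε) ^ 2 := by positivity
    linarith
  have hmain : ∫ x in X, F x = ∑ i, ∑ j, (A i j - Bp i j) + ∑ i, ∑ j, Bp i j := by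
    rw [setIntegral_eq_sum_lagCell hX hXm hy z hFint]
    simp only [Finset.sum_sub_distrib, sub_add_cancel]
    exact Finset.sum_congr rfl fun i _ => hcell i
  rw [hmain]
  refine (abs_add_le _ _).trans ?_
  have h5 : N ^ 2 * (2 * B * (N * (C₁ * ε ^ 2))) ≤ N ^ 2 * (2 * (N * C₁)) * B * rate := by
    have : N ^ 2 * (2 * B * (N * (C₁ * ε ^ 2))) = N ^ 2 * (2 * (N * C₁)) * B * ε ^ 2 := by ring
    rw [this]
    gcongr
  linarith

/-- Without any condition on the cells, the soft assignment is within `O(ε)` of the assignment to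
the cells in `L¹`. -/
lemma exists_integral_abs_gibbs_sub_indicator_le (hX : Bornology.IsBounded X)
    (hXm : MeasurableSet X) (hy : Function.Injective y) :
    ∃ C : ℝ, 0 < C ∧ ∀ (z : ι → ℝ) (ε : ℝ), 0 < ε → ∀ i,
      ∫ x in X, |gibbs y z ε i x - (lagCell X y z i).indicator 1 x| ≤ C * ε := by
  classical
  obtain ⟨C, hC, H⟩ := exists_integral_exp_score_le hX hy
  refine ⟨Fintype.card ι * C + 1, by positivity, fun z ε hε i => ?_⟩
  have : Nonempty ι := ⟨i⟩
  set E : ι → Euc d → ℝ := fun k x => Real.exp (-|score y z i x - score y z k x| / ε) with hE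
  have hE0 : ∀ k x, 0 ≤ E k x := fun k x => (Real.exp_pos _).le
  have hEint : ∀ k, IntegrableOn (E k) X := fun k =>
    integrableOn_of_abs_le hX subset_rfl hXm (by fun_prop) (B := 1) fun x _ => by
      rw [abs_of_nonneg (hE0 k x)]
      exact Real.exp_le_one_iff.2 (div_nonpos_of_nonpos_of_nonneg (by simp) hε.le)
  have hpt : ∀ x ∈ X, |gibbs y z ε i x - (lagCell X y z i).indicator 1 x| ≤
      ∑ k ∈ Finset.univ.erase i, E k x := by
    intro x hx
    by_cases hxi : x ∈ lagCell X y z i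
    · have h1 : (lagCell X y z i).indicator (1 : Euc d → ℝ) x = 1 := by simp [hxi]
      have h2 := sum_gibbs (y := y) (z := z) (ε := ε) x
      rw [← Finset.add_sum_erase _ _ (Finset.mem_univ i)] at h2
      rw [h1, abs_sub_comm,
        abs_of_nonneg (by linarith [gibbs_le_one (y := y) (z := z) (ε := ε) i x]),
        ← h2, add_sub_cancel_left]
      refine Finset.sum_le_sum fun k _ => (gibbs_le_exp i k x).trans_eq ?_
      rw [hE]
      simp only
      rw [abs_of_nonneg (sub_nonneg.2 (hxi.2 k)), neg_sub]
    · have h1 : (lagCell X y z i).indicator (1 : Euc d → ℝ) x = 0 := by simp [hxi]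
      obtain ⟨k, hk⟩ : ∃ k, score y z i x < score y z k x := by
        by_contra! h
        exact hxi ⟨hx, h⟩
      have hki : k ≠ i := by rintro rfl; exact lt_irrefl _ hk
      rw [h1, sub_zero, abs_of_nonneg (gibbs_nonneg i x)]
      refine le_trans ?_ (Finset.single_le_sum (f := fun k => E k x) (fun k _ => hE0 k x)
        (Finset.mem_erase.2 ⟨hki, Finset.mem_univ k⟩))
      refine (gibbs_le_exp k i x).trans_eq ?_
      rw [hE]
      simp only
      rw [abs_of_neg (by linarith), neg_neg]
  calc ∫ x in X, |gibbs y z ε i x - (lagCell X y z i).indicator 1 x|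
      ≤ ∫ x in X, ∑ k ∈ Finset.univ.erase i, E k x := by
        refine setIntegral_mono_on ?_ (integrable_finsetSum _ fun k _ => hEint k) hXm hpt
        refine integrableOn_of_abs_le hX subset_rfl hXm ?_
          (B := ∑ k ∈ Finset.univ.erase i, 1) fun x hx => ?_
        · exact ((measurable_gibbs y z ε i).sub
            (measurable_one.indicator (measurableSet_lagCell hXm y z i))).abs
        · rw [abs_abs]
          refine (hpt x hx).trans (Finset.sum_le_sum fun k _ => ?_)
          exact Real.exp_le_one_iff.2 (div_nonpos_of_nonpos_of_nonneg (by simp) hε.le)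
    _ = ∑ k ∈ Finset.univ.erase i, ∫ x in X, E k x := integral_finsetSum _ fun k _ => hEint k
    _ ≤ ∑ k ∈ Finset.univ.erase i, C * ε := by
        refine Finset.sum_le_sum fun k hk => H z i k (Finset.mem_erase.1 hk).1.symm ε hε
    _ ≤ Fintype.card ι * (C * ε) := by
        rw [Finset.sum_const, nsmul_eq_mul]
        gcongr
        exact Finset.card_le_univ _
    _ ≤ _ := by nlinarith

/-- The cells depend on the weights in a Lipschitz way. -/
lemma exists_volume_lagCell_diff_le (hX : Bornology.IsBounded X) (hy : Function.Injective y) :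
    ∃ C : ℝ, 0 < C ∧ ∀ (z z' : ι → ℝ) (η : ℝ), 0 ≤ η →
      (∀ i j, |(z' i - z i) - (z' j - z j)| ≤ η) → ∀ i,
      volume.real (lagCell X y z i \ lagCell X y z' i) ≤ C * η := by
  classical
  obtain ⟨C, hC, H⟩ := exists_volume_score_le hX hy
  refine ⟨Fintype.card ι * C + 1, by positivity, fun z z' η hη hz i => ?_⟩
  have hsub : lagCell X y z i \ lagCell X y z' i ⊆ ⋃ k ∈ Finset.univ.erase i,
      {x ∈ X | |score y z i x - score y z k x| ≤ η} := by
    rintro x ⟨hx, hx'⟩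
    obtain ⟨k, hk⟩ : ∃ k, score y z' i x < score y z' k x := by
      by_contra! h
      exact hx' ⟨hx.1, h⟩
    have hki : k ≠ i := by rintro rfl; exact lt_irrefl _ hk
    refine mem_biUnion (Finset.mem_erase.2 ⟨hki, Finset.mem_univ k⟩) ⟨hx.1, ?_⟩
    rw [abs_of_nonneg (sub_nonneg.2 (hx.2 k))]
    have h1 := le_abs_self ((z' i - z i) - (z' k - z k))
    have h2 := hz i k
    simp only [score] at hk ⊢
    linarith
  calc volume.real (lagCell X y z i \ lagCell X y z' i)
      ≤ volume.real (⋃ k ∈ Finset.univ.erase i,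
          {x ∈ X | |score y z i x - score y z k x| ≤ η}) :=
        measureReal_mono hsub (ne_top_of_le_ne_top hX.measure_lt_top.ne
          (measure_mono (iUnion₂_subset fun k _ x hx => hx.1)))
    _ ≤ ∑ k ∈ Finset.univ.erase i, volume.real {x ∈ X | |score y z i x - score y z k x| ≤ η} :=
        measureReal_biUnion_finset_le _ _
    _ ≤ ∑ k ∈ Finset.univ.erase i, C * η :=
        Finset.sum_le_sum fun k hk => H z i k (Finset.mem_erase.1 hk).1.symm η hη
    _ ≤ Fintype.card ι * (C * η) := by
        rw [Finset.sum_const, nsmul_eq_mul]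
        gcongr
        exact Finset.card_le_univ _
    _ ≤ _ := by nlinarith

end CellEstimate

/-! ### Stability of the weights -/

section Stability

variable {d : ℕ} {ι : Type*} [Fintype ι] {X : Set (Euc d)} {y : ι → Euc d}

/-- A finite family of reals has a gap of at least the average size between any two members. -/
lemma exists_gap {δ : ι → ℝ} {i j : ι} (h : δ j < δ i) :
    ∃ t, δ j ≤ t ∧ t + (δ i - δ j) / Fintype.card ι ≤ δ i ∧
      ∀ k, δ k ≤ t ∨ t + (δ i - δ j) / Fintype.card ι ≤ δ k := by
  have hN : (0 : ℝ) < Fintype.card ι := by exact_mod_cast Fintype.card_pos_iff.2 ⟨i⟩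
  set D := (δ i - δ j) / Fintype.card ι with hD
  have hD0 : 0 < D := div_pos (by linarith) hN
  have hND : Fintype.card ι * D = δ i - δ j := by rw [hD]; field_simp
  by_contra! hcon
  have h1 : ∀ m : Fin (Fintype.card ι), ∃ k, δ j + m * D < δ k ∧ δ k < δ j + m * D + D := by
    intro m
    refine hcon (δ j + m * D) (by have : 0 ≤ m * D := by positivity
                                  linarith) ?_
    have h2 : ((m : ℕ) : ℝ) + 1 ≤ Fintype.card ι := by exact_mod_cast m.2
    nlinarith
  choose k hk using h1
  have hlt : ∀ m m' : Fin (Fintype.card ι), k m = k m' → (m : ℕ) ≤ m' := by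
    intro m m' hmm
    by_contra! hc
    have h3 : ((m' : ℕ) : ℝ) + 1 ≤ (m : ℕ) := by exact_mod_cast hc
    have h4 := (hk m).1
    have h5 := (hk m').2
    rw [hmm] at h4
    nlinarith
  have hinj : Function.Injective k := fun m m' hmm =>
    Fin.ext (le_antisymm (hlt m m' hmm) (hlt m' m hmm.symm))
  -- As many disjoint intervals as indices, and `j` lies in none of them.
  have hbij := (Fintype.bijective_iff_injective_and_card k).2 ⟨hinj, by simp⟩
  obtain ⟨m, hm⟩ := hbij.2 j
  have h6 := (hk m).1
  rw [hm] at h6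
  have : 0 ≤ m * D := by positivity
  linarith

lemma lipschitzWith_score (y : ι → Euc d) (z : ι → ℝ) (i : ι) :
    LipschitzWith (∑ k, ‖y k‖₊) (score y z i) := by
  refine LipschitzWith.of_le_add_mul _ fun x w => ?_
  have h1 : score y z i x = score y z i w + inner ℝ (x - w) (y i) := by
    simp only [score, inner_sub_left]; ring
  rw [h1, dist_eq_norm, mul_comm, NNReal.coe_sum]
  have h2 := real_inner_le_norm (x - w) (y i)
  have h3 := Finset.single_le_sum (fun k _ => norm_nonneg (y k)) (Finset.mem_univ i)
  have h4 := mul_le_mul_of_nonneg_left h3 (norm_nonneg (x - w))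
  simp only [coe_nnnorm]
  linarith

lemma lipschitzWith_sup'_score (y : ι → Euc d) (z : ι → ℝ) {A : Finset ι} (hA : A.Nonempty) :
    LipschitzWith (∑ k, ‖y k‖₊) fun x => A.sup' hA fun k => score y z k x := by
  refine LipschitzWith.of_le_add_mul _ fun x w => Finset.sup'_le _ _ fun k hk => ?_
  have h1 := (lipschitzWith_score y z k).le_add_mul x w
  have h2 := Finset.le_sup' (fun k => score y z k w) hk
  linarith

/-- The masses of the cells determine the weights up to a common constant, in a Lipschitz way. If
`z' - z` has a gap of size `g` then the two groups of indices which it separates exchange the mass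
of a strip of width `g`, which the isoperimetric inequality bounds below. -/
lemma exists_abs_sub_le_sum_measureReal_lagCell (hXc : Convex ℝ X) (hX : Bornology.IsBounded X)
    (hXm : MeasurableSet X) (hy : Function.Injective y) {μ : Measure (Euc d)} [IsFiniteMeasure μ]
    {m M : ℝ} (hm : 0 < m) (hM : 0 < M)
    (hμm : ∀ S ⊆ X, MeasurableSet S → m * volume.real S ≤ μ.real S)
    (hμM : ∀ S ⊆ X, MeasurableSet S → μ.real S ≤ M * volume.real S) {a : ℝ} (ha : 0 < a) :
    ∃ C : ℝ, 0 < C ∧ ∀ z z' : ι → ℝ, (∀ i, a ≤ μ.real (lagCell X y z i)) →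
      (∀ i, a ≤ μ.real (lagCell X y z' i)) → ∀ i j, |(z' i - z i) - (z' j - z j)| ≤
        C * ∑ k, |μ.real (lagCell X y z k) - μ.real (lagCell X y z' k)| := by
  classical
  obtain ⟨c, hc, H⟩ := exists_volume_between_ge hXc hX hXm
    ((∑ k, ‖y k‖₊) + ∑ k, ‖y k‖₊) (div_pos ha hM)
  have hXfin : volume X ≠ ∞ := hX.measure_lt_top.ne
  refine ⟨(Fintype.card ι + 1) / (c * m), by positivity, fun z z' hz hz' => ?_⟩
  set S : ℝ := ∑ k, |μ.real (lagCell X y z k) - μ.real (lagCell X y z' k)|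
  have hS : 0 ≤ S := Finset.sum_nonneg fun k _ => abs_nonneg _
  suffices key : ∀ i j, (z' i - z i) - (z' j - z j) ≤ (Fintype.card ι + 1) / (c * m) * S by
    intro i j
    rw [abs_le]
    exact ⟨by linarith [key j i], key i j⟩
  intro i j
  rcases le_or_gt (z' i - z i) (z' j - z j) with hle | hlt
  · exact (sub_nonpos.2 hle).trans (by positivity)
  obtain ⟨t, ht1, ht2, ht3⟩ := exists_gap (δ := fun k => z' k - z k) hlt
  have hN : (0 : ℝ) < Fintype.card ι := by exact_mod_cast Fintype.card_pos_iff.2 ⟨i⟩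
  set g : ℝ := (z' i - z i - (z' j - z j)) / Fintype.card ι with hg
  have hg0 : 0 < g := div_pos (by linarith) hN
  set A : Finset ι := Finset.univ.filter fun k => t + g ≤ z' k - z k with hA
  set B : Finset ι := Finset.univ.filter fun k => z' k - z k ≤ t with hB
  have hiA : i ∈ A := by simp only [hA, Finset.mem_filter, Finset.mem_univ, true_and]; exact ht2
  have hjB : j ∈ B := by simp only [hB, Finset.mem_filter, Finset.mem_univ, true_and]; exact ht1
  have hAB : ∀ k, k ∈ B ∨ k ∈ A := fun k => by
    simp only [hA, hB, Finset.mem_filter, Finset.mem_univ, true_and]; exact ht3 k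
  set fA : Euc d → ℝ := fun x => A.sup' ⟨i, hiA⟩ fun k => score y z k x with hfA
  set fB : Euc d → ℝ := fun x => B.sup' ⟨j, hjB⟩ fun k => score y z k x with hfB
  set h : Euc d → ℝ := fun x => fA x - fB x with hh
  have hLip : LipschitzWith ((∑ k, ‖y k‖₊) + ∑ k, ‖y k‖₊) h :=
    (lipschitzWith_sup'_score y z ⟨i, hiA⟩).sub (lipschitzWith_sup'_score y z ⟨j, hjB⟩)
  have hhm : Measurable h := hLip.continuous.measurable
  have hle_fA : ∀ k ∈ A, ∀ x, score y z k x ≤ fA x := fun k hk x =>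
    Finset.le_sup' (fun k => score y z k x) hk
  have hle_fB : ∀ k ∈ B, ∀ x, score y z k x ≤ fB x := fun k hk x =>
    Finset.le_sup' (fun k => score y z k x) hk
  -- The cell of `j` for `z` and the cells of `A` for `z'` lie on opposite sides of the strip.
  have hcellB : lagCell X y z j ⊆ {x ∈ X | h x ≤ 0} := by
    intro x hx
    refine ⟨hx.1, ?_⟩
    have h1 : fA x ≤ score y z j x := Finset.sup'_le _ _ fun k _ => hx.2 k
    linarith [hle_fB j hjB x]
  have hcellA : ∀ k ∈ A, lagCell X y z' k ⊆ {x ∈ X | g ≤ h x} := by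
    intro k hk x hx
    refine ⟨hx.1, ?_⟩
    have h1 : fB x ≤ score y z k x - g := Finset.sup'_le _ _ fun l hl => by
      have h2 := hx.2 l
      have h3 := (Finset.mem_filter.1 hk).2
      have h4 := (Finset.mem_filter.1 hl).2
      simp only [score] at h2 ⊢
      linarith
    linarith [hle_fA k hk x]
  have hposA : ∀ x ∈ X, 0 < h x → ∃ k ∈ A, x ∈ lagCell X y z k := by
    intro x hx hpos
    have : Nonempty ι := ⟨i⟩
    obtain ⟨k, hk⟩ := exists_mem_lagCell y z hx
    refine ⟨k, (hAB k).resolve_left fun hkB => ?_, hk⟩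
    have h1 : fA x ≤ score y z k x := Finset.sup'_le _ _ fun l _ => hk.2 l
    linarith [hle_fB k hkB x]
  have hcm := fun (w : ι → ℝ) k => measurableSet_lagCell hXm y w k
  have hvol : ∀ (w : ι → ℝ) k, a ≤ μ.real (lagCell X y w k) →
      a / M ≤ volume.real (lagCell X y w k) := fun w k hw => by
    rw [div_le_iff₀ hM, mul_comm]
    exact hw.trans (hμM _ (lagCell_subset X y w k) (hcm w k))
  have hfinite : ∀ s ⊆ X, volume s ≠ ∞ := fun s hs => ne_top_of_le_ne_top hXfin (measure_mono hs)
  have hstrip := H h hLip g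
    ((hvol z j (hz j)).trans (measureReal_mono hcellB (hfinite _ fun x hx => hx.1)))
    ((hvol z' i (hz' i)).trans (measureReal_mono (hcellA i hiA) (hfinite _ fun x hx => hx.1)))
  set T := {x ∈ X | 0 < h x ∧ h x < g} with hT
  have hTm : MeasurableSet T := hXm.inter
    ((measurableSet_lt measurable_const hhm).inter (measurableSet_lt hhm measurable_const))
  have hTμ := hμm T (fun x hx => hx.1) hTm
  -- For `z`, the indices of `A` own the strip in addition to what they own for `z'`.
  have hunion : (⋃ k ∈ A, lagCell X y z' k) ∪ T ⊆ ⋃ k ∈ A, lagCell X y z k := by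
    rintro x (hx | hx)
    · obtain ⟨k, hk, hxk⟩ := mem_iUnion₂.1 hx
      have h1 := hcellA k hk hxk
      obtain ⟨l, hl, hxl⟩ := hposA x h1.1 (hg0.trans_le h1.2)
      exact mem_biUnion hl hxl
    · obtain ⟨l, hl, hxl⟩ := hposA x hx.1 hx.2.1
      exact mem_biUnion hl hxl
  have hdisj : Disjoint (⋃ k ∈ A, lagCell X y z' k) T := by
    rw [Set.disjoint_left]
    intro x hx hxT
    obtain ⟨k, hk, hxk⟩ := mem_iUnion₂.1 hx
    exact absurd hxT.2.2 (not_lt.2 (hcellA k hk hxk).2)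
  have hae : (A : Set ι).Pairwise (Function.onFun (AEDisjoint μ) (lagCell X y z')) := by
    intro k _ l _ hkl
    have h1 := aedisjoint_lagCell hX hy z' hkl
    have hs : lagCell X y z' k ∩ lagCell X y z' l ⊆ X := fun x hx => hx.1.1
    have h2 := hμM _ hs ((hcm z' k).inter (hcm z' l))
    rw [Measure.real, Measure.real, h1, ENNReal.toReal_zero, mul_zero] at h2
    exact (measureReal_eq_zero_iff).1 (le_antisymm h2 ENNReal.toReal_nonneg)
  have h1 : μ.real (⋃ k ∈ A, lagCell X y z' k) = ∑ k ∈ A, μ.real (lagCell X y z' k) := by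
    rw [Measure.real, measure_biUnion_finset₀ hae fun k _ => (hcm z' k).nullMeasurableSet,
      ENNReal.toReal_sum fun k _ => measure_ne_top μ _]
    rfl
  have h2 : μ.real ((⋃ k ∈ A, lagCell X y z' k) ∪ T) =
      μ.real (⋃ k ∈ A, lagCell X y z' k) + μ.real T :=
    measureReal_union hdisj hTm (measure_ne_top μ _) (measure_ne_top μ _)
  have h3 : μ.real ((⋃ k ∈ A, lagCell X y z' k) ∪ T) ≤ ∑ k ∈ A, μ.real (lagCell X y z k) :=
    (measureReal_mono hunion (measure_ne_top μ _)).trans (measureReal_biUnion_finset_le _ _)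
  have h4 : ∑ k ∈ A, μ.real (lagCell X y z k) - ∑ k ∈ A, μ.real (lagCell X y z' k) ≤ S := by
    rw [← Finset.sum_sub_distrib]
    exact (Finset.sum_le_sum fun k _ => le_abs_self _).trans
      (Finset.sum_le_sum_of_subset_of_nonneg (Finset.subset_univ A) fun k _ _ => abs_nonneg _)
  have h5 : m * (c * g) ≤ S := by
    have := mul_le_mul_of_nonneg_left hstrip hm.le
    linarith
  have h6 : z' i - z i - (z' j - z j) = Fintype.card ι * g := by rw [hg]; field_simp
  rw [h6, div_mul_eq_mul_div, le_div_iff₀ (by positivity)]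
  nlinarith

end Stability

/-! ### Existence of dual potentials -/

section Potentials

variable {d : ℕ} {ι : Type*} [Fintype ι] [Nonempty ι]

/-- A convex function with continuous subgradient `g`, invariant under the addition of constants and
coercive modulo constants, attains its minimum, and its subgradient vanishes there. Convexity enters
only through the subgradient inequality, which also implies continuity. -/
lemma exists_subgradient_eq_zero {K : (ι → ℝ) → ℝ} {g : (ι → ℝ) → ι → ℝ} (hg : Continuous g)
    (hK : ∀ z z', K z + ∑ i, g z i * (z' i - z i) ≤ K z')
    (hshift : ∀ z (c : ℝ), K (fun i => z i + c) = K z) {R c : ℝ} (hc : 0 < c)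
    (hcoer : ∀ z i j, c * (z i - z j) ≤ K z + R) : ∃ z, g z = 0 := by
  have hgi : ∀ i, Continuous fun z => g z i := fun i => (continuous_apply i).comp hg
  have hKc : Continuous K := by
    refine continuous_iff_continuousAt.2 fun z => ?_
    have h1 : Tendsto (fun z' => K z + ∑ i, g z i * (z' i - z i)) (nhds z) (nhds (K z)) := by
      have : Continuous fun z' : ι → ℝ => K z + ∑ i, g z i * (z' i - z i) := by fun_prop
      simpa using this.tendsto z
    have h2 : Tendsto (fun z' => K z + ∑ i, g z' i * (z' i - z i)) (nhds z) (nhds (K z)) := by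
      have : Continuous fun z' : ι → ℝ => K z + ∑ i, g z' i * (z' i - z i) := by fun_prop
      simpa using this.tendsto z
    refine tendsto_of_tendsto_of_tendsto_of_le_of_le h1 h2 (fun z' => hK z z') fun z' => ?_
    have h3 := hK z' z
    have h4 : ∑ i, g z' i * (z i - z' i) = -∑ i, g z' i * (z' i - z i) := by
      rw [← Finset.sum_neg_distrib]
      exact Finset.sum_congr rfl fun i _ => by ring
    simp only
    linarith
  obtain ⟨j₀⟩ := ‹Nonempty ι›
  have hM0 : 0 ≤ (K 0 + R) / c := div_nonneg (by simpa using hcoer 0 j₀ j₀) hc.le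
  obtain ⟨z, hz, hzmin⟩ := (isCompact_Icc (a := (0 : ι → ℝ))
    (b := fun _ => (K 0 + R) / c)).exists_isMinOn ⟨0, le_rfl, fun _ => hM0⟩ hKc.continuousOn
  -- A translate with least entry zero lies in the compact box if its value is at most `K 0`.
  have hmin : ∀ z', K z ≤ K z' := by
    intro z'
    rcases le_total (K 0) (K z') with h | h
    · exact (isMinOn_iff.1 hzmin 0 ⟨le_rfl, fun _ => hM0⟩).trans h
    · have : Nonempty ι := ⟨j₀⟩
      obtain ⟨j, hj⟩ := Finite.exists_min z'
      rw [← hshift z' (-z' j)]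
      refine isMinOn_iff.1 hzmin _ ⟨fun i => ?_, fun i => ?_⟩
      · simpa using hj i
      · have h1 := hcoer z' i j
        simp only
        rw [le_div_iff₀ hc]
        linarith
  refine ⟨z, ?_⟩
  -- The subgradient at `z + t • v` has nonnegative pairing with `v`, by minimality of `z`.
  have hdir : ∀ v : ι → ℝ, 0 ≤ ∑ i, g z i * v i := by
    intro v
    have hcont : Continuous fun t : ℝ => ∑ i, g (z + t • v) i * v i := by
      refine continuous_finsetSum _ fun i _ => Continuous.mul ?_ continuous_const
      exact (hgi i).comp (by fun_prop)
    have htend : Tendsto (fun t : ℝ => ∑ i, g (z + t • v) i * v i) (nhdsWithin 0 (Ioi 0))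
        (nhds (∑ i, g z i * v i)) := by
      have := hcont.tendsto 0
      simp only [zero_smul, add_zero] at this
      exact this.mono_left nhdsWithin_le_nhds
    refine ge_of_tendsto htend ?_
    filter_upwards [self_mem_nhdsWithin] with t ht
    have h1 := hK (z + t • v) z
    have h2 := hmin (z + t • v)
    have h3 : ∑ i, g (z + t • v) i * (z i - (z + t • v) i) =
        -(t * ∑ i, g (z + t • v) i * v i) := by
      rw [Finset.mul_sum, ← Finset.sum_neg_distrib]
      refine Finset.sum_congr rfl fun i _ => ?_
      simp only [Pi.add_apply, Pi.smul_apply, smul_eq_mul]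
      ring
    rw [h3] at h1
    exact nonneg_of_mul_nonneg_right (by linarith) (mem_Ioi.1 ht)
  have h1 := hdir fun i => -g z i
  have h2 : ∑ i, g z i * g z i ≤ 0 := by
    simp only [mul_neg, Finset.sum_neg_distrib] at h1
    linarith
  have h3 := (Finset.sum_eq_zero_iff_of_nonneg fun i _ => mul_self_nonneg (g z i)).1
    (le_antisymm h2 (Finset.sum_nonneg fun i _ => mul_self_nonneg _))
  funext i
  exact mul_self_eq_zero.1 (h3 i (Finset.mem_univ i))

variable {X : Set (Euc d)} {y : ι → Euc d}

/-- The common part of the existence proofs for the potentials of the unregularized and of the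
regularized problem: `Φ z` is the potential with weights `z`, and `w z` its subgradient. -/
lemma exists_integral_eq_of_potential (hX : IsCompact X) {μ : Measure (Euc d)}
    [IsProbabilityMeasure μ] (hμX : μ Xᶜ = 0) {q : ι → ℝ} {c : ℝ} (hc : 0 < c)
    (hq : ∀ i, c ≤ q i) (hq1 : ∑ i, q i = 1) {Φ : (ι → ℝ) → Euc d → ℝ}
    {w : (ι → ℝ) → ι → Euc d → ℝ} (hΦ : ∀ z, Continuous (Φ z))
    (hle : ∀ z i x, score y z i x ≤ Φ z x) (hshift : ∀ z c x, Φ (fun i => z i + c) x = Φ z x - c)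
    (hw : ∀ z i, Integrable (w z i) μ)
    (hsub : ∀ z z', ∀ᵐ x ∂μ, Φ z x - ∑ i, w z i x * (z' i - z i) ≤ Φ z' x)
    (hcont : ∀ i, Continuous fun z => ∫ x, w z i x ∂μ) :
    ∃ z, ∀ i, ∫ x, w z i x ∂μ = q i := by
  have hμr : μ.restrict X = μ := Measure.restrict_eq_self_of_ae_mem (by
    rw [ae_iff]; exact hμX)
  have hΦint : ∀ z, Integrable (Φ z) μ := fun z => by
    have := (hΦ z).continuousOn.integrableOn_compact (μ := μ) hX
    rwa [IntegrableOn, hμr] at this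
  obtain ⟨R, hR0, hR⟩ := hX.isBounded.subset_ball_lt 0 (0 : Euc d)
  set L := ∑ k, ‖y k‖
  obtain ⟨z, hz⟩ := exists_subgradient_eq_zero (K := fun z => (∫ x, Φ z x ∂μ) + ∑ i, q i * z i)
    (g := fun z i => q i - ∫ x, w z i x ∂μ) (R := R * L) hc
    (hg := continuous_pi fun i => continuous_const.sub (hcont i))
    (hK := fun z z' => by
      have h1 : ∫ x, (Φ z x - ∑ i, w z i x * (z' i - z i)) ∂μ ≤ ∫ x, Φ z' x ∂μ :=
        integral_mono_ae ((hΦint z).sub (integrable_finsetSum _ fun i _ =>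
          (hw z i).mul_const _)) (hΦint z') (hsub z z')
      rw [integral_sub (hΦint z) (integrable_finsetSum _ fun i _ => (hw z i).mul_const _),
        integral_finsetSum _ fun i _ => (hw z i).mul_const _] at h1
      simp_rw [integral_mul_const] at h1
      simp only [sub_mul, mul_sub, Finset.sum_sub_distrib] at h1 ⊢
      linarith)
    (hshift := fun z c => by
      simp_rw [hshift, mul_add, Finset.sum_add_distrib, ← Finset.sum_mul, hq1]
      rw [integral_sub (hΦint z) (integrable_const c)]
      simp)
    (hcoer := fun z i j => by
      obtain ⟨l, hl⟩ := Finite.exists_min z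
      have h1 : -(R * L) - z l ≤ ∫ x, Φ z x ∂μ := by
        have h2 : ∫ _x, (-(R * L) - z l) ∂μ ≤ ∫ x, Φ z x ∂μ := by
          refine integral_mono_ae (integrable_const _) (hΦint z) ?_
          have h3 : ∀ᵐ x ∂μ, x ∈ X := by rw [ae_iff]; exact hμX
          filter_upwards [h3] with x hx
          refine le_trans ?_ (hle z l x)
          have h4 := neg_le_of_abs_le (abs_real_inner_le_norm x (y l))
          have h5 : ‖x‖ * ‖y l‖ ≤ R * L := mul_le_mul (mem_ball_zero_iff.1 (hR hx)).le
            (Finset.single_le_sum (fun k _ => norm_nonneg (y k)) (Finset.mem_univ l))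
            (norm_nonneg _) hR0.le
          simp only [score]
          linarith
        simpa using h2
      have h6 : c * (z i - z l) ≤ ∑ k, q k * (z k - z l) :=
        (mul_le_mul_of_nonneg_right (hq i) (sub_nonneg.2 (hl i))).trans
          (Finset.single_le_sum (f := fun k => q k * (z k - z l))
            (fun k _ => mul_nonneg (hc.le.trans (hq k)) (sub_nonneg.2 (hl k))) (Finset.mem_univ i))
      have h7 : ∑ k, q k * (z k - z l) = ∑ k, q k * z k - z l := by
        simp_rw [mul_sub, Finset.sum_sub_distrib, ← Finset.sum_mul, hq1, one_mul]
      have h8 : c * (z i - z j) ≤ c * (z i - z l) := by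
        have := hl j
        gcongr
      linarith)
  refine ⟨z, fun i => ?_⟩
  have := congrFun hz i
  simp only [Pi.zero_apply] at this
  linarith

/-- The unregularized problem: there are weights whose Laguerre cells have prescribed masses. -/
lemma exists_measureReal_lagCell_eq (hX : IsCompact X) (hy : Function.Injective y)
    {μ : Measure (Euc d)} [IsProbabilityMeasure μ] (hμX : μ Xᶜ = 0) {M : ℝ} (hM : 0 < M)
    (hμM : ∀ S ⊆ X, MeasurableSet S → μ.real S ≤ M * volume.real S)
    (hac : μ ≪ volume.restrict X) {q : ι → ℝ} {c : ℝ} (hc : 0 < c)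
    (hq : ∀ i, c ≤ q i) (hq1 : ∑ i, q i = 1) :
    ∃ z, ∀ i, μ.real (lagCell X y z i) = q i := by
  classical
  have hXm := hX.measurableSet
  have hcm := measurableSet_lagCell hXm y
  obtain ⟨C, hC, HC⟩ := exists_volume_lagCell_diff_le hX.isBounded hy
  obtain ⟨z, hz⟩ := exists_integral_eq_of_potential (y := y) hX hμX hc hq hq1
    (Φ := fun z x => Finset.univ.sup' Finset.univ_nonempty fun k => score y z k x)
    (w := fun z i => (lagCell X y z i).indicator 1)
    (hΦ := fun z => (lipschitzWith_sup'_score y z Finset.univ_nonempty).continuous)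
    (hle := fun z i x => Finset.le_sup' (fun k => score y z k x) (Finset.mem_univ i))
    (hshift := fun z c x => by
      refine le_antisymm (Finset.sup'_le _ _ fun k _ => ?_) ?_
      · have := Finset.le_sup' (fun k => score y z k x) (Finset.mem_univ k)
        simp only [score] at this ⊢
        linarith
      · rw [sub_le_iff_le_add]
        refine Finset.sup'_le _ _ fun k _ => ?_
        have := Finset.le_sup' (fun k => score y (fun i => z i + c) k x) (Finset.mem_univ k)
        simp only [score] at this ⊢
        linarith)
    (hw := fun z i => (integrable_indicator_iff (hcm z i)).2
      (integrableOn_const (measure_ne_top μ _)))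
    (hsub := fun z z' => by
      have h3 : ∀ᵐ x ∂μ, x ∈ X := by rw [ae_iff]; exact hμX
      filter_upwards [hac.ae_le (ae_mem_lagCell_unique hX.isBounded hXm hy z), h3] with x hx hxX
      obtain ⟨i, hi⟩ := exists_mem_lagCell y z hxX
      have h1 : ∀ k, (lagCell X y z k).indicator (1 : Euc d → ℝ) x = if k = i then 1 else 0 := by
        intro k
        by_cases hk : k = i
        · rw [hk]; simp [hi]
        · have : x ∉ lagCell X y z k := fun h => hk (hx k i h hi)
          simp [hk, this]
      have h2 : (Finset.univ.sup' Finset.univ_nonempty fun k => score y z k x) = score y z i x :=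
        le_antisymm (Finset.sup'_le _ _ fun k _ => hi.2 k)
          (Finset.le_sup' (fun k => score y z k x) (Finset.mem_univ i))
      simp only [h1, h2, ite_mul, one_mul, zero_mul, Finset.sum_ite_eq', Finset.mem_univ, if_true]
      have h4 := Finset.le_sup' (fun k => score y z' k x) (Finset.mem_univ i)
      refine le_trans (le_of_eq ?_) h4
      simp only [score]
      ring)
    (hcont := fun i => by
      simp_rw [fun z => integral_indicator_one (μ := μ) (hcm z i)]
      have hLip : LipschitzWith (M * C * 2).toNNReal fun z => μ.real (lagCell X y z i) := by
        refine LipschitzWith.of_le_add_mul _ fun z z' => ?_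
        rw [Real.coe_toNNReal _ (by positivity)]
        have h1 := HC z z' (2 * dist z z') (by positivity) (fun k l => by
          have e1 := dist_le_pi_dist z z' k
          have e2 := dist_le_pi_dist z z' l
          rw [dist_comm, Real.dist_eq] at e1 e2
          linarith [abs_sub (z' k - z k) (z' l - z l)]) i
        have h2 := hμM _ (sdiff_subset.trans (lagCell_subset X y z i))
          ((hcm z i).diff (hcm z' i))
        have h3 : μ.real (lagCell X y z i) ≤
            μ.real (lagCell X y z' i) + μ.real (lagCell X y z i \ lagCell X y z' i) := by
          refine le_trans (measureReal_mono ?_ (measure_ne_top _ _)) (measureReal_union_le _ _)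
          intro x hx
          by_cases h : x ∈ lagCell X y z' i
          · exact Or.inl h
          · exact Or.inr ⟨hx, h⟩
        have h4 := mul_le_mul_of_nonneg_left h1 hM.le
        linarith
      exact hLip.continuous)
  refine ⟨z, fun i => ?_⟩
  rw [← hz i, integral_indicator_one (hcm z i)]

/-- The entropic potential: the soft maximum of the scores. -/
noncomputable def softMax (y : ι → Euc d) (z : ι → ℝ) (ε : ℝ) (x : Euc d) : ℝ :=
  ε * Real.log (∑ k, Real.exp (score y z k x / ε))

lemma sum_exp_score_pos (y : ι → Euc d) (z : ι → ℝ) (ε : ℝ) (x : Euc d) :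
    0 < ∑ k, Real.exp (score y z k x / ε) :=
  Finset.sum_pos (fun _ _ => Real.exp_pos _) Finset.univ_nonempty

lemma continuous_softMax (y : ι → Euc d) (z : ι → ℝ) (ε : ℝ) : Continuous (softMax y z ε) := by
  unfold softMax
  refine continuous_const.mul (Continuous.log ?_ fun x => (sum_exp_score_pos y z ε x).ne')
  exact continuous_finsetSum _ fun k _ => Real.continuous_exp.comp
    ((continuous_score y z k).div_const ε)

/-- Jensen's inequality for the exponential function. -/
lemma softMax_sub_le {ε : ℝ} (hε : 0 < ε) (y : ι → Euc d) (z z' : ι → ℝ) (x : Euc d) :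
    softMax y z ε x - ∑ i, gibbs y z ε i x * (z' i - z i) ≤ softMax y z' ε x := by
  have hS := sum_exp_score_pos y z ε x
  set S := ∑ k, Real.exp (score y z k x / ε) with hSdef
  have h1 := convexOn_exp.map_sum_le (t := Finset.univ) (w := fun i => gibbs y z ε i x)
    (p := fun i => -(z' i - z i) / ε) (fun i _ => gibbs_nonneg i x) (sum_gibbs x)
    (fun i _ => mem_univ _)
  have h2 : S * ∑ i, gibbs y z ε i x • Real.exp (-(z' i - z i) / ε) =
      ∑ k, Real.exp (score y z' k x / ε) := by
    rw [Finset.mul_sum]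
    refine Finset.sum_congr rfl fun i _ => ?_
    have h3 : score y z' i x / ε = score y z i x / ε + -(z' i - z i) / ε := by
      simp only [score]; ring
    rw [h3, Real.exp_add, gibbs, ← hSdef, smul_eq_mul]
    field_simp
  have h4 : ∑ i, gibbs y z ε i x • (-(z' i - z i) / ε) =
      -(∑ i, gibbs y z ε i x * (z' i - z i)) / ε := by
    rw [neg_div, Finset.sum_div, ← Finset.sum_neg_distrib]
    refine Finset.sum_congr rfl fun i _ => ?_
    rw [smul_eq_mul]; ring
  rw [h4] at h1
  have h5 := mul_le_mul_of_nonneg_left h1 hS.le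
  rw [h2] at h5
  have h6 := Real.log_le_log (by positivity) h5
  rw [Real.log_mul hS.ne' (Real.exp_pos _).ne', Real.log_exp] at h6
  have h7 := mul_le_mul_of_nonneg_left h6 hε.le
  rw [mul_add, mul_div_cancel₀ _ hε.ne'] at h7
  simp only [softMax, ← hSdef]
  linarith

/-- The regularized problem: there are weights whose soft assignments have prescribed masses. -/
lemma exists_integral_gibbs_eq (hX : IsCompact X) {μ : Measure (Euc d)}
    [IsProbabilityMeasure μ] (hμX : μ Xᶜ = 0) {ε : ℝ} (hε : 0 < ε) {q : ι → ℝ} {c : ℝ}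
    (hc : 0 < c) (hq : ∀ i, c ≤ q i) (hq1 : ∑ i, q i = 1) (y : ι → Euc d) :
    ∃ z, ∀ i, ∫ x, gibbs y z ε i x ∂μ = q i := by
  refine exists_integral_eq_of_potential (y := y) hX hμX hc hq hq1
    (Φ := fun z => softMax y z ε) (w := fun z => gibbs y z ε)
    (hΦ := fun z => continuous_softMax y z ε)
    (hle := fun z i x => ?_) (hshift := fun z c x => ?_) (hw := fun z i => ?_)
    (hsub := fun z z' => ae_of_all _ fun x => softMax_sub_le hε y z z' x) (hcont := fun i => ?_)
  · have h1 := Real.log_le_log (Real.exp_pos _) (Finset.single_le_sum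
      (f := fun k => Real.exp (score y z k x / ε)) (fun k _ => (Real.exp_pos _).le)
      (Finset.mem_univ i))
    rw [Real.log_exp, div_le_iff₀ hε] at h1
    rw [softMax, mul_comm]
    exact h1
  · have h1 : ∀ k, Real.exp (score y (fun i => z i + c) k x / ε) =
        Real.exp (score y z k x / ε) * Real.exp (-c / ε) := by
      intro k
      rw [← Real.exp_add]
      congr 1
      simp only [score]
      ring
    simp only [softMax, h1]
    rw [← Finset.sum_mul, Real.log_mul (sum_exp_score_pos y z ε x).ne' (Real.exp_pos _).ne',
      Real.log_exp]
    field_simp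
    ring
  · refine Integrable.of_bound (measurable_gibbs y z ε i).aestronglyMeasurable 1
      (ae_of_all _ fun x => ?_)
    rw [Real.norm_of_nonneg (gibbs_nonneg i x)]
    exact gibbs_le_one i x
  · refine continuous_of_dominated (bound := fun _ => 1)
      (fun z => (measurable_gibbs y z ε i).aestronglyMeasurable)
      (fun z => ae_of_all _ fun x => ?_) (integrable_const _) (ae_of_all _ fun x => ?_)
    · rw [Real.norm_of_nonneg (gibbs_nonneg i x)]
      exact gibbs_le_one i x
    · unfold gibbs
      refine Continuous.div ?_ ?_ fun z => (sum_exp_score_pos y z ε x).ne'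
      all_goals unfold score; fun_prop

end Potentials

/-! ### Finitely supported measures and couplings -/

section FiniteSupport

variable {d : ℕ} {ι : Type*} [Fintype ι] {y : ι → Euc d}

lemma measure_eq_sum_smul_dirac (hy : Function.Injective y) {μ : Measure (Euc d)}
    (hμ : ∀ᵐ p ∂μ, p ∈ range y) : μ = ∑ i, μ {y i} • Measure.dirac (y i) := by
  ext s hs
  have h1 : μ s = μ (⋃ i, s ∩ {y i}) := by
    refine measure_congr ?_
    filter_upwards [hμ] with p hp
    obtain ⟨i, rfl⟩ := hp
    refine propext ⟨fun h => mem_iUnion.2 ⟨i, h, rfl⟩, fun h => ?_⟩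
    obtain ⟨j, hj⟩ := mem_iUnion.1 h
    exact hj.1
  rw [h1, measure_iUnion (fun i j hij => Set.disjoint_left.2 fun p hp hp' =>
    hij (hy (hp.2.symm.trans hp'.2))) fun i => hs.inter (measurableSet_singleton _), tsum_fintype,
    Measure.finsetSum_apply]
  refine Finset.sum_congr rfl fun i _ => ?_
  rw [Measure.smul_apply, Measure.dirac_apply' _ hs, smul_eq_mul]
  by_cases hi : y i ∈ s
  · rw [indicator_of_mem hi, Pi.one_apply, mul_one,
      inter_eq_self_of_subset_right (singleton_subset_iff.2 hi)]
  · rw [indicator_of_notMem hi, mul_zero, inter_singleton_eq_empty.2 hi, measure_empty]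

lemma measure_ext_of_mem_range (hy : Function.Injective y) {μ ν : Measure (Euc d)}
    (hμ : ∀ᵐ p ∂μ, p ∈ range y) (hν : ∀ᵐ p ∂ν, p ∈ range y) (h : ∀ i, μ {y i} = ν {y i}) :
    μ = ν := by
  rw [measure_eq_sum_smul_dirac hy hμ, measure_eq_sum_smul_dirac hy hν]
  simp_rw [h]

lemma integral_eq_sum_of_mem_range (hy : Function.Injective y) {μ : Measure (Euc d)}
    [IsFiniteMeasure μ] (hμ : ∀ᵐ p ∂μ, p ∈ range y) {E : Type*} [NormedAddCommGroup E]
    [NormedSpace ℝ E] [CompleteSpace E] (g : Euc d → E) :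
    ∫ p, g p ∂μ = ∑ i, μ.real {y i} • g (y i) := by
  conv_lhs => rw [measure_eq_sum_smul_dirac hy hμ]
  rw [integral_finsetSum_measure fun i _ =>
    (integrable_dirac enorm_lt_top).smul_measure (measure_ne_top μ _)]
  refine Finset.sum_congr rfl fun i _ => ?_
  rw [integral_smul_measure, integral_dirac]
  rfl

lemma lintegral_eq_sum_of_mem_range (hy : Function.Injective y) {μ : Measure (Euc d)}
    (hμ : ∀ᵐ p ∂μ, p ∈ range y) (g : Euc d → ℝ≥0∞) :
    ∫⁻ p, g p ∂μ = ∑ i, μ {y i} * g (y i) := by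
  conv_lhs => rw [measure_eq_sum_smul_dirac hy hμ]
  rw [lintegral_finsetSum_measure]
  refine Finset.sum_congr rfl fun i _ => ?_
  rw [lintegral_smul_measure, lintegral_dirac, smul_eq_mul]

/-- The function on `ℝᵈ` with the value `w i` at `y i`, and zero elsewhere. -/
noncomputable def extendRange (y : ι → Euc d) (w : ι → ℝ) (p : Euc d) : ℝ :=
  ∑ i, ({y i} : Set (Euc d)).indicator (fun _ => w i) p

lemma extendRange_apply (hy : Function.Injective y) (w : ι → ℝ) (i : ι) :
    extendRange y w (y i) = w i := by
  classical
  rw [extendRange, Finset.sum_eq_single i]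
  · simp
  · intro j _ hj
    exact indicator_of_notMem (fun h => hj (hy (mem_singleton_iff.1 h).symm)) _
  · simp

@[fun_prop]
lemma measurable_extendRange (y : ι → Euc d) (w : ι → ℝ) : Measurable (extendRange y w) := by
  unfold extendRange
  exact Finset.measurable_sum _ fun i _ =>
    measurable_const.indicator (measurableSet_singleton _)

lemma abs_extendRange_le (y : ι → Euc d) (w : ι → ℝ) (p : Euc d) :
    |extendRange y w p| ≤ ∑ i, |w i| := by
  refine (Finset.abs_sum_le_sum_abs _ _).trans (Finset.sum_le_sum fun i _ => ?_)
  by_cases h : p ∈ ({y i} : Set (Euc d))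
  · rw [indicator_of_mem h]
  · rw [indicator_of_notMem h, abs_zero]; exact abs_nonneg _

lemma integrable_extendRange (y : ι → Euc d) (w : ι → ℝ) (μ : Measure (Euc d))
    [IsFiniteMeasure μ] : Integrable (extendRange y w) μ :=
  Integrable.of_bound (measurable_extendRange y w).aestronglyMeasurable _
    (ae_of_all _ fun p => abs_extendRange_le y w p)

lemma ae_prod_mem_range {κ : Type*} {y : κ → Euc d} {P Q : Measure (Euc d)}
    [IsProbabilityMeasure P] [IsProbabilityMeasure Q]
    (hQ : ∀ᵐ p ∂Q, p ∈ range y) : ∀ᵐ p ∂P.prod Q, p.2 ∈ range y := by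
  have h : (P.prod Q).map Prod.snd = Q := by
    have := Measure.snd_prod (μ := P) (ν := Q)
    rwa [Measure.snd] at this
  exact ae_of_ae_map measurable_snd.aemeasurable (by rwa [h])

lemma isProbabilityMeasure_of_mem_couplings {P Q : Measure (Euc d)} [IsProbabilityMeasure P]
    {π : Measure (Euc d × Euc d)} (hπ : π ∈ couplings P Q) : IsProbabilityMeasure π := by
  have h := hπ.1
  constructor
  rw [← Measure.fst_univ, h, measure_univ]

lemma integrable_inner_of_mem_couplings {X : Set (Euc d)} (hX : IsCompact X)
    {P Q : Measure (Euc d)} (hPX : ∀ᵐ x ∂P, x ∈ X)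
    [IsProbabilityMeasure P] (hQ : ∀ᵐ p ∂Q, p ∈ range y)
    {π : Measure (Euc d × Euc d)} (hπ : π ∈ couplings P Q) :
    Integrable (fun p : Euc d × Euc d => (inner ℝ p.1 p.2 : ℝ)) π := by
  have := isProbabilityMeasure_of_mem_couplings hπ
  obtain ⟨R, hR0, hR⟩ := hX.isBounded.subset_ball_lt 0 (0 : Euc d)
  have h1 : ∀ᵐ p ∂π, p.1 ∈ X := ae_of_ae_map measurable_fst.aemeasurable (by
    have := hπ.1; rw [Measure.fst] at this; rwa [this])
  have h2 : ∀ᵐ p ∂π, p.2 ∈ range y := ae_of_ae_map measurable_snd.aemeasurable (by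
    have := hπ.2; rw [Measure.snd] at this; rwa [this])
  refine Integrable.of_bound (by fun_prop) (R * ∑ i, ‖y i‖) ?_
  filter_upwards [h1, h2] with p hp1 ⟨i, hi⟩
  rw [← hi]
  refine (norm_inner_le_norm _ _).trans ?_
  exact mul_le_mul (mem_ball_zero_iff.1 (hR hp1)).le
    (Finset.single_le_sum (fun k _ => norm_nonneg (y k)) (Finset.mem_univ i))
    (norm_nonneg _) hR0.le

end FiniteSupport

/-! ### The Brenier map -/

section Brenier

variable {d : ℕ} {ι : Type*} [Fintype ι] [Nonempty ι] {X : Set (Euc d)} {y : ι → Euc d}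

/-- By complementary slackness, a Brenier map sends almost every point of the Laguerre cell of `yᵢ`
to `yᵢ`, if the cells have the masses prescribed by the target measure. -/
lemma IsBrenierMap.ae_exists_mem_lagCell (hX : IsCompact X) (hy : Function.Injective y)
    {P Q : Measure (Euc d)} [IsProbabilityMeasure P] [IsProbabilityMeasure Q]
    (hPX : ∀ᵐ x ∂P, x ∈ X) (hac : P ≪ volume.restrict X) (hQ : ∀ᵐ p ∂Q, p ∈ range y)
    {z : ι → ℝ} (hz : ∀ i, P.real (lagCell X y z i) = Q.real {y i}) {T : Euc d → Euc d}
    (hT : IsBrenierMap P Q T) : ∀ᵐ x ∂P, ∃ i, T x = y i ∧ x ∈ lagCell X y z i := by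
  classical
  obtain ⟨hTm, ⟨-, hTsnd⟩, hTmax⟩ := hT
  have hXm := hX.measurableSet
  have hcm := measurableSet_lagCell hXm y z
  obtain ⟨R, hR0, hR⟩ := hX.isBounded.subset_ball_lt 0 (0 : Euc d)
  -- The competitor: the map which is `y i` on the cell of `i`.
  set S : Euc d → Euc d := fun x => ∑ i, (lagCell X y z i).indicator (fun _ => y i) x with hS
  have hSm : Measurable S := Finset.measurable_sum _ fun i _ => measurable_const.indicator (hcm i)
  have huniq := hac.ae_le (ae_mem_lagCell_unique hX.isBounded hXm hy z)
  have hSval : ∀ᵐ x ∂P, ∃ i, x ∈ lagCell X y z i ∧ S x = y i ∧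
      ∀ j, x ∈ lagCell X y z j → j = i := by
    filter_upwards [huniq, hPX] with x hx hxX
    obtain ⟨i, hi⟩ := exists_mem_lagCell y z hxX
    refine ⟨i, hi, ?_, fun j hj => hx j i hj hi⟩
    rw [hS]
    simp only
    rw [Finset.sum_eq_single i]
    · exact indicator_of_mem hi _
    · intro j _ hj
      exact indicator_of_notMem (fun h => hj (hx j i h hi)) _
    · simp
  have hSQ : P.map S = Q := by
    refine measure_ext_of_mem_range hy ?_ hQ fun i => ?_
    · refine (ae_map_iff (p := fun p => p ∈ range y) hSm.aemeasurable
        (finite_range y).measurableSet).2 ?_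
      filter_upwards [hSval] with x ⟨i, _, hi, _⟩
      exact ⟨i, hi.symm⟩
    · rw [Measure.map_apply hSm (measurableSet_singleton _)]
      have h1 : P (S ⁻¹' {y i}) = P (lagCell X y z i) := by
        refine measure_congr ?_
        filter_upwards [hSval] with x ⟨j, hj, hSj, hu⟩
        refine propext ⟨fun h => ?_, fun h => ?_⟩
        · have : y j = y i := hSj.symm.trans h
          rw [← hy this]; exact hj
        · change S x = y i
          rw [hSj, hu i h]
      rw [h1]
      have h2 := hz i
      rwa [Measure.real, Measure.real, ENNReal.toReal_eq_toReal_iff' (measure_ne_top _ _)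
        (measure_ne_top _ _)] at h2
  have hTQ : P.map T = Q := by
    rwa [Measure.snd_map_prodMk₀ aemeasurable_id'] at hTsnd
  have hTval : ∀ᵐ x ∂P, T x ∈ range y := by
    refine ae_of_ae_map hTm ?_
    rwa [hTQ]
  have hSval' : ∀ᵐ x ∂P, S x ∈ range y := hSval.mono fun x ⟨i, _, hi, _⟩ => ⟨i, hi.symm⟩
  have hle := hTmax (show P.map (fun x => (x, S x)) ∈ couplings P Q from
    ⟨by rw [Measure.fst_map_prodMk hSm, Measure.map_id'],
      by rw [Measure.snd_map_prodMk measurable_id', hSQ]⟩)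
  have hinner : Measurable fun p : Euc d × Euc d => (inner ℝ p.1 p.2 : ℝ) := by fun_prop
  simp only [mem_ofPred_eq] at hle
  rw [integral_map (by fun_prop) hinner.aestronglyMeasurable,
    integral_map (by fun_prop) hinner.aestronglyMeasurable] at hle
  simp only at hle
  have hint : ∀ U : Euc d → Euc d, AEMeasurable U P → (∀ᵐ x ∂P, U x ∈ range y) →
      Integrable (fun x => (inner ℝ x (U x) : ℝ)) P := by
    intro U hU hUr
    refine Integrable.of_bound (by fun_prop) (R * ∑ i, ‖y i‖) ?_
    filter_upwards [hUr, hPX] with x ⟨i, hi⟩ hxX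
    rw [← hi]
    refine (norm_inner_le_norm _ _).trans ?_
    exact mul_le_mul (mem_ball_zero_iff.1 (hR hxX)).le
      (Finset.single_le_sum (fun k _ => norm_nonneg (y k)) (Finset.mem_univ i))
      (norm_nonneg _) hR0.le
  have hzint : ∀ U : Euc d → Euc d, AEMeasurable U P →
      Integrable (fun x => extendRange y z (U x)) P := fun U hU =>
    Integrable.of_bound ((measurable_extendRange y z).comp_aemeasurable hU).aestronglyMeasurable _
      (ae_of_all _ fun x => abs_extendRange_le y z (U x))
  have hzeq : ∫ x, extendRange y z (S x) ∂P = ∫ x, extendRange y z (T x) ∂P := by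
    rw [← integral_map hSm.aemeasurable (measurable_extendRange y z).aestronglyMeasurable,
      ← integral_map hTm (measurable_extendRange y z).aestronglyMeasurable, hSQ, hTQ]
  have hiS := (hint S hSm.aemeasurable hSval').sub (hzint S hSm.aemeasurable)
  have hiT := (hint T hTm hTval).sub (hzint T hTm)
  -- The slack of `T` in the dual constraint is nonnegative, with nonpositive integral.
  set D : Euc d → ℝ := fun x => (inner ℝ x (S x) - extendRange y z (S x)) -
    (inner ℝ x (T x) - extendRange y z (T x)) with hD
  have hDint : Integrable D P := hiS.sub hiT
  have hDval : ∀ᵐ x ∂P, ∃ i j, x ∈ lagCell X y z i ∧ T x = y j ∧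
      D x = score y z i x - score y z j x := by
    filter_upwards [hSval, hTval] with x ⟨i, hi, hSi, _⟩ ⟨j, hj⟩
    refine ⟨i, j, hi, hj.symm, ?_⟩
    rw [hD]
    simp only
    rw [hSi, ← hj, extendRange_apply hy, extendRange_apply hy]
    rfl
  have hD0 : 0 ≤ᵐ[P] D := hDval.mono fun x ⟨i, j, hi, _, h⟩ => by
    rw [Pi.zero_apply, h]; exact sub_nonneg.2 (hi.2 j)
  have hDle : ∫ x, D x ∂P ≤ 0 := by
    have : ∫ x, D x ∂P = ((∫ x, inner ℝ x (S x) ∂P) - ∫ x, extendRange y z (S x) ∂P) -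
        ((∫ x, inner ℝ x (T x) ∂P) - ∫ x, extendRange y z (T x) ∂P) := by
      rw [← integral_sub (hint S hSm.aemeasurable hSval') (hzint S hSm.aemeasurable),
        ← integral_sub (hint T hTm hTval) (hzint T hTm)]
      exact integral_sub hiS hiT
    rw [this]
    linarith
  have hDzero := (integral_eq_zero_iff_of_nonneg_ae hD0 hDint).1
    (le_antisymm hDle (integral_nonneg_of_ae hD0))
  filter_upwards [hDval, hDzero] with x ⟨i, j, hi, hj, hDx⟩ hx
  rw [hx, Pi.zero_apply] at hDx
  exact ⟨j, hj, hi.1, fun k => (hi.2 k).trans (by linarith)⟩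

end Brenier

/-! ### The entropic map -/

section Entropic

variable {d : ℕ} {ι : Type*} [Fintype ι] [Nonempty ι] {X : Set (Euc d)} {y : ι → Euc d}
  {P Q : Measure (Euc d)} {z : ι → ℝ} {ε : ℝ}

/-- The logarithm of the density, with respect to `P ⊗ Q`, of the coupling under which `Y` is `yᵢ`
with the conditional probability `gibbs y z ε i X`. -/
noncomputable def logDensity (Q : Measure (Euc d)) (y : ι → Euc d) (z : ι → ℝ) (ε : ℝ)
    (p : Euc d × Euc d) : ℝ :=
  (inner ℝ p.1 p.2 - extendRange y (fun i => z i + ε * Real.log (Q.real {y i})) p.2 -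
    softMax y z ε p.1) / ε

@[fun_prop]
lemma measurable_logDensity : Measurable (logDensity Q y z ε) := by
  have := (continuous_softMax y z ε).measurable
  unfold logDensity
  fun_prop

lemma exp_logDensity (hε : 0 < ε) (hy : Function.Injective y) {i : ι} (hQi : 0 < Q.real {y i})
    (x : Euc d) : Real.exp (logDensity Q y z ε (x, y i)) = gibbs y z ε i x / Q.real {y i} := by
  have h1 : logDensity Q y z ε (x, y i) = score y z i x / ε - Real.log (Q.real {y i}) -
      Real.log (∑ k, Real.exp (score y z k x / ε)) := by
    simp only [logDensity, extendRange_apply hy, softMax, score]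
    field_simp
    ring
  rw [h1, Real.exp_sub, Real.exp_sub, Real.exp_log hQi, Real.exp_log (sum_exp_score_pos y z ε x),
    gibbs, div_right_comm]

lemma integrable_exp_logDensity (hε : 0 < ε) (hy : Function.Injective y) [IsProbabilityMeasure P]
    [IsProbabilityMeasure Q] (hQ : ∀ᵐ p ∂Q, p ∈ range y) (hQi : ∀ i, 0 < Q.real {y i}) :
    Integrable (fun p => Real.exp (logDensity Q y z ε p)) (P.prod Q) := by
  refine Integrable.of_bound (by fun_prop) (∑ i, 1 / Q.real {y i}) ?_
  filter_upwards [ae_prod_mem_range hQ] with p ⟨i, hi⟩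
  obtain ⟨x, p⟩ := p
  simp only at hi
  subst hi
  rw [Real.norm_of_nonneg (Real.exp_pos _).le, exp_logDensity hε hy (hQi i)]
  refine le_trans ?_ (Finset.single_le_sum (f := fun i => 1 / Q.real {y i})
    (fun i _ => (one_div_pos.2 (hQi i)).le) (Finset.mem_univ i))
  exact div_le_div_of_nonneg_right (gibbs_le_one i x) (hQi i).le

lemma integral_exp_logDensity (hε : 0 < ε) (hy : Function.Injective y) [IsProbabilityMeasure P]
    [IsProbabilityMeasure Q] (hQ : ∀ᵐ p ∂Q, p ∈ range y) (hQi : ∀ i, 0 < Q.real {y i}) :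
    ∫ p, Real.exp (logDensity Q y z ε p) ∂P.prod Q = 1 := by
  rw [integral_prod _ (integrable_exp_logDensity hε hy hQ hQi)]
  have h : ∀ x, ∫ p, Real.exp (logDensity Q y z ε (x, p)) ∂Q = 1 := fun x => by
    rw [integral_eq_sum_of_mem_range hy hQ, ← sum_gibbs (y := y) (z := z) (ε := ε) x]
    refine Finset.sum_congr rfl fun i _ => ?_
    rw [exp_logDensity hε hy (hQi i), smul_eq_mul, mul_div_cancel₀ _ (hQi i).ne']
  simp [h]

lemma lintegral_tilted_logDensity (hε : 0 < ε) (hy : Function.Injective y)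
    [IsProbabilityMeasure P] [IsProbabilityMeasure Q] (hQ : ∀ᵐ p ∂Q, p ∈ range y)
    (hQi : ∀ i, 0 < Q.real {y i}) {G : Euc d × Euc d → ℝ≥0∞} (hG : Measurable G) :
    ∫⁻ p, G p ∂(P.prod Q).tilted (logDensity Q y z ε) =
      ∫⁻ x, ∑ i, ENNReal.ofReal (gibbs y z ε i x) * G (x, y i) ∂P := by
  rw [lintegral_tilted, integral_exp_logDensity hε hy hQ hQi,
    lintegral_prod _ (by fun_prop)]
  refine lintegral_congr fun x => ?_
  rw [lintegral_eq_sum_of_mem_range hy hQ]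
  refine Finset.sum_congr rfl fun i _ => ?_
  rw [exp_logDensity hε hy (hQi i), div_one, ← mul_assoc]
  congr 1
  rw [← ENNReal.ofReal_toReal (measure_ne_top Q {y i}), ← ENNReal.ofReal_mul ENNReal.toReal_nonneg]
  congr 1
  exact mul_div_cancel₀ _ (hQi i).ne'

lemma integral_tilted_logDensity (hε : 0 < ε) (hy : Function.Injective y)
    [IsProbabilityMeasure P] [IsProbabilityMeasure Q] (hQ : ∀ᵐ p ∂Q, p ∈ range y)
    (hQi : ∀ i, 0 < Q.real {y i}) {G : Euc d × Euc d → Euc d}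
    (hG : Integrable G ((P.prod Q).tilted (logDensity Q y z ε))) :
    ∫ p, G p ∂(P.prod Q).tilted (logDensity Q y z ε) =
      ∫ x, ∑ i, gibbs y z ε i x • G (x, y i) ∂P := by
  have h1 := (integrable_tilted_iff (integrable_exp_logDensity hε hy hQ hQi) G).1 hG
  rw [integral_tilted, integral_exp_logDensity hε hy hQ hQi]
  simp only [div_one]
  rw [integral_prod _ h1]
  refine integral_congr_ae (ae_of_all _ fun x => ?_)
  simp only
  rw [integral_eq_sum_of_mem_range hy hQ]
  refine Finset.sum_congr rfl fun i _ => ?_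
  rw [exp_logDensity hε hy (hQi i), smul_smul, mul_div_cancel₀ _ (hQi i).ne']

/-- The Gibbs coupling has the right marginals if the soft assignments have the right masses. -/
lemma tilted_logDensity_mem_couplings (hε : 0 < ε) (hy : Function.Injective y)
    [IsProbabilityMeasure P] [IsProbabilityMeasure Q] (hQ : ∀ᵐ p ∂Q, p ∈ range y)
    (hQi : ∀ i, 0 < Q.real {y i}) (hz : ∀ i, ∫ x, gibbs y z ε i x ∂P = Q.real {y i}) :
    (P.prod Q).tilted (logDensity Q y z ε) ∈ couplings P Q := by
  classical
  have hmeas : ∀ s : Set (Euc d × Euc d), MeasurableSet s →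
      (P.prod Q).tilted (logDensity Q y z ε) s =
        ∫⁻ x, ∑ i, ENNReal.ofReal (gibbs y z ε i x) * s.indicator 1 (x, y i) ∂P := by
    intro s hs
    rw [← lintegral_indicator_one hs]
    exact lintegral_tilted_logDensity hε hy hQ hQi (measurable_one.indicator hs)
  constructor
  · ext A hA
    rw [Measure.fst_apply hA, hmeas _ (measurable_fst hA), ← lintegral_indicator_one hA]
    refine lintegral_congr fun x => ?_
    have h1 : ∀ i, (Prod.fst ⁻¹' A : Set (Euc d × Euc d)).indicator
        (1 : Euc d × Euc d → ℝ≥0∞) (x, y i) = A.indicator 1 x := fun i => rfl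
    simp_rw [h1]
    rw [← Finset.sum_mul, ← ENNReal.ofReal_sum_of_nonneg fun i _ => gibbs_nonneg i x, sum_gibbs,
      ENNReal.ofReal_one, one_mul]
  · refine measure_ext_of_mem_range hy ?_ hQ fun j => ?_
    · rw [ae_iff, show {a | a ∉ range y} = (range y)ᶜ from rfl,
        Measure.snd_apply (finite_range y).measurableSet.compl,
        hmeas _ (measurable_snd (finite_range y).measurableSet.compl)]
      simp
    · rw [Measure.snd_apply (measurableSet_singleton _),
        hmeas _ (measurable_snd (measurableSet_singleton _))]
      have h1 : ∀ x i, (Prod.snd ⁻¹' {y j} : Set (Euc d × Euc d)).indicator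
          (1 : Euc d × Euc d → ℝ≥0∞) (x, y i) = if i = j then 1 else 0 := by
        intro x i
        by_cases hij : i = j
        · subst hij; simp
        · rw [if_neg hij]
          have : (x, y i) ∉ (Prod.snd ⁻¹' {y j} : Set (Euc d × Euc d)) := fun h => hij (hy h)
          rw [indicator_of_notMem this]
      simp only [h1, mul_ite, mul_one, mul_zero, Finset.sum_ite_eq', Finset.mem_univ, if_true]
      rw [← ofReal_integral_eq_lintegral_ofReal ?_ (ae_of_all _ fun x => gibbs_nonneg j x), hz j,
        Measure.real, ENNReal.ofReal_toReal (measure_ne_top _ _)]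
      refine Integrable.of_bound (measurable_gibbs y z ε j).aestronglyMeasurable 1
        (ae_of_all _ fun x => ?_)
      rw [Real.norm_of_nonneg (gibbs_nonneg j x)]
      exact gibbs_le_one j x

/-- The integral of the logarithmic density against a coupling is the transport objective up to
terms which depend only on the marginals. -/
lemma integral_logDensity (hε : 0 < ε) (hX : IsCompact X) (hPX : ∀ᵐ x ∂P, x ∈ X)
    [IsProbabilityMeasure P] [IsProbabilityMeasure Q] (hQ : ∀ᵐ p ∂Q, p ∈ range y) :
    ∃ c : ℝ, ∀ π ∈ couplings P Q, Integrable (logDensity Q y z ε) π ∧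
      ε * ∫ p, logDensity Q y z ε p ∂π = (∫ p, inner ℝ p.1 p.2 ∂π) - c := by
  set b := extendRange y (fun i => z i + ε * Real.log (Q.real {y i}))
  refine ⟨(∫ p, b p ∂Q) + ∫ x, softMax y z ε x ∂P, fun π hπ => ?_⟩
  have := isProbabilityMeasure_of_mem_couplings hπ
  have hfst : π.map Prod.fst = P := hπ.1
  have hsnd : π.map Prod.snd = Q := hπ.2
  have hi := integrable_inner_of_mem_couplings hX hPX hQ hπ
  have hbQ : Integrable b Q := integrable_extendRange _ _ _
  have hsP : Integrable (softMax y z ε) P := by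
    have h1 := (continuous_softMax y z ε).continuousOn.integrableOn_compact (μ := P) hX
    rwa [IntegrableOn, Measure.restrict_eq_self_of_ae_mem hPX] at h1
  have hb : Integrable (fun p : Euc d × Euc d => b p.2) π := by
    rw [← hsnd] at hbQ
    exact hbQ.comp_measurable measurable_snd
  have hs : Integrable (fun p : Euc d × Euc d => softMax y z ε p.1) π := by
    rw [← hfst] at hsP
    exact hsP.comp_measurable measurable_fst
  have hb' : ∫ p, b p.2 ∂π = ∫ p, b p ∂Q := by
    rw [← hsnd, integral_map measurable_snd.aemeasurable
      (measurable_extendRange _ _).aestronglyMeasurable]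
  have hs' : ∫ p, softMax y z ε p.1 ∂π = ∫ x, softMax y z ε x ∂P := by
    rw [← hfst, integral_map measurable_fst.aemeasurable
      (continuous_softMax y z ε).aestronglyMeasurable]
  refine ⟨((hi.sub hb).sub hs).div_const ε, ?_⟩
  have h1 : ∫ p, logDensity Q y z ε p ∂π =
      ((∫ p, inner ℝ p.1 p.2 ∂π) - (∫ p, b p.2 ∂π) - ∫ p, softMax y z ε p.1 ∂π) / ε := by
    rw [← integral_sub hi hb, ← integral_sub (f := fun p => inner ℝ p.1 p.2 - b p.2)
      (hi.sub hb) hs, ← integral_div]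
    rfl
  rw [h1, hb', hs']
  field_simp
  ring

lemma entropicObjective_eq [IsProbabilityMeasure P] [IsProbabilityMeasure Q] (hε : 0 < ε)
    {π : Measure (Euc d × Euc d)} [IsProbabilityMeasure π]
    (hac : π ≪ P.prod Q) (hint : Integrable (llr π (P.prod Q)) π) :
    entropicObjective P Q ε π =
      (((∫ p, inner ℝ p.1 p.2 ∂π) - ε * ∫ p, llr π (P.prod Q) p ∂π : ℝ) : EReal) := by
  have h1 := InformationTheory.toReal_klDiv_of_measure_eq hac (by simp)
  have h2 := InformationTheory.klDiv_ne_top hac hint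
  rw [entropicObjective, ← h1, ← ENNReal.ofReal_toReal h2, ← ENNReal.ofReal_mul hε.le,
    EReal.coe_ennreal_ofReal, max_eq_left (by positivity), ENNReal.ofReal_toReal h2]
  rfl

/-- Gibbs' variational principle: up to a constant, the entropic objective of a coupling is minus
`ε` times its divergence from the Gibbs coupling, which is therefore the only maximizer. -/
lemma IsEOTOptimal.eq_tilted (hε : 0 < ε) (hX : IsCompact X) (hy : Function.Injective y)
    (hPX : ∀ᵐ x ∂P, x ∈ X) [IsProbabilityMeasure P] [IsProbabilityMeasure Q]
    (hQ : ∀ᵐ p ∂Q, p ∈ range y) (hQi : ∀ i, 0 < Q.real {y i})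
    (hz : ∀ i, ∫ x, gibbs y z ε i x ∂P = Q.real {y i}) {π : Measure (Euc d × Euc d)}
    (hπ : IsEOTOptimal P Q ε π) : π = (P.prod Q).tilted (logDensity Q y z ε) := by
  obtain ⟨hπc, hπmax⟩ := hπ
  have hexp := integrable_exp_logDensity (P := P) (z := z) hε hy hQ hQi
  have hexp1 := integral_exp_logDensity (P := P) (z := z) hε hy hQ hQi
  set F := logDensity Q y z ε
  set π₀ := (P.prod Q).tilted F with hπ₀
  have hπ₀c : π₀ ∈ couplings P Q := tilted_logDensity_mem_couplings hε hy hQ hQi hz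
  have hp := isProbabilityMeasure_of_mem_couplings hπc
  have hp₀ := isProbabilityMeasure_of_mem_couplings hπ₀c
  obtain ⟨c, hc⟩ := integral_logDensity (z := z) hε hX hPX hQ
  obtain ⟨hFπ, hFπ'⟩ := hc π hπc
  obtain ⟨hFπ₀, hFπ₀'⟩ := hc π₀ hπ₀c
  have hac₀ : π₀ ≪ P.prod Q := tilted_absolutelyContinuous _ _
  have hllr₀ : llr π₀ (P.prod Q) =ᵐ[π₀] F := by
    filter_upwards [hac₀.ae_le (log_rnDeriv_tilted_left_self hexp)] with p h
    rw [llr, h, hexp1, Real.log_one, sub_zero]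
  have hobj₀ : entropicObjective P Q ε π₀ = (c : EReal) := by
    rw [entropicObjective_eq hε hac₀ ((integrable_congr hllr₀).2 hFπ₀), integral_congr_ae hllr₀,
      hFπ₀', sub_sub_cancel]
  have hge : (c : EReal) ≤ entropicObjective P Q ε π := hobj₀ ▸ hπmax hπ₀c
  have hfin : InformationTheory.klDiv π (P.prod Q) ≠ ∞ := by
    intro h
    have h1 : entropicObjective P Q ε π = ⊥ := by
      rw [entropicObjective, h, ENNReal.mul_top (by simpa using hε), EReal.coe_ennreal_top,
        EReal.sub_top]
    rw [h1] at hge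
    exact EReal.coe_ne_bot c (le_bot_iff.1 hge)
  obtain ⟨hac, hint⟩ := InformationTheory.klDiv_ne_top_iff.1 hfin
  rw [entropicObjective_eq hε hac hint, EReal.coe_le_coe_iff] at hge
  have hac' : π ≪ π₀ := hac.trans (absolutelyContinuous_tilted hexp)
  have hint' : Integrable (llr π π₀) π := integrable_llr_tilted_right hac hFπ hint hexp
  have h2 := integral_llr_tilted_right hac hFπ hexp hint
  rw [hexp1, Real.log_one, add_zero] at h2
  have h3 := InformationTheory.toReal_klDiv_of_measure_eq hac' (by simp)
  have h4 : (InformationTheory.klDiv π π₀).toReal ≤ 0 := by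
    have h5 : ε * ∫ p, llr π π₀ p ∂π ≤ 0 := by
      rw [h2, mul_sub]
      linarith
    rw [h3]
    by_contra! h6
    have := mul_pos hε h6
    linarith
  have h7 : InformationTheory.klDiv π π₀ = 0 := by
    rcases (ENNReal.toReal_eq_zero_iff _).1 (le_antisymm h4 ENNReal.toReal_nonneg) with h | h
    · exact h
    · exact absurd h (InformationTheory.klDiv_ne_top hac' hint')
  exact InformationTheory.klDiv_eq_zero_iff.1 h7

/-- The entropic map is the barycentre of the targets with the Gibbs weights. -/
lemma IsEntropicMap.ae_eq_sum_gibbs (hε : 0 < ε) (hX : IsCompact X) (hy : Function.Injective y)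
    (hPX : ∀ᵐ x ∂P, x ∈ X) [IsProbabilityMeasure P] [IsProbabilityMeasure Q]
    (hQ : ∀ᵐ p ∂Q, p ∈ range y) (hQi : ∀ i, 0 < Q.real {y i})
    (hz : ∀ i, ∫ x, gibbs y z ε i x ∂P = Q.real {y i}) {T : Euc d → Euc d}
    (hT : IsEntropicMap P Q ε T) : T =ᵐ[P] fun x => ∑ i, gibbs y z ε i x • y i := by
  classical
  obtain ⟨hTm, π, hπ, hTπ⟩ := hT
  have hπeq := hπ.eq_tilted hε hX hy hPX hQ hQi hz
  have hπc := hπ.1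
  have hp := isProbabilityMeasure_of_mem_couplings hπc
  have hfst : π.map Prod.fst = P := hπc.1
  set S : Euc d → Euc d := fun x => ∑ i, gibbs y z ε i x • y i with hS
  have hSm : Measurable S := by fun_prop
  have hSbd : ∀ x, ‖S x‖ ≤ ∑ i, ‖y i‖ := fun x =>
    (norm_sum_le _ _).trans (Finset.sum_le_sum fun i _ => by
      rw [norm_smul, Real.norm_of_nonneg (gibbs_nonneg i x)]
      exact mul_le_of_le_one_left (norm_nonneg _) (gibbs_le_one i x))
  have hSint : Integrable (fun p : Euc d × Euc d => S p.1) π :=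
    Integrable.of_bound (hSm.comp measurable_fst).aestronglyMeasurable _
      (ae_of_all _ fun p => hSbd p.1)
  have h2 : ∀ᵐ p ∂π, p.2 ∈ range y := ae_of_ae_map measurable_snd.aemeasurable (by
    have := hπc.2; rw [Measure.snd] at this; rwa [this])
  have hYint : Integrable (fun p : Euc d × Euc d => p.2) π := by
    refine Integrable.of_bound (by fun_prop) (∑ i, ‖y i‖) ?_
    filter_upwards [h2] with p ⟨i, hi⟩
    rw [← hi]
    exact Finset.single_le_sum (fun k _ => norm_nonneg (y k)) (Finset.mem_univ i)
  have hcond : (fun p : Euc d × Euc d => S p.1) =ᵐ[π]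
      π[(fun p : Euc d × Euc d => p.2) |
        MeasurableSpace.comap (fun p : Euc d × Euc d => p.1) inferInstance] := by
    refine ae_eq_condExp_of_forall_setIntegral_eq measurable_fst.comap_le hYint
      (fun s _ _ => hSint.integrableOn) ?_ ?_
    · rintro _ ⟨A, hA, rfl⟩ -
      have hAm : MeasurableSet ((fun p : Euc d × Euc d => p.1) ⁻¹' A) := measurable_fst hA
      rw [← integral_indicator hAm, ← integral_indicator hAm]
      have i1 := hSint.indicator hAm
      have i2 := hYint.indicator hAm
      rw [hπeq] at i1 i2 ⊢
      rw [integral_tilted_logDensity hε hy hQ hQi i1, integral_tilted_logDensity hε hy hQ hQi i2]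
      refine integral_congr_ae (ae_of_all _ fun x => ?_)
      by_cases hx : x ∈ A
      · have e : ∀ i, (x, y i) ∈ (fun p : Euc d × Euc d => p.1) ⁻¹' A := fun i => hx
        simp only [indicator_of_mem (e _)]
        rw [← Finset.sum_smul, sum_gibbs, one_smul]
      · have e : ∀ i, (x, y i) ∉ (fun p : Euc d × Euc d => p.1) ⁻¹' A := fun i => hx
        simp only [indicator_of_notMem (e _)]
    · exact (hSm.comp (comap_measurable _)).stronglyMeasurable.aestronglyMeasurable
  have h3 : (fun p : Euc d × Euc d => T p.1) =ᵐ[π] fun p => S p.1 := hTπ.trans hcond.symm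
  obtain ⟨T', hT'm, hTT'⟩ := hTm
  have h4 : ∀ᵐ p ∂π, T p.1 = T' p.1 := by
    rw [← hfst] at hTT'
    exact ae_of_ae_map measurable_fst.aemeasurable hTT'
  have h5 : ∀ᵐ x ∂P, T' x = S x := by
    rw [← hfst, ae_map_iff measurable_fst.aemeasurable (measurableSet_eq_fun hT'm hSm)]
    filter_upwards [h3, h4] with p hp3 hp4
    rw [← hp4, hp3]
  filter_upwards [hTT', h5] with x hx1 hx2
  rw [hx1, hx2]

end Entropic

/-! ### Hölder fields and their dual -/

section HolderDual

variable {d : ℕ} {α : ℝ} {X : Set (Euc d)}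

lemma HolderSpace.norm_toField_le (φ : HolderSpace α X) (x : X) : ‖φ.toField x‖ ≤ ‖φ‖ := by
  have h : ‖φ.toField x‖ₑ ≤ eHolderNormField α φ.toField :=
    (le_iSup (fun x : X => ‖φ.toField x‖ₑ) x).trans le_self_add
  have := ENNReal.toReal_mono φ.2 h
  rwa [toReal_enorm] at this

lemma HolderSpace.holderWith (hα : 0 < α) (φ : HolderSpace α X) :
    HolderWith ‖φ‖₊ ⟨α, hα.le⟩ φ.toField := by
  intro x y
  have hn : ((‖φ‖₊ : NNReal) : ℝ≥0∞) = eHolderNormField α φ.toField := by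
    rw [← ENNReal.coe_toNNReal (show eHolderNormField α φ.toField ≠ ∞ from φ.2)]
    exact congrArg _ (NNReal.eq rfl)
  rw [hn, edist_eq_enorm_sub, Subtype.edist_eq, edist_eq_enorm_sub]
  rcases eq_or_ne x y with rfl | hxy
  · simp
  have h0 : ‖(x : Euc d) - y‖ₑ ≠ 0 := by
    rw [enorm_ne_zero, sub_ne_zero]
    exact fun h => hxy (Subtype.ext h)
  have h1 : ‖φ.toField x - φ.toField y‖ₑ / ‖(x : Euc d) - (y : Euc d)‖ₑ ^ α ≤
      ⨆ (x : X) (y : X) (_ : x ≠ y),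
        ‖φ.toField x - φ.toField y‖ₑ / ‖(x : Euc d) - (y : Euc d)‖ₑ ^ α :=
    le_iSup_of_le x (le_iSup_of_le y (le_iSup_of_le hxy le_rfl))
  replace h1 := h1.trans (le_add_self (b := ⨆ x : X, ‖φ.toField x‖ₑ))
  refine (ENNReal.div_le_iff ?_ ?_).1 h1
  · exact (ENNReal.rpow_pos (pos_iff_ne_zero.2 h0) enorm_ne_top).ne'
  · exact ENNReal.rpow_ne_top_of_nonneg hα.le enorm_ne_top

/-- The extension by zero of a vector field on `X` to `ℝᵈ`. -/
noncomputable def HolderSpace.extend (φ : HolderSpace α X) : Euc d → Euc d :=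
  Function.extend Subtype.val φ.toField 0

lemma HolderSpace.extend_coe (φ : HolderSpace α X) (x : X) : φ.extend x = φ.toField x :=
  Subtype.val_injective.extend_apply _ _ _

lemma HolderSpace.norm_extend_le (φ : HolderSpace α X) {x : Euc d} (hx : x ∈ X) :
    ‖φ.extend x‖ ≤ ‖φ‖ := by
  lift x to X using hx
  rw [extend_coe]
  exact φ.norm_toField_le x

lemma HolderSpace.norm_extend_sub_le (hα : 0 < α) (φ : HolderSpace α X) {x x' : Euc d}
    (hx : x ∈ X) (hx' : x' ∈ X) : ‖φ.extend x - φ.extend x'‖ ≤ ‖φ‖ * ‖x - x'‖ ^ α := by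
  lift x to X using hx
  lift x' to X using hx'
  have h := (φ.holderWith hα).dist_le x x'
  rw [extend_coe, extend_coe, ← dist_eq_norm, ← dist_eq_norm]
  exact h

lemma HolderSpace.measurable_extend (hα : 0 < α) (hX : MeasurableSet X) (φ : HolderSpace α X) :
    Measurable φ.extend :=
  (MeasurableEmbedding.subtype_coe hX).measurable_extend
    ((φ.holderWith hα).continuous (show (0 : ℝ) < α from hα)).measurable measurable_const

/-- A bounded map induces a continuous linear functional on the Hölder fields. -/
lemma exists_isDualElement (hα : 0 < α) (hX : MeasurableSet X) {P : Measure (Euc d)}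
    [IsFiniteMeasure P] {T : Euc d → Euc d} (hT : AEMeasurable T P) {R : ℝ}
    (hR : ∀ᵐ x ∂P, ‖T x‖ ≤ R) :
    ∃ ℓ : StrongDual ℝ (HolderSpace α X), IsDualElement P T ℓ ∧
      ∀ φ, ℓ φ = ∫ x in X, inner ℝ (φ.extend x) (T x) ∂P := by
  have hint : ∀ φ : HolderSpace α X,
      IntegrableOn (fun x => (inner ℝ (φ.extend x) (T x) : ℝ)) X P := by
    intro φ
    refine Integrable.of_bound (C := ‖φ‖ * R) ?_ ?_
    · exact ((φ.measurable_extend hα hX).aestronglyMeasurable.inner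
        hT.aestronglyMeasurable).restrict
    · filter_upwards [ae_restrict_of_ae hR, ae_restrict_mem hX] with x h1 h2
      exact (norm_inner_le_norm _ _).trans
        (mul_le_mul (φ.norm_extend_le h2) h1 (norm_nonneg _) (norm_nonneg _))
  have hadd : ∀ φ φ' : HolderSpace α X, ∀ x ∈ X, (φ + φ').extend x = φ.extend x + φ'.extend x := by
    intro φ φ' x hx
    lift x to X using hx
    simp only [HolderSpace.extend_coe]
    rfl
  have hsmul : ∀ (c : ℝ) (φ : HolderSpace α X), ∀ x ∈ X, (c • φ).extend x = c • φ.extend x := by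
    intro c φ x hx
    lift x to X using hx
    simp only [HolderSpace.extend_coe]
    rfl
  let L : HolderSpace α X →ₗ[ℝ] ℝ :=
    { toFun := fun φ => ∫ x in X, inner ℝ (φ.extend x) (T x) ∂P
      map_add' := fun φ φ' => by
        rw [← integral_add (hint φ) (hint φ')]
        exact setIntegral_congr_fun hX fun x hx => by
          simp only [hadd φ φ' x hx, inner_add_left]
      map_smul' := fun c φ => by
        rw [RingHom.id_apply, smul_eq_mul, ← integral_const_mul]
        exact setIntegral_congr_fun hX fun x hx => by
          simp only [hsmul c φ x hx, real_inner_smul_left] }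
  refine ⟨L.mkContinuous (R * P.real X) fun φ => ?_, fun φ => ⟨?_, ?_⟩, fun φ => rfl⟩
  · refine (norm_setIntegral_le_of_norm_le_const_ae' (C := ‖φ‖ * R) (measure_lt_top P X)
      ?_).trans_eq (by ring)
    filter_upwards [hR] with x h1 h2
    exact (norm_inner_le_norm _ _).trans
      (mul_le_mul (φ.norm_extend_le h2) h1 (norm_nonneg _) (norm_nonneg _))
  · have h := hint φ
    rw [IntegrableOn, ← map_comap_subtype_coe hX] at h
    have h2 := h.comp_measurable measurable_subtype_coe
    simpa only [Function.comp_def, HolderSpace.extend_coe] using h2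
  · rw [LinearMap.mkContinuous_apply]
    have h := integral_subtype_comap (μ := P) hX fun x => (inner ℝ (φ.extend x) (T x) : ℝ)
    simp only [HolderSpace.extend_coe] at h
    exact h.symm

end HolderDual

/-! ### The source measure -/

section Source

variable {d : ℕ} {X : Set (Euc d)} {ρ : Euc d → ℝ} {P : Measure (Euc d)}

namespace SourceCondition

lemma measurable_indicator (hP : SourceCondition X ρ P) : Measurable (X.indicator ρ) := by
  classical
  obtain ⟨K, hK⟩ := hP.lipschitz
  rw [← piecewise_eq_indicator]
  exact hK.continuousOn.measurable_piecewise continuousOn_const hP.isCompact.measurableSet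

lemma exists_bounds (hP : SourceCondition X ρ P) :
    ∃ m M : ℝ, 0 < m ∧ 0 < M ∧ ∀ x ∈ X, m ≤ ρ x ∧ ρ x ≤ M := by
  obtain ⟨K, hK⟩ := hP.lipschitz
  have hne : X.Nonempty := hP.nonempty_interior.mono interior_subset
  obtain ⟨x₀, hx₀, h₀⟩ := hP.isCompact.exists_isMinOn hne hK.continuousOn
  obtain ⟨x₁, hx₁, h₁⟩ := hP.isCompact.exists_isMaxOn hne hK.continuousOn
  exact ⟨ρ x₀, ρ x₁, hP.pos _ hx₀, hP.pos _ hx₁, fun x hx => ⟨h₀ hx, h₁ hx⟩⟩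

lemma apply_eq (hP : SourceCondition X ρ P) {S : Set (Euc d)} (hS : S ⊆ X)
    (hSm : MeasurableSet S) : P S = ∫⁻ x in S, ENNReal.ofReal (ρ x) := by
  rw [hP.density, withDensity_apply _ hSm, Measure.restrict_restrict hSm,
    inter_eq_self_of_subset_left hS]

lemma measureReal_le (hP : SourceCondition X ρ P) {M : ℝ} (hM : 0 ≤ M) (h : ∀ x ∈ X, ρ x ≤ M)
    {S : Set (Euc d)} (hS : S ⊆ X) (hSm : MeasurableSet S) :
    P.real S ≤ M * volume.real S := by
  have hfin : volume S ≠ ∞ :=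
    ne_top_of_le_ne_top hP.isCompact.measure_lt_top.ne (measure_mono hS)
  have h1 : P S ≤ ENNReal.ofReal M * volume S := by
    rw [hP.apply_eq hS hSm, ← setLIntegral_const]
    exact setLIntegral_mono' hSm fun x hx => ENNReal.ofReal_le_ofReal (h x (hS hx))
  have h2 := ENNReal.toReal_mono (ENNReal.mul_ne_top ENNReal.ofReal_ne_top hfin) h1
  rwa [ENNReal.toReal_mul, ENNReal.toReal_ofReal hM] at h2

lemma le_measureReal (hP : SourceCondition X ρ P) {m : ℝ} (hm : 0 ≤ m) (h : ∀ x ∈ X, m ≤ ρ x)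
    {S : Set (Euc d)} (hS : S ⊆ X) (hSm : MeasurableSet S) :
    m * volume.real S ≤ P.real S := by
  have := hP.isProbabilityMeasure
  have h1 : ENNReal.ofReal m * volume S ≤ P S := by
    rw [hP.apply_eq hS hSm, ← setLIntegral_const]
    exact setLIntegral_mono' hSm fun x hx => ENNReal.ofReal_le_ofReal (h x (hS hx))
  have h2 := ENNReal.toReal_mono (measure_ne_top P S) h1
  rwa [ENNReal.toReal_mul, ENNReal.toReal_ofReal hm] at h2

lemma absolutelyContinuous (hP : SourceCondition X ρ P) : P ≪ volume.restrict X := by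
  rw [hP.density]
  exact withDensity_absolutelyContinuous _ _

lemma measure_compl (hP : SourceCondition X ρ P) : P Xᶜ = 0 :=
  hP.absolutelyContinuous (by
    rw [Measure.restrict_apply hP.isCompact.measurableSet.compl, compl_inter_self, measure_empty])

lemma ae_mem (hP : SourceCondition X ρ P) : ∀ᵐ x ∂P, x ∈ X :=
  mem_ae_iff.2 hP.measure_compl

/-- The density is only controlled on `X`, whence the indicator. -/
lemma integral_eq (hP : SourceCondition X ρ P) (f : Euc d → ℝ) :
    ∫ x, f x ∂P = ∫ x in X, X.indicator ρ x * f x := by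
  have h1 : P = (volume.restrict X).withDensity fun x => ENNReal.ofReal (X.indicator ρ x) := by
    conv_lhs => rw [hP.density]
    refine withDensity_congr_ae ?_
    filter_upwards [ae_restrict_mem hP.isCompact.measurableSet] with x hx
    rw [indicator_of_mem hx]
  conv_lhs => rw [h1]
  rw [integral_withDensity_eq_integral_toReal_smul hP.measurable_indicator.ennreal_ofReal
    (ae_of_all _ fun x => ENNReal.ofReal_lt_top)]
  refine integral_congr_ae (ae_of_all _ fun x => ?_)
  simp only [smul_eq_mul]
  rw [ENNReal.toReal_ofReal (indicator_nonneg (fun x hx => (hP.pos x hx).le) x)]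

/-- A Lipschitz function on a bounded set is Hölder of every exponent `α ≤ 1`. -/
lemma exists_abs_sub_le (hP : SourceCondition X ρ P) {α : ℝ} (hα1 : α ≤ 1) :
    ∃ K : ℝ, 0 ≤ K ∧ ∀ x ∈ X, ∀ x' ∈ X, |ρ x - ρ x'| ≤ K * ‖x - x'‖ ^ α := by
  obtain ⟨K, hK⟩ := hP.lipschitz
  have hD0 : 0 ≤ Metric.diam X := Metric.diam_nonneg
  refine ⟨K * Metric.diam X ^ (1 - α), by positivity, fun x hx x' hx' => ?_⟩
  have h1 := hK.dist_le_mul x hx x' hx'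
  have h2 := Metric.dist_le_diam_of_mem hP.isCompact.isBounded hx hx'
  rw [Real.dist_eq] at h1
  rw [dist_eq_norm] at h1 h2
  rcases (norm_nonneg (x - x')).eq_or_lt with h0 | h0
  · rw [← h0, mul_zero] at h1
    exact h1.trans (by positivity)
  · refine h1.trans ?_
    rw [mul_assoc]
    refine mul_le_mul_of_nonneg_left ?_ K.2
    calc ‖x - x'‖ = ‖x - x'‖ ^ (1 - α) * ‖x - x'‖ ^ α := by
          rw [← Real.rpow_add h0, sub_add_cancel, Real.rpow_one]
      _ ≤ _ := mul_le_mul_of_nonneg_right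
          (Real.rpow_le_rpow h0.le h2 (sub_nonneg.2 hα1)) (by positivity)

end SourceCondition

end Source

/-! ### Comparison of the soft assignment with the optimal cells -/

section Comparison

variable {d : ℕ} {ι : Type*} [Fintype ι] {X : Set (Euc d)} {y : ι → Euc d}
  {ρ : Euc d → ℝ} {P : Measure (Euc d)} {α : ℝ}

lemma rpow_add_sq_mul_log_sq_le (hα1 : α ≤ 1) {ε : ℝ} (hε : 0 < ε) (hε1 : ε < 1) :
    ε ^ (1 + α) + ε ^ 2 * Real.log (1 / ε) ^ 2 ≤
      2 * max (ε ^ (1 + α)) (ε ^ 2 * Real.log (1 / ε) ^ 3) := by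
  set l := Real.log (1 / ε)
  have hl : 0 ≤ l := Real.log_nonneg (by rw [le_div_iff₀ hε]; linarith)
  have h1 : ε ^ 2 ≤ ε ^ (1 + α) := by
    rw [← Real.rpow_natCast]
    exact Real.rpow_le_rpow_of_exponent_ge hε hε1.le (by push_cast; linarith)
  have h2 : ε ^ 2 * l ^ 2 ≤ max (ε ^ (1 + α)) (ε ^ 2 * l ^ 3) := by
    rcases le_total l 1 with h | h
    · refine le_max_of_le_left (le_trans ?_ h1)
      exact mul_le_of_le_one_right (by positivity) (pow_le_one₀ hl h)
    · refine le_max_of_le_right (mul_le_mul_of_nonneg_left ?_ (by positivity))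
      exact pow_le_pow_right₀ h (by norm_num)
  linarith [le_max_left (ε ^ (1 + α)) (ε ^ 2 * l ^ 3)]

/-- The estimate for the Lebesgue measure carries over to `P`, because a Lipschitz density can be
absorbed into the Hölder weights. -/
lemma SourceCondition.exists_abs_integral_gibbs_sub_indicator_le [Nonempty ι]
    (hP : SourceCondition X ρ P) (hy : Function.Injective y) (hα : 0 < α) (hα1 : α ≤ 1) {a : ℝ}
    (ha : 0 < a) :
    ∃ C : ℝ, 0 < C ∧ ∀ z : ι → ℝ, (∀ i, a ≤ volume.real (lagCell X y z i)) →
      ∀ ε : ℝ, 0 < ε → ε < 1 → ∀ (B : ℝ) (ψ : ι → Euc d → ℝ), (∀ i, Measurable (ψ i)) →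
      (∀ i, ∀ x ∈ X, |ψ i x| ≤ B) →
      (∀ i, ∀ x ∈ X, ∀ x' ∈ X, |ψ i x - ψ i x'| ≤ B * ‖x - x'‖ ^ α) →
      |∫ x, ∑ i, ψ i x * (gibbs y z ε i x - (lagCell X y z i).indicator 1 x) ∂P| ≤
        C * B * (ε ^ (1 + α) + ε ^ 2 * Real.log (1 / ε) ^ 2) := by
  obtain ⟨m, M, hm, hM, hmM⟩ := hP.exists_bounds
  obtain ⟨K, hK, hρ⟩ := hP.exists_abs_sub_le hα1
  obtain ⟨C, hC, H⟩ := _root_.exists_abs_integral_gibbs_sub_indicator_le hP.convex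
    hP.isCompact.isBounded hP.isCompact.measurableSet hP.nonempty_interior ha hy hα hα1
  have habs : ∀ x ∈ X, |ρ x| ≤ M := fun x hx => by
    rw [abs_of_pos (hP.pos x hx)]; exact (hmM x hx).2
  refine ⟨C * (M + K), by positivity, fun z hz ε hε hε1 B ψ hψm hψB hψα => ?_⟩
  have hB : 0 ≤ B := by
    obtain ⟨x, hx⟩ := hP.nonempty_interior
    exact (abs_nonneg _).trans (hψB (Classical.arbitrary ι) x (interior_subset hx))
  have h := H z hz ε hε hε1 ((M + K) * B) (fun i x => X.indicator ρ x * ψ i x)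
    (fun i => hP.measurable_indicator.mul (hψm i)) (fun i x hx => ?_) (fun i x hx x' hx' => ?_)
  · rw [hP.integral_eq]
    refine le_trans (le_of_eq ?_) (h.trans_eq (by ring))
    simp only [Finset.mul_sum, mul_assoc]
  · rw [indicator_of_mem hx, abs_mul]
    refine (mul_le_mul (habs x hx) (hψB i x hx) (abs_nonneg _) hM.le).trans ?_
    nlinarith
  · rw [indicator_of_mem hx, indicator_of_mem hx',
      show ρ x * ψ i x - ρ x' * ψ i x' = ρ x * (ψ i x - ψ i x') + (ρ x - ρ x') * ψ i x' by ring]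
    refine (abs_add_le _ _).trans ?_
    rw [abs_mul, abs_mul]
    have e1 := mul_le_mul (habs x hx) (hψα i x hx x' hx') (abs_nonneg _) hM.le
    have e2 := mul_le_mul (hρ x hx x' hx') (hψB i x' hx') (abs_nonneg _) (by positivity)
    linarith

lemma integral_gibbs_sub_indicator (y : ι → Euc d) (z z' : ι → ℝ) (ε : ℝ) (i : ι)
    (hX : MeasurableSet X) [IsProbabilityMeasure P] :
    ∫ x, (gibbs y z ε i x - (lagCell X y z' i).indicator 1 x) ∂P =
      (∫ x, gibbs y z ε i x ∂P) - P.real (lagCell X y z' i) := by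
  have hm := measurableSet_lagCell hX y z' i
  have hi : Integrable ((lagCell X y z' i).indicator (1 : Euc d → ℝ)) P :=
    (integrable_const (1 : ℝ)).indicator hm
  rw [integral_sub _ hi]
  · rw [integral_indicator_one hm]
  · refine Integrable.of_bound (measurable_gibbs y z ε i).aestronglyMeasurable 1
      (ae_of_all _ fun x => ?_)
    rw [Real.norm_of_nonneg (gibbs_nonneg i x)]
    exact gibbs_le_one i x

lemma abs_gibbs_sub_indicator_le (y : ι → Euc d) (z : ι → ℝ) (ε : ℝ) (i : ι) (S : Set (Euc d))
    (x : Euc d) : |gibbs y z ε i x - S.indicator 1 x| ≤ 1 := by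
  have h1 := gibbs_nonneg (y := y) (z := z) (ε := ε) i x
  have h2 := gibbs_le_one (y := y) (z := z) (ε := ε) i x
  by_cases h : x ∈ S
  · rw [indicator_of_mem h, Pi.one_apply]; exact abs_le.2 ⟨by linarith, by linarith⟩
  · rw [indicator_of_notMem h]; exact abs_le.2 ⟨by linarith, by linarith⟩

/-- The soft assignment and the optimal assignment with the same marginals agree up to the rate,
although their weights differ. The masses of the cells for the weights of the soft assignment are
within the rate of the prescribed masses; by stability these weights, and hence the cells, are
within the rate of the optimal ones. -/
lemma SourceCondition.exists_abs_integral_gibbs_sub_optimal_le [Nonempty ι]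
    (hP : SourceCondition X ρ P) (hy : Function.Injective y) (hα : 0 < α) (hα1 : α ≤ 1) {c : ℝ}
    (hc : 0 < c) :
    ∃ C : ℝ, 0 < C ∧ ∀ (z z' : ι → ℝ) (ε : ℝ), 0 < ε → ε < 1 →
      (∀ i, c ≤ P.real (lagCell X y z i)) →
      (∀ i, ∫ x, gibbs y z' ε i x ∂P = P.real (lagCell X y z i)) →
      ∀ (B : ℝ) (ψ : ι → Euc d → ℝ), (∀ i, Measurable (ψ i)) →
      (∀ i, ∀ x ∈ X, |ψ i x| ≤ B) →
      (∀ i, ∀ x ∈ X, ∀ x' ∈ X, |ψ i x - ψ i x'| ≤ B * ‖x - x'‖ ^ α) →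
      |∫ x, ∑ i, ψ i x * (gibbs y z' ε i x - (lagCell X y z i).indicator 1 x) ∂P| ≤
        C * B * max (ε ^ (1 + α)) (ε ^ 2 * Real.log (1 / ε) ^ 3) := by
  classical
  have hprob := hP.isProbabilityMeasure
  have hXb := hP.isCompact.isBounded
  have hXm := hP.isCompact.measurableSet
  obtain ⟨m, M, hm, hM, hmM⟩ := hP.exists_bounds
  have hPM : ∀ S ⊆ X, MeasurableSet S → P.real S ≤ M * volume.real S := fun S hS hSm =>
    hP.measureReal_le hM.le (fun x hx => (hmM x hx).2) hS hSm
  have hPm : ∀ S ⊆ X, MeasurableSet S → m * volume.real S ≤ P.real S := fun S hS hSm =>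
    hP.le_measureReal hm.le (fun x hx => (hmM x hx).1) hS hSm
  obtain ⟨C₁, hC₁, H₁⟩ := hP.exists_abs_integral_gibbs_sub_indicator_le hy hα hα1
    (a := c / 2 / M) (by positivity)
  obtain ⟨C₂, hC₂, H₂⟩ := exists_integral_abs_gibbs_sub_indicator_le hXb hXm hy
  obtain ⟨C₃, hC₃, H₃⟩ := exists_volume_lagCell_diff_le hXb hy
  obtain ⟨C₄, hC₄, H₄⟩ := exists_abs_sub_le_sum_measureReal_lagCell hP.convex hXb hXm hy hm hM
    hPm hPM (half_pos hc)
  set n : ℝ := (Fintype.card ι : ℝ)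
  have hn : 0 < n := by simp only [n]; exact_mod_cast Fintype.card_pos
  set C₅ : ℝ := C₁ + n * (2 * (M * (C₃ * (C₄ * (n * C₁)))))
  have hC₅ : 0 < C₅ := by positivity
  set ε₀ : ℝ := c / 2 / (M * C₂)
  have hε₀ : 0 < ε₀ := by positivity
  refine ⟨2 * C₅ + n / ε₀ ^ 2, by positivity, fun z z' ε hε hε1 hz hz' B ψ hψm hψB hψα => ?_⟩
  set R := max (ε ^ (1 + α)) (ε ^ 2 * Real.log (1 / ε) ^ 3)
  have hεR : ε ^ 2 ≤ R := by
    refine le_max_of_le_left ?_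
    rw [← Real.rpow_natCast]
    exact Real.rpow_le_rpow_of_exponent_ge hε hε1.le (by push_cast; linarith)
  have hR : 0 < R := lt_of_lt_of_le (by positivity) hεR
  have hB : 0 ≤ B := by
    obtain ⟨x, hx⟩ := hP.nonempty_interior
    exact (abs_nonneg _).trans (hψB (Classical.arbitrary ι) x (interior_subset hx))
  have hXae := hP.ae_mem
  -- For `ε` bounded below, the rate is bounded below, and the trivial bound is enough.
  rcases le_total ε₀ ε with hlarge | hsmall
  · have h1 : |∫ x, ∑ i, ψ i x * (gibbs y z' ε i x - (lagCell X y z i).indicator 1 x) ∂P| ≤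
        n * B := by
      rw [← Real.norm_eq_abs]
      refine (norm_integral_le_of_norm_le_const (C := n * B) ?_).trans_eq (by simp)
      filter_upwards [hXae] with x hx
      rw [Real.norm_eq_abs]
      refine (Finset.abs_sum_le_sum_abs _ _).trans ?_
      refine (Finset.sum_le_card_nsmul _ _ B fun i _ => ?_).trans_eq (by simp [n])
      rw [abs_mul]
      exact (mul_le_mul (hψB i x hx) (abs_gibbs_sub_indicator_le y z' ε i _ x) (abs_nonneg _)
        hB).trans_eq (mul_one B)
    have h2 : ε₀ ^ 2 ≤ R := (pow_le_pow_left₀ hε₀.le hlarge 2).trans hεR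
    have h3 : n * B ≤ n / ε₀ ^ 2 * B * R := by
      calc n * B = n / ε₀ ^ 2 * B * ε₀ ^ 2 := by field_simp
        _ ≤ _ := mul_le_mul_of_nonneg_left h2 (by positivity)
    have h4 : 0 ≤ 2 * C₅ * B * R := by positivity
    nlinarith
  have hgibbs : ∀ z'' i, ∫ x, (gibbs y z' ε i x - (lagCell X y z'' i).indicator 1 x) ∂P =
      P.real (lagCell X y z i) - P.real (lagCell X y z'' i) := fun z'' i => by
    rw [integral_gibbs_sub_indicator y z' z'' ε i hXm, hz' i]
  have hcell : ∀ i, MeasurableSet (lagCell X y z i) := measurableSet_lagCell hXm y z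
  have hcell' : ∀ i, MeasurableSet (lagCell X y z' i) := measurableSet_lagCell hXm y z'
  -- The cells for `z'` have mass bounded below, by the estimate of order `ε`.
  have hlow : ∀ i, c / 2 ≤ P.real (lagCell X y z' i) := by
    intro i
    have h1 : P.real (lagCell X y z i) - P.real (lagCell X y z' i) ≤ M * (C₂ * ε) := by
      rw [← hgibbs z' i, hP.integral_eq]
      refine (le_abs_self _).trans (abs_integral_le_integral_abs.trans ?_)
      refine le_trans ?_ (mul_le_mul_of_nonneg_left (H₂ z' ε hε i) hM.le)
      rw [← integral_const_mul]
      have hbd : IntegrableOn (fun x => |gibbs y z' ε i x - (lagCell X y z' i).indicator 1 x|) X :=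
        integrableOn_of_abs_le hXb subset_rfl hXm (((measurable_gibbs y z' ε i).sub
          (measurable_one.indicator (hcell' i))).abs) (B := 1) fun x _ => by
            rw [abs_abs]; exact abs_gibbs_sub_indicator_le y z' ε i _ x
      refine integral_mono_of_nonneg (ae_of_all _ fun x => abs_nonneg _) (hbd.const_mul M) ?_
      filter_upwards [ae_restrict_mem hXm] with x hx
      rw [abs_mul, indicator_of_mem hx, abs_of_pos (hP.pos x hx)]
      exact mul_le_mul_of_nonneg_right (hmM x hx).2 (abs_nonneg _)
    have h2 : M * (C₂ * ε) ≤ c / 2 := by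
      have := mul_le_mul_of_nonneg_left hsmall (show 0 ≤ M * C₂ by positivity)
      rw [mul_div_cancel₀ _ (by positivity)] at this
      linarith
    linarith [hz i]
  have hvol : ∀ i, c / 2 / M ≤ volume.real (lagCell X y z' i) := fun i => by
    rw [div_le_iff₀' hM]
    exact (hlow i).trans (hPM _ (lagCell_subset X y z' i) (hcell' i))
  set r := ε ^ (1 + α) + ε ^ 2 * Real.log (1 / ε) ^ 2
  have hr : r ≤ 2 * R := rpow_add_sq_mul_log_sq_le hα1 hε hε1
  have hr0 : 0 ≤ r := by positivity
  -- Constant weights measure the masses of the cells.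
  have hmass : ∀ i, |P.real (lagCell X y z i) - P.real (lagCell X y z' i)| ≤ C₁ * r := by
    intro i
    have h := H₁ z' hvol ε hε hε1 1 (fun k _ => if k = i then 1 else 0)
      (fun k => measurable_const) (fun k x _ => by split_ifs <;> simp)
      (fun k x _ x' _ => by rw [sub_self, abs_zero]; positivity)
    simp only [ite_mul, one_mul, zero_mul, Finset.sum_ite_eq', Finset.mem_univ, if_true] at h
    rwa [hgibbs z' i, mul_one] at h
  set η := C₄ * (n * (C₁ * r)) with hη
  have hη0 : 0 ≤ η := by positivity
  have hosc : ∀ i j, |(z' i - z i) - (z' j - z j)| ≤ η := fun i j => by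
    refine (H₄ z z' (fun k => (half_le_self hc.le).trans (hz k)) hlow i j).trans ?_
    refine mul_le_mul_of_nonneg_left ?_ hC₄.le
    exact (Finset.sum_le_card_nsmul _ _ _ fun k _ => hmass k).trans_eq (by simp [n])
  have hosc' : ∀ i j, |(z i - z' i) - (z j - z' j)| ≤ η := fun i j => by
    rw [← abs_neg]
    refine le_trans (le_of_eq ?_) (hosc i j)
    congr 1; ring
  have hcells : ∀ i, ∫ x, |(lagCell X y z' i).indicator (1 : Euc d → ℝ) x -
      (lagCell X y z i).indicator 1 x| ∂P ≤ 2 * (M * (C₃ * η)) := by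
    intro i
    have h1 : (fun x => |(lagCell X y z' i).indicator (1 : Euc d → ℝ) x -
        (lagCell X y z i).indicator 1 x|) = fun x =>
        (lagCell X y z' i \ lagCell X y z i).indicator 1 x +
        (lagCell X y z i \ lagCell X y z' i).indicator 1 x := by
      funext x
      by_cases hx : x ∈ lagCell X y z i <;> by_cases hx' : x ∈ lagCell X y z' i <;>
        simp [hx, hx']
    have hd := (hcell' i).diff (hcell i)
    have hd' := (hcell i).diff (hcell' i)
    have hint : ∀ S, MeasurableSet S → Integrable (S.indicator (1 : Euc d → ℝ)) P := fun S hS =>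
      (integrable_const (1 : ℝ)).indicator hS
    rw [h1, integral_add (hint _ hd) (hint _ hd'), integral_indicator_one hd,
      integral_indicator_one hd']
    have e1 := (hPM _ (sdiff_subset.trans (lagCell_subset X y z' i)) hd).trans
      (mul_le_mul_of_nonneg_left (H₃ z' z η hη0 hosc' i) hM.le)
    have e2 := (hPM _ (sdiff_subset.trans (lagCell_subset X y z i)) hd').trans
      (mul_le_mul_of_nonneg_left (H₃ z z' η hη0 hosc i) hM.le)
    linarith
  have hψint : ∀ (g : ι → Euc d → ℝ), (∀ i, Measurable (g i)) → (∀ i x, |g i x| ≤ 1) →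
      ∀ i, Integrable (fun x => ψ i x * g i x) P := by
    intro g hgm hg i
    refine Integrable.of_bound ((hψm i).mul (hgm i)).aestronglyMeasurable (B * 1) ?_
    filter_upwards [hXae] with x hx
    rw [Real.norm_eq_abs, abs_mul]
    exact mul_le_mul (hψB i x hx) (hg i x) (abs_nonneg _) hB
  have habs : ∀ i x, |(lagCell X y z' i).indicator (1 : Euc d → ℝ) x -
      (lagCell X y z i).indicator 1 x| ≤ 1 := fun i x => by
    by_cases hx : x ∈ lagCell X y z i <;> by_cases hx' : x ∈ lagCell X y z' i <;> simp [hx, hx']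
  have i1 := hψint (fun i x => gibbs y z' ε i x - (lagCell X y z' i).indicator 1 x)
    (fun i => (measurable_gibbs y z' ε i).sub (measurable_one.indicator (hcell' i)))
    (fun i x => abs_gibbs_sub_indicator_le y z' ε i _ x)
  have hdm : ∀ i, Measurable fun x => (lagCell X y z' i).indicator (1 : Euc d → ℝ) x -
      (lagCell X y z i).indicator 1 x := fun i =>
    (measurable_one.indicator (hcell' i)).sub (measurable_one.indicator (hcell i))
  have i2 := hψint (fun i x => (lagCell X y z' i).indicator 1 x -
    (lagCell X y z i).indicator 1 x) hdm habs
  have hsplit : ∫ x, ∑ i, ψ i x * (gibbs y z' ε i x - (lagCell X y z i).indicator 1 x) ∂P =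
      (∫ x, ∑ i, ψ i x * (gibbs y z' ε i x - (lagCell X y z' i).indicator 1 x) ∂P) +
      ∑ i, ∫ x, ψ i x * ((lagCell X y z' i).indicator 1 x -
        (lagCell X y z i).indicator 1 x) ∂P := by
    rw [← integral_finsetSum _ fun i _ => i2 i, ← integral_add
      (integrable_finsetSum _ fun i _ => i1 i) (integrable_finsetSum _ fun i _ => i2 i)]
    refine integral_congr_ae (ae_of_all _ fun x => ?_)
    simp only [← Finset.sum_add_distrib]
    exact Finset.sum_congr rfl fun i _ => by ring
  have hsecond : |∑ i, ∫ x, ψ i x * ((lagCell X y z' i).indicator 1 x -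
        (lagCell X y z i).indicator 1 x) ∂P| ≤ n * (B * (2 * (M * (C₃ * η)))) := by
    refine (Finset.abs_sum_le_sum_abs _ _).trans ?_
    refine (Finset.sum_le_card_nsmul _ _ _ fun i _ => ?_).trans_eq
      (by rw [nsmul_eq_mul, Finset.card_univ])
    refine abs_integral_le_integral_abs.trans ?_
    refine le_trans ?_ (mul_le_mul_of_nonneg_left (hcells i) hB)
    rw [← integral_const_mul]
    have hbd : Integrable (fun x => |(lagCell X y z' i).indicator (1 : Euc d → ℝ) x -
        (lagCell X y z i).indicator 1 x|) P :=
      Integrable.of_bound (hdm i).abs.aestronglyMeasurable 1 (ae_of_all _ fun x => by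
        rw [Real.norm_eq_abs, abs_abs]; exact habs i x)
    refine integral_mono_of_nonneg (ae_of_all _ fun x => abs_nonneg _) (hbd.const_mul B) ?_
    filter_upwards [hXae] with x hx
    rw [abs_mul]
    exact mul_le_mul_of_nonneg_right (hψB i x hx) (abs_nonneg _)
  have hfirst := H₁ z' hvol ε hε hε1 B ψ hψm hψB hψα
  rw [hsplit]
  refine (abs_add_le _ _).trans ((add_le_add hfirst hsecond).trans ?_)
  calc C₁ * B * r + n * (B * (2 * (M * (C₃ * η)))) = C₅ * B * r := by
        simp only [hη, C₅]; ring
    _ ≤ C₅ * B * (2 * R) := mul_le_mul_of_nonneg_left hr (by positivity)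
    _ ≤ (2 * C₅ + n / ε₀ ^ 2) * B * R := by
        have : 0 ≤ n / ε₀ ^ 2 * B * R := by positivity
        linarith

end Comparison

/-! ### The target measure and the convergence rate -/

section Target

variable {d : ℕ} {Y : Finset (Euc d)} {c₀ : ℝ} {Q : Measure (Euc d)}

lemma TargetCondition.ae_mem_range (hQ : TargetCondition Y c₀ Q) :
    ∀ᵐ p ∂Q, p ∈ range (Subtype.val : Y → Euc d) := by
  have h : Q.support ∈ ae Q := Measure.support_mem_ae
  rw [hQ.support_eq] at h
  filter_upwards [h] with p hp
  exact ⟨⟨p, hp⟩, rfl⟩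

lemma TargetCondition.sum_measureReal (hQ : TargetCondition Y c₀ Q) :
    ∑ i : Y, Q.real {(i : Euc d)} = 1 := by
  have := hQ.isProbabilityMeasure
  have h := integral_eq_sum_of_mem_range Subtype.val_injective hQ.ae_mem_range
    fun _ => (1 : ℝ)
  simpa using h.symm

end Target

/-- Convergence rate of the entropic map to the Brenier map in the dual `α`-Hölder norm. -/
theorem corollary1 {d : ℕ} (α : ℝ) (hα : 0 < α) (hα' : α ≤ 1)
    (X : Set (Euc d)) (ρ : Euc d → ℝ) (P : Measure (Euc d)) (hP : SourceCondition X ρ P)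
    (Y : Finset (Euc d)) (c₀ : ℝ) (hc₀ : 0 < c₀) (hc₀' : c₀ < 1) :
    ∃ C : ℝ, ∀ Q : Measure (Euc d), TargetCondition Y c₀ Q →
      ∀ ε : ℝ, 0 < ε → ε < 1 →
      ∀ T₀ Tε : Euc d → Euc d, IsBrenierMap P Q T₀ → IsEntropicMap P Q ε Tε →
      ∃ ℓ₀ ℓε : StrongDual ℝ (HolderSpace α X),
        IsDualElement P T₀ ℓ₀ ∧ IsDualElement P Tε ℓε ∧
        ‖ℓε - ℓ₀‖ ≤ C * max (ε ^ (1 + α)) (ε ^ 2 * Real.log (1 / ε) ^ 3) := by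
  have hprob := hP.isProbabilityMeasure
  have hXm := hP.isCompact.measurableSet
  rcases isEmpty_or_nonempty Y with hY | hY
  · exact ⟨0, fun Q hQ => absurd hQ.sum_measureReal (by simp)⟩
  set y : Y → Euc d := Subtype.val
  have hy : Function.Injective y := Subtype.val_injective
  obtain ⟨C, hC, H⟩ := hP.exists_abs_integral_gibbs_sub_optimal_le hy hα hα' hc₀
  set R : ℝ := ∑ i, ‖y i‖
  have hR : 0 ≤ R := Finset.sum_nonneg fun i _ => norm_nonneg _
  have hyR : ∀ i, ‖y i‖ ≤ R := fun i =>
    Finset.single_le_sum (fun k _ => norm_nonneg (y k)) (Finset.mem_univ i)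
  refine ⟨C * R, fun Q hQ ε hε hε1 T₀ Tε hT₀ hTε => ?_⟩
  have hQprob := hQ.isProbabilityMeasure
  have hQr := hQ.ae_mem_range
  have hQi : ∀ i, c₀ ≤ Q.real {y i} := fun i => hQ.mass_ge _ i.2
  have hQpos : ∀ i, 0 < Q.real {y i} := fun i => hc₀.trans_le (hQi i)
  obtain ⟨m, M, hm, hM, hmM⟩ := hP.exists_bounds
  obtain ⟨z, hz⟩ := exists_measureReal_lagCell_eq hP.isCompact hy hP.measure_compl hM
    (fun S hS hSm => hP.measureReal_le hM.le (fun x hx => (hmM x hx).2) hS hSm)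
    hP.absolutelyContinuous hc₀ hQi hQ.sum_measureReal
  obtain ⟨z', hz'⟩ := exists_integral_gibbs_eq hP.isCompact hP.measure_compl hε hc₀ hQi
    hQ.sum_measureReal y
  have hB := hT₀.ae_exists_mem_lagCell hP.isCompact hy hP.ae_mem hP.absolutelyContinuous hQr hz
  have hE := hTε.ae_eq_sum_gibbs hε hP.isCompact hy hP.ae_mem hQr hQpos hz'
  have hbd₀ : ∀ᵐ x ∂P, ‖T₀ x‖ ≤ R := by
    filter_upwards [hB] with x ⟨i, hi, _⟩
    rw [hi]
    exact hyR i
  have hbdε : ∀ᵐ x ∂P, ‖Tε x‖ ≤ R := by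
    filter_upwards [hE] with x hx
    rw [hx]
    refine (norm_sum_le _ _).trans (Finset.sum_le_sum fun i _ => ?_)
    rw [norm_smul, Real.norm_of_nonneg (gibbs_nonneg i x)]
    exact mul_le_of_le_one_left (norm_nonneg _) (gibbs_le_one i x)
  obtain ⟨ℓ₀, hℓ₀, hℓ₀'⟩ := exists_isDualElement (X := X) hα hXm hT₀.1 hbd₀
  obtain ⟨ℓε, hℓε, hℓε'⟩ := exists_isDualElement (X := X) hα hXm hTε.1 hbdε
  refine ⟨ℓ₀, ℓε, hℓ₀, hℓε, ContinuousLinearMap.opNorm_le_bound _ ?_ fun φ => ?_⟩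
  · exact mul_nonneg (by positivity) (le_max_of_le_left (by positivity))
  have hPX : P.restrict X = P := Measure.restrict_eq_self_of_ae_mem hP.ae_mem
  have hXae := hP.ae_mem
  have hint : ∀ T : Euc d → Euc d, AEMeasurable T P → (∀ᵐ x ∂P, ‖T x‖ ≤ R) →
      Integrable (fun x => (inner ℝ (φ.extend x) (T x) : ℝ)) P := fun T hT hTR => by
    refine Integrable.of_bound (C := ‖φ‖ * R)
      ((φ.measurable_extend hα hXm).aestronglyMeasurable.inner hT.aestronglyMeasurable) ?_
    filter_upwards [hTR, hXae] with x h1 h2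
    exact (norm_inner_le_norm _ _).trans
      (mul_le_mul (φ.norm_extend_le h2) h1 (norm_nonneg _) (norm_nonneg _))
  have hac := hP.absolutelyContinuous.ae_le
    (ae_mem_lagCell_unique hP.isCompact.isBounded hXm hy z)
  have hmain : (ℓε - ℓ₀) φ = ∫ x, ∑ i, inner ℝ (φ.extend x) (y i) *
      (gibbs y z' ε i x - (lagCell X y z i).indicator 1 x) ∂P := by
    rw [sub_apply, hℓ₀', hℓε', hPX,
      ← integral_sub (hint _ hTε.1 hbdε) (hint _ hT₀.1 hbd₀)]
    refine integral_congr_ae ?_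
    filter_upwards [hE, hB, hac] with x hx ⟨i, hi, hxi⟩ hu
    have h1 : ∀ k, (lagCell X y z k).indicator (1 : Euc d → ℝ) x = if k = i then 1 else 0 := by
      intro k
      split_ifs with hk
      · rw [hk, indicator_of_mem hxi, Pi.one_apply]
      · exact indicator_of_notMem (fun h => hk (hu k i h hxi)) _
    simp only [h1, hx, hi, mul_sub, Finset.sum_sub_distrib, mul_ite, mul_one, mul_zero,
      Finset.sum_ite_eq', Finset.mem_univ, if_true, inner_sum, real_inner_smul_right]
    congr 1
    exact Finset.sum_congr rfl fun k _ => mul_comm _ _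
  rw [hmain, Real.norm_eq_abs]
  refine (H z z' ε hε hε1 (fun i => (hQi i).trans_eq (hz i).symm)
    (fun i => (hz' i).trans (hz i).symm) (‖φ‖ * R) (fun i x => inner ℝ (φ.extend x) (y i))
    (fun i => (φ.measurable_extend hα hXm).inner measurable_const) (fun i x hx => ?_)
    fun i x hx x' hx' => ?_).trans_eq (by ring)
  · exact (abs_real_inner_le_norm _ _).trans
      (mul_le_mul (φ.norm_extend_le hx) (hyR i) (norm_nonneg _) (norm_nonneg _))
  · rw [← inner_sub_left]
    refine (abs_real_inner_le_norm _ _).trans ((mul_le_mul (φ.norm_extend_sub_le hα hx hx') (hyR i)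
      (norm_nonneg _) (by positivity)).trans_eq (by ring))
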